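/- **Setting.** For $n\ge 2$ let $\theta_{(n)}=(\theta_1,\dots,\theta_n)$ be a random vector with an arbitrary joint law (deterministic, independent or dependent coordinates), and suppose that, conditionally on $\theta_{(n)}$, the observations $X_1,\dots,X_n$ are independent with $X_k\sim N(\theta_k,1)$. Let $G_n(x)=\frac1n\sum_{k=1}^n P\{\theta_k\le x\}$. For a distribution $G$ on $\mathbb R$ and Borel $t$ let $$R(t,G)=\int E_\theta\,(t(X)-\theta)^2\,dG(\theta)\quad (X\sim N(\theta,1)\text{ under }P_\theta),\qquad R^*(G)=\inf_{t\ \mathrm{Borel}}R(t,G).$$ **Estimator.** Let $\rho_0,b_0>0$ be constants, $\zeta_n\to0$ a real sequence with $1+\zeta_n>0$ for $n\ge2$, and $$\rho(n)=(1+\zeta_n)\rho_0\sqrt{2(\log n)/n},\qquad b(n)=b_0(\log n)/\sqrt n,\qquad \lambda_n=a_n=\sqrt{2\log n}.$$ With $K(x)=\sin(x)/(\pi x)$ (so $K(0)=1/\pi$) let $$\hat\varphi_n(x)=\frac1n\sum_{k=1}^n a_nK(a_n(x-X_k)),\qquad \hat\kappa_n=1-\frac1n\sum_{k=1}^n\sqrt2\,e^{-X_k^2/2}.$$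 The hybrid estimator is $\hat\theta_k=\tilde t_n(X_k)$, where $$\tilde t_n(x)=\begin{cases}x+\dfrac{\hat\varphi_n'(x)}{\max\{\hat\varphi_n(x),\rho(n)\}},&\hat\kappa_n>b(n),\\[2mm] \operatorname{sgn}(x)\,(|x|-\lambda_n)^+,&\hat\kappa_n\le b(n).\end{cases}$$ **Rates.** Let $\overline G(x)=\int_{|u|>x}dG(u)$ and $\mu_p(G)=\big(\int|u|^p\,dG(u)\big)^{1/p}\in[0,\infty]$, and for $C\in[0,\infty]$ let $$r_p(n,C)=\min\Big(1,\ \frac{C^p}{(\log n)^{p/2-1}},\ \max\Big[\frac{(\log n)^2}{\sqrt n},\Big\{\frac{C(\log n)^{3/2}}{\sqrt n}\Big\}^{p/(p+1)}\Big]\Big),$$ $$r_0(n,G)=\min\Big(1,\ \int_0^{\log n}\overline G(\sqrt u)\,du,\ \frac{(\log n)^2}{\sqrt n}+\inf_{x\ge1}\Big[\overline G(x)+x\,\frac{(\log n)^{3/2}}{\sqrt n}\Big]\Big).$$ **Theorem.** There is a constant $M<\infty$ depending only on $(\rho_0,b_0)$, and a real sequence $\eta_n\to0$ depending only on $n$,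 $\rho_0$, $b_0$ and the sequence $(\zeta_m)_{m\ge2}$, such that for all $n\ge2$, all joint laws of $\theta_{(n)}$ and all $0<p<\infty$, the losses $(\hat\theta_k-\theta_k)^2$ are integrable and $$\frac1n\sum_{k=1}^nE(\hat\theta_k-\theta_k)^2-R^*(G_n)\ \le\ M\min\big\{r_0(n,G_n),\ r_{p\wedge2}(n,\mu_p(G_n))\big\}+\frac{1+\eta_n}{n(\log n+1)^{3/2}}.$$ -/

import Mathlib

open MeasureTheory ProbabilityTheory Filter Topology
open scoped ENNReal

noncomputable section

namespace HybridGEB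

/-! ### The normal means model -/

/-- The normal means model: conditionally on `θ = (θ₁, …, θₙ)`, the observations `X₁, …, Xₙ` are
independent and `X k ∼ N(θ k, 1)`. The joint law of `θ` is arbitrary. -/
structure NormalMeans {Ω : Type*} [MeasurableSpace Ω] (P : Measure Ω) [IsProbabilityMeasure P]
    {n : ℕ} (θ X : Ω → Fin n → ℝ) : Prop where
  measurable_mean : Measurable θ
  measurable_obs : Measurable X
  condLaw : ∀ᵐ t ∂(P.map θ), condDistrib X θ P t = Measure.pi fun k => gaussianReal (t k) 1

/-- The mixture `Gₙ = n⁻¹ ∑ₖ P{θₖ ∈ ·}` of the marginal distributions of `θ₁, …, θₙ`. -/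
def mixture {Ω : Type*} [MeasurableSpace Ω] (P : Measure Ω) {n : ℕ} (θ : Ω → Fin n → ℝ) :
    Measure ℝ :=
  (n : ℝ≥0∞)⁻¹ • ∑ k, P.map fun ω => θ ω k

/-- The Bayes risk `R(t, G) = ∫ E_θ (t(X) - θ)² dG(θ)`, `X ∼ N(θ, 1)`, possibly infinite. -/
def bayesRisk (t : ℝ → ℝ) (G : Measure ℝ) : ℝ≥0∞ :=
  ∫⁻ u, ∫⁻ x, ENNReal.ofReal ((t x - u) ^ 2) ∂(gaussianReal u 1) ∂G

/-- The ideal Bayes risk `R*(G) = inf_t R(t, G)` over all Borel functions `t`. (It is at most `1`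
for a probability measure `G`, by `t(x) = x`.) -/
def idealRisk (G : Measure ℝ) : ℝ :=
  (⨅ (t : ℝ → ℝ) (_ : Measurable t), bayesRisk t G).toReal

/-! ### The hybrid general empirical Bayes estimator -/

/-- The kernel `K(x) = sin x / (π x)`, with `K(0) = 1 / π`. -/
def kern (x : ℝ) : ℝ := Real.sinc x / Real.pi

/-- The kernel estimator `φ̂ₙ(y) = n⁻¹ ∑ₖ aₙ K(aₙ (y - xₖ))` with `aₙ = √(2 log n)`. -/
def phiHat {n : ℕ} (x : Fin n → ℝ) (y : ℝ) : ℝ :=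
  (1 / n) * ∑ k, √(2 * Real.log n) * kern (√(2 * Real.log n) * (y - x k))

/-- The general empirical Bayes rule `y + φ̂ₙ'(y) / max(φ̂ₙ(y), ρ)`. -/
def gebRule {n : ℕ} (ρ : ℝ) (x : Fin n → ℝ) (y : ℝ) : ℝ :=
  y + deriv (phiHat x) y / max (phiHat x y) ρ

/-- Soft thresholding `sgn(y) (|y| - l)⁺`. -/
def softThreshold (l y : ℝ) : ℝ := Real.sign y * max (|y| - l) 0

/-- `κ̂ₙ = 1 - n⁻¹ ∑ₖ √2 exp(-xₖ² / 2)`. -/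
def kappaHat {n : ℕ} (x : Fin n → ℝ) : ℝ :=
  1 - (1 / n) * ∑ k, √2 * Real.exp (-(x k) ^ 2 / 2)

open Classical in
/-- The hybrid rule: the general empirical Bayes rule if `κ̂ₙ > b`, and soft thresholding at level
`l` if `κ̂ₙ ≤ b`. -/
def hybridRule {n : ℕ} (ρ l b : ℝ) (x : Fin n → ℝ) (y : ℝ) : ℝ :=
  if b < kappaHat x then gebRule ρ x y else softThreshold l y

/-! ### The terms of the oracle inequality -/

/-- The tail `Ḡ(x) = G{u : |u| > x}`. -/
def tail (G : Measure ℝ) (x : ℝ) : ℝ := G.real {u | x < |u|}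

/-- `μ_p(G) = (∫ |u|^p dG(u))^{1/p}`, possibly infinite. -/
def moment (p : ℝ) (G : Measure ℝ) : ℝ≥0∞ :=
  (∫⁻ u, ENNReal.ofReal (|u| ^ p) ∂G) ^ (1 / p)

/-- `r_p(n, C) = min(1, C^p / (log n)^{p/2-1},
  max[(log n)² / √n, {C (log n)^{3/2} / √n}^{p/(p+1)}])` for `0 ≤ C ≤ ∞`, so that
`r_p(n, ∞) = 1`. -/
def rMoment (p : ℝ) (n : ℕ) (C : ℝ≥0∞) : ℝ :=
  (min 1 (min (C ^ p / ENNReal.ofReal (Real.log n ^ (p / 2 - 1)))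
    (max (ENNReal.ofReal (Real.log n ^ 2 / √n))
      ((C * ENNReal.ofReal (Real.log n ^ (3 / 2 : ℝ) / √n)) ^ (p / (p + 1)))))).toReal

/-- `r₀(n, G) = min(1, ∫₀^{log n} Ḡ(√u) du,
  (log n)² / √n + inf_{x ≥ 1} [Ḡ(x) + x (log n)^{3/2} / √n])`. -/
def rTail (n : ℕ) (G : Measure ℝ) : ℝ :=
  min 1 (min (∫ u in (0 : ℝ)..Real.log n, tail G √u)
    (Real.log n ^ 2 / √n +
      ⨅ x : Set.Ici (1 : ℝ), (tail G x + x * (Real.log n ^ (3 / 2 : ℝ) / √n))))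

end HybridGEB

end

open MeasureTheory ProbabilityTheory Filter Topology
open scoped ENNReal

noncomputable section

namespace HybridGEB

/-! The inequality is first proved for deterministic means, against every separable rule `t` at once
(`avg_hybridRisk_le`), and then integrated over the law of the means. This works because `sepRisk`
integrates to the Bayes risk under `mixture P θ`, and each error bound is a constant plus an average
over the means of a function of one mean, so it integrates to a functional of the mixture
(`risk_sub_idealRisk_le`). The infimum over `t` comes last.

Regret of the empirical Bayes rule. Write `f = mixDens θ` and `a = √(2 log n)`. The best separable
rule is `y + f'/f` (Tweedie), and `y + s` has excess risk `∫ f (s - f'/f)²` (`mixLoss_eq`). The sinc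
kernel has the indicator of `[-a, a]` as Fourier transform, so its bias comes only from the Gaussian
frequencies beyond `a` and is at most `exp(-a²/2) = 1/n`, while the variance is of order at most
`a/n` for the density and `a³/n` for its derivative. Hence the regret at `y` is at most a multiple
of `min(a³/(n max(f, ρ)), f)`, plus a regularization bias present only where `f < ρ`
(`lintegral_score_regret_le`). Its integral is split at `|y| = T`, the outside being a Gaussian tail
(`tailLoss`). With `T = x + a` one gets the tail rate `(log n)²/√n + tailAvg θ x + x (log
n)^{3/2}/√n`. If most means are near zero, `f` is at least a multiple of the normal density on `|y|
≤ T` with `exp(-T²/2) = 25ρ`; no regularization occurs there, and the bound improves to a multiple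
of `log n/√n + truncSq θ 1`. An observation also enters its own estimated score; replacing it there
by an independent copy costs a relative error `a²/(nρ)` (`lintegral_self_le`).

Thresholding and the pretest. Soft thresholding at `a` has risk at most `12 truncSq θ (2 log n) +
6φ(a)/a³`. The mean `κ` of `kappaHat` is comparable to `truncSq θ 1`, and `kappaHat` deviates from
it by `b/2` with probability at most `n⁻⁴` in each direction. If `κ ≤ b/2`, thresholding is used
almost surely, and its remainder, with constant `3/(2√π) < 1` over `n (log n)^{3/2}`, fits into the
additive term of the theorem. If `κ > b/2`, then `log n/√n` is at most a multiple of the target rate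
and absorbs all remainders. For `b/2 < κ ≤ 2b` both rules attain the rate and both risks are paid;
for `κ > 2b` thresholding is rare.

The moment rates follow from the tail rate by Markov's inequality, interpolation and a choice of `x`
(`rTail_le_rMoment`). The finitely many `n` that are not large are absorbed by `η`. -/

/-- The standard normal density. -/
def phi (x : ℝ) : ℝ := Real.exp (-x ^ 2 / 2) / √(2 * Real.pi)

lemma phi_pos (x : ℝ) : 0 < phi x := by unfold phi; positivity

lemma continuous_phi : Continuous phi := by unfold phi; fun_prop

lemma gaussianPDFReal_one (t y : ℝ) : gaussianPDFReal t 1 y = phi (y - t) := by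
  simp [gaussianPDFReal, phi, div_eq_inv_mul]

/-! ### The sinc kernel as a band-limited function -/

/-- The kernel at bandwidth `1 / a`. -/
def bandKernel (a y : ℝ) : ℝ := a * kern (a * y)

/-- The derivative of `bandKernel a`. -/
def bandKernelDeriv (a y : ℝ) : ℝ :=
  -(2 * Real.pi)⁻¹ * ∫ w in -a..a, w * Real.sin (w * y)

lemma bandKernel_zero (a : ℝ) : bandKernel a 0 = a / Real.pi := by
  simp [bandKernel, kern]; ring

/-- The factor `y` cancels the denominator and leaves a bounded sine: this is the `1/|y|` decay of
the kernel. Differentiating the identity gives the same decay for the derivative. -/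
lemma mul_bandKernel (a y : ℝ) : y * bandKernel a y = Real.sin (a * y) / Real.pi := by
  unfold bandKernel kern
  by_cases h : a * y = 0
  · rcases mul_eq_zero.1 h with h | h <;> simp [h]
  · rw [Real.sinc_of_ne_zero h]
    have h1 : a ≠ 0 := left_ne_zero_of_mul h
    have h2 : y ≠ 0 := right_ne_zero_of_mul h
    field_simp

/-- The kernel is the inverse Fourier transform of the indicator of `[-a, a]`. Differentiation and
Gaussian averaging can then be carried out frequency by frequency. -/
lemma bandKernel_eq_integral (a y : ℝ) :
    bandKernel a y = (2 * Real.pi)⁻¹ * ∫ w in -a..a, Real.cos (w * y) := by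
  by_cases hy : y = 0
  · subst hy
    simp [bandKernel_zero]
    field_simp; ring
  · rw [intervalIntegral.integral_comp_mul_right _ hy, integral_cos]
    have := mul_bandKernel a y
    have h2 : bandKernel a y = Real.sin (a * y) / Real.pi / y := by
      rw [← this]; field_simp
    rw [h2, neg_mul, Real.sin_neg]
    simp only [smul_eq_mul]
    field_simp; ring

lemma hasDerivAt_bandKernel (a y : ℝ) :
    HasDerivAt (bandKernel a) (bandKernelDeriv a y) y := by
  have h0 : bandKernel a = fun y => (2 * Real.pi)⁻¹ * ∫ w in -a..a, Real.cos (w * y) := by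
    ext y; exact bandKernel_eq_integral a y
  have key := intervalIntegral.hasDerivAt_integral_of_dominated_loc_of_deriv_le
    (μ := volume) (a := -a) (b := a) (F := fun y w => Real.cos (w * y))
    (F' := fun y w => - (w * Real.sin (w * y))) (x₀ := y) (s := Set.univ)
    (bound := fun w => |w|) Filter.univ_mem
    (Eventually.of_forall fun x => (by fun_prop : Continuous fun w : ℝ =>
      Real.cos (w * x)).aestronglyMeasurable)
    ((by fun_prop : Continuous fun w : ℝ => Real.cos (w * y)).intervalIntegrable _ _)
    ((by fun_prop : Continuous fun w : ℝ => -(w * Real.sin (w * y))).aestronglyMeasurable)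
    (ae_of_all _ fun w _ x _ => by
      rw [norm_neg, norm_mul, Real.norm_eq_abs, Real.norm_eq_abs]
      exact mul_le_of_le_one_right (abs_nonneg _) (Real.abs_sin_le_one _))
    ((by fun_prop : Continuous fun w : ℝ => |w|).intervalIntegrable _ _)
    (ae_of_all _ fun w _ x _ => by
      have := (Real.hasDerivAt_cos (w * x)).comp x ((hasDerivAt_id x).const_mul w)
      exact this.congr_deriv (by simp; ring))
  have h2 := key.2.const_mul (2 * Real.pi)⁻¹
  rw [h0]
  exact h2.congr_deriv (by rw [intervalIntegral.integral_neg, bandKernelDeriv]; ring)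

lemma mul_bandKernelDeriv (a y : ℝ) :
    y * bandKernelDeriv a y = a * Real.cos (a * y) / Real.pi - bandKernel a y := by
  have h1 := (hasDerivAt_id y).mul (hasDerivAt_bandKernel a y)
  have h2 : HasDerivAt (fun y => Real.sin (a * y) / Real.pi) (Real.cos (a * y) * (a * 1) / Real.pi) y :=
    (((hasDerivAt_id y).const_mul a).sin).div_const _
  have h3 : (id * bandKernel a) = fun y => Real.sin (a * y) / Real.pi := by
    ext z; simpa using mul_bandKernel a z
  rw [h3] at h1
  have := h1.unique h2
  simp only [id] at this
  rw [eq_sub_iff_add_eq, add_comm, ← one_mul (bandKernel a y), this, mul_one, mul_comm (Real.cos _)]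

lemma abs_bandKernel_le {a : ℝ} (ha : 0 ≤ a) (y : ℝ) : |bandKernel a y| ≤ a / Real.pi := by
  rw [bandKernel_eq_integral, abs_mul, abs_of_pos (by positivity)]
  have := intervalIntegral.norm_integral_le_of_norm_le_const (a := -a) (b := a) (C := 1)
    (f := fun w => Real.cos (w * y)) (fun w _ => Real.abs_cos_le_one _)
  rw [Real.norm_eq_abs, abs_of_nonneg (by linarith : 0 ≤ a - -a)] at this
  calc _ ≤ (2 * Real.pi)⁻¹ * (1 * (a - -a)) := by gcongr
    _ = _ := by field_simp; ring

lemma abs_bandKernelDeriv_le {a : ℝ} (ha : 0 ≤ a) (y : ℝ) :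
    |bandKernelDeriv a y| ≤ a ^ 2 / Real.pi := by
  rw [bandKernelDeriv, abs_mul, abs_neg, abs_of_pos (by positivity)]
  have := intervalIntegral.norm_integral_le_of_norm_le_const (a := -a) (b := a) (C := a)
    (f := fun w => w * Real.sin (w * y)) (fun w hw => by
      rw [Set.uIoc_of_le (by linarith)] at hw
      rw [norm_mul, Real.norm_eq_abs, Real.norm_eq_abs]
      have h1 : |w| ≤ a := abs_le.2 ⟨hw.1.le, hw.2⟩
      calc |w| * |Real.sin (w * y)| ≤ a * 1 := by
            gcongr; exact Real.abs_sin_le_one _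
        _ = a := mul_one a)
  rw [Real.norm_eq_abs, abs_of_nonneg (by linarith : 0 ≤ a - -a)] at this
  calc _ ≤ (2 * Real.pi)⁻¹ * (a * (a - -a)) := by gcongr
    _ = _ := by field_simp; ring

/-- An integrable envelope for the squared kernel. -/
def envelope (a y : ℝ) : ℝ := a ^ 2 / (1 + (a * y) ^ 2)

lemma envelope_nonneg (a y : ℝ) : 0 ≤ envelope a y := by unfold envelope; positivity

/-- The bound `a/π` controls the term `1` of the denominator and the decay `1/(π|y|)` controls
`(ay)²`; each contributes at most `a²/9`. -/
lemma bandKernel_sq_le {a : ℝ} (ha : 0 ≤ a) (y : ℝ) : bandKernel a y ^ 2 ≤ envelope a y := by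
  have hpi : (3:ℝ) < Real.pi := Real.pi_gt_three
  rw [envelope, le_div_iff₀ (by positivity)]
  have h1 : bandKernel a y ^ 2 ≤ (a / 3) ^ 2 := by
    rw [← sq_abs]; gcongr
    exact (abs_bandKernel_le ha y).trans (by gcongr)
  have h2 : (y * bandKernel a y) ^ 2 ≤ (1 / 3) ^ 2 := by
    rw [mul_bandKernel, ← sq_abs, abs_div, abs_of_pos Real.pi_pos]
    gcongr
    exact Real.abs_sin_le_one _
  have h3 : a ^ 2 * (y * bandKernel a y) ^ 2 ≤ a ^ 2 * (1 / 3) ^ 2 := by gcongr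
  nlinarith [sq_nonneg a]

lemma bandKernelDeriv_sq_le {a : ℝ} (ha : 0 ≤ a) (y : ℝ) :
    bandKernelDeriv a y ^ 2 ≤ a ^ 2 * envelope a y := by
  have hpi : (3:ℝ) < Real.pi := Real.pi_gt_three
  rw [envelope, ← mul_div_assoc, le_div_iff₀ (by positivity)]
  have h1 : bandKernelDeriv a y ^ 2 ≤ (a ^ 2 / 3) ^ 2 := by
    rw [← sq_abs]; gcongr
    exact (abs_bandKernelDeriv_le ha y).trans (by gcongr)
  have h2 : (y * bandKernelDeriv a y) ^ 2 ≤ (2 * a / 3) ^ 2 := by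
    rw [mul_bandKernelDeriv, ← sq_abs]
    gcongr
    have h4 : |a * Real.cos (a * y) / Real.pi| ≤ a / 3 := by
      rw [abs_div, abs_of_pos Real.pi_pos, abs_mul, abs_of_nonneg ha]
      have := Real.abs_cos_le_one (a * y)
      gcongr
      exact mul_le_of_le_one_right ha this
    have h5 : |bandKernel a y| ≤ a / 3 := (abs_bandKernel_le ha y).trans (by gcongr)
    calc _ ≤ |a * Real.cos (a * y) / Real.pi| + |bandKernel a y| := abs_sub _ _
      _ ≤ _ := by linarith
  have h3 : a ^ 2 * (y * bandKernelDeriv a y) ^ 2 ≤ a ^ 2 * (2 * a / 3) ^ 2 := by gcongr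
  nlinarith [sq_nonneg a, sq_nonneg (a^2)]

lemma continuous_bandKernel (a : ℝ) : Continuous (bandKernel a) :=
  continuous_iff_continuousAt.2 fun y => (hasDerivAt_bandKernel a y).continuousAt

lemma continuous_bandKernelDeriv (a : ℝ) : Continuous (bandKernelDeriv a) := by
  unfold bandKernelDeriv
  refine continuous_const.mul ?_
  exact intervalIntegral.continuous_parametric_intervalIntegral_of_continuous' (by fun_prop) _ _

/-! ### Bias of the kernel -/

lemma integral_cexp_gaussianReal (t w : ℝ) :
    ∫ x, Complex.exp (w * x * Complex.I) ∂(gaussianReal t 1)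
      = Complex.exp (w * t * Complex.I) * Real.exp (-w ^ 2 / 2) := by
  have := charFun_gaussianReal (μ := t) (v := 1) w
  rw [charFun_apply_real] at this
  rw [this]
  push_cast
  rw [← Complex.exp_add]
  congr 1; ring

lemma integral_cos_gaussianReal (t y w : ℝ) :
    ∫ x, Real.cos (w * (y - x)) ∂(gaussianReal t 1)
      = Real.cos (w * (y - t)) * Real.exp (-w ^ 2 / 2) := by
  have h := integral_cexp_gaussianReal t (-w)
  have h1 : ∀ x : ℝ, Real.cos (w * (y - x))
      = (Complex.exp (w * y * Complex.I) * Complex.exp ((-w : ℝ) * x * Complex.I)).re := by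
    intro x
    rw [← Complex.exp_add, show (w:ℂ) * y * Complex.I + (-w : ℝ) * x * Complex.I
      = ((w * (y - x) : ℝ) : ℂ) * Complex.I by push_cast; ring, Complex.exp_ofReal_mul_I_re]
  have hint : Integrable (fun x : ℝ => Complex.exp (w * y * Complex.I) *
      Complex.exp ((-w : ℝ) * x * Complex.I)) (gaussianReal t 1) := by
    refine Integrable.const_mul ?_ _
    refine Integrable.of_bound (C := 1) (by fun_prop) (ae_of_all _ fun x => ?_)
    rw [show ((-w : ℝ):ℂ) * x * Complex.I = ((-w * x : ℝ) : ℂ) * Complex.I by push_cast; ring,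
      Complex.norm_exp_ofReal_mul_I]
  simp_rw [h1]
  have h2 := integral_re hint
  simp only [RCLike.re_eq_complex_re] at h2
  rw [h2, integral_const_mul, h, ← mul_assoc, ← Complex.exp_add, Complex.re_mul_ofReal,
    show (w:ℂ) * y * Complex.I + (-w : ℝ) * t * Complex.I
      = ((w * (y - t) : ℝ) : ℂ) * Complex.I by push_cast; ring, Complex.exp_ofReal_mul_I_re]
  simp

/-- The sine is the cosine after a quarter period, that is, after shifting `y` by `π/(2w)`. -/
lemma integral_sin_gaussianReal (t y w : ℝ) :
    ∫ x, Real.sin (w * (y - x)) ∂(gaussianReal t 1)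
      = Real.sin (w * (y - t)) * Real.exp (-w ^ 2 / 2) := by
  by_cases hw : w = 0
  · simp [hw]
  have h := integral_cos_gaussianReal t (y - Real.pi / 2 / w) w
  have h1 : ∀ x, Real.cos (w * (y - Real.pi / 2 / w - x)) = Real.sin (w * (y - x)) := by
    intro x
    rw [show w * (y - Real.pi / 2 / w - x) = w * (y - x) - Real.pi / 2 by field_simp; ring,
      Real.cos_sub_pi_div_two]
  simpa [h1] using h

lemma integral_gaussianReal_one (t : ℝ) (F : ℝ → ℝ) :
    ∫ x, F x ∂(gaussianReal t 1) = ∫ x, phi (x - t) * F x := by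
  rw [integral_gaussianReal_eq_integral_smul (by simp)]
  simp [gaussianPDFReal_one]

lemma integrable_exp_half : Integrable (fun w : ℝ => Real.exp (-w ^ 2 / 2)) := by
  have := integrable_exp_neg_mul_sq (b := 1/2) (by norm_num)
  refine this.congr (ae_of_all _ fun w => ?_)
  simp only; congr 1; ring

lemma integrable_mul_exp_half : Integrable (fun w : ℝ => w * Real.exp (-w ^ 2 / 2)) := by
  have := integrable_mul_exp_neg_mul_sq (b := 1/2) (by norm_num)
  refine this.congr (ae_of_all _ fun w => ?_)
  simp only; congr 2; ring

/-- Fourier inversion for the normal density costs nothing: its characteristic function is again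
Gaussian, so frequency and position exchange roles. -/
lemma integral_cos_mul_exp (x : ℝ) :
    ∫ w, Real.cos (w * x) * Real.exp (-w ^ 2 / 2) = 2 * Real.pi * phi x := by
  have h := integral_cos_gaussianReal 0 0 (-x)
  rw [integral_gaussianReal_one] at h
  simp only [phi, sub_zero, zero_sub, mul_neg, neg_mul, neg_neg, mul_zero, Real.cos_zero, one_mul,
    neg_sq] at h
  have h2 : ∀ w, Real.exp (-w ^ 2 / 2) / √(2 * Real.pi) * Real.cos (x * w)
     = (√(2 * Real.pi))⁻¹ * (Real.cos (w * x) * Real.exp (-w ^ 2 / 2)) := by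
    intro w; rw [mul_comm x w]; ring
  simp_rw [h2, integral_const_mul] at h
  have hs : √(2 * Real.pi) ≠ 0 := by positivity
  have hs2 : √(2 * Real.pi) * √(2 * Real.pi) = 2 * Real.pi := Real.mul_self_sqrt (by positivity)
  rw [phi, ← h]
  generalize (∫ a, Real.cos (a * x) * Real.exp (-a ^ 2 / 2)) = J
  rw [← hs2, Real.sqrt_mul_self (by positivity)]; field_simp

lemma hasDerivAt_phi (x : ℝ) : HasDerivAt phi (-x * phi x) x := by
  unfold phi
  have h := (((hasDerivAt_id x).pow 2).neg.div_const 2).exp.div_const (√(2 * Real.pi))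
  exact h.congr_deriv (by simp; ring)

/-- Differentiate the cosine identity in `x` under the integral sign. -/
lemma integral_mul_sin_mul_exp (x : ℝ) :
    ∫ w, w * Real.sin (w * x) * Real.exp (-w ^ 2 / 2) = 2 * Real.pi * (x * phi x) := by
  have key := hasDerivAt_integral_of_dominated_loc_of_deriv_le
    (μ := volume) (F := fun y w => Real.cos (w * y) * Real.exp (-w ^ 2 / 2))
    (F' := fun y w => - (w * Real.sin (w * y) * Real.exp (-w ^ 2 / 2))) (x₀ := x) (s := Set.univ)
    (bound := fun w => |w * Real.exp (-w ^ 2 / 2)|) Filter.univ_mem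
    (Eventually.of_forall fun x => (by fun_prop : Continuous fun w : ℝ =>
      Real.cos (w * x) * Real.exp (-w ^ 2 / 2)).aestronglyMeasurable)
    (by
      refine integrable_exp_half.mono' (by fun_prop) (ae_of_all _ fun w => ?_)
      rw [norm_mul, Real.norm_eq_abs, Real.norm_eq_abs, Real.abs_exp]
      exact mul_le_of_le_one_left (Real.exp_pos _).le (Real.abs_cos_le_one _))
    ((by fun_prop : Continuous fun w : ℝ =>
      -(w * Real.sin (w * x) * Real.exp (-w ^ 2 / 2))).aestronglyMeasurable)
    (ae_of_all _ fun w y _ => by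
      rw [norm_neg, norm_mul, norm_mul, Real.norm_eq_abs, Real.norm_eq_abs, Real.norm_eq_abs,
        abs_mul]
      gcongr
      exact mul_le_of_le_one_right (abs_nonneg _) (Real.abs_sin_le_one _))
    integrable_mul_exp_half.abs
    (ae_of_all _ fun w y _ => by
      have := ((Real.hasDerivAt_cos (w * y)).comp y ((hasDerivAt_id y).const_mul w)).mul_const
        (Real.exp (-w ^ 2 / 2))
      exact this.congr_deriv (by simp; ring))
  have h2 := key.2
  simp_rw [integral_cos_mul_exp] at h2
  have h3 := h2.unique ((hasDerivAt_phi x).const_mul (2 * Real.pi))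
  rw [integral_neg] at h3
  linarith

lemma integral_Ioi_mul_exp_half (a : ℝ) :
    ∫ w in Set.Ioi a, w * Real.exp (-w ^ 2 / 2) = Real.exp (-a ^ 2 / 2) := by
  have hd : ∀ x ∈ Set.Ici a, HasDerivAt (fun x : ℝ => -Real.exp (-x ^ 2 / 2))
      (x * Real.exp (-x ^ 2 / 2)) x := fun x _ =>
    ((((hasDerivAt_id x).pow 2).neg.div_const 2).exp.neg).congr_deriv (by simp; ring)
  have ht : Tendsto (fun x : ℝ => -Real.exp (-x ^ 2 / 2)) atTop (𝓝 0) := by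
    rw [← neg_zero]
    refine (Real.tendsto_exp_atBot.comp ?_).neg
    have : Tendsto (fun x : ℝ => x ^ 2 / 2) atTop atTop :=
      (tendsto_pow_atTop (by norm_num)).atTop_div_const (by norm_num)
    refine (tendsto_neg_atTop_atBot.comp this).congr fun x => ?_
    simp; ring
  rw [integral_Ioi_of_hasDerivAt_of_tendsto' hd integrable_mul_exp_half.integrableOn ht]
  ring

lemma integral_compl_Ioc_abs_mul_exp_half {a : ℝ} (ha : 0 ≤ a) :
    ∫ w in (Set.Ioc (-a) a)ᶜ, |w| * Real.exp (-w ^ 2 / 2) = 2 * Real.exp (-a ^ 2 / 2) := by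
  have hI : Integrable (fun w : ℝ => |w| * Real.exp (-w ^ 2 / 2)) := by
    refine integrable_mul_exp_half.abs.congr (ae_of_all _ fun w => ?_)
    simp [abs_mul]
  have h1 : (Set.Ioc (-a) a)ᶜ = Set.Iic (-a) ∪ Set.Ioi a := by
    ext x; simp only [Set.mem_compl_iff, Set.mem_Ioc, Set.mem_union, Set.mem_Iic, Set.mem_Ioi]
    constructor
    · intro h; by_contra! h'; exact h ⟨h'.1, h'.2⟩
    · rintro (h | h) <;> intro h' <;> linarith [h'.1, h'.2]
  have h2 : ∫ w in Set.Ioi a, |w| * Real.exp (-w ^ 2 / 2) = Real.exp (-a ^ 2 / 2) := by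
    rw [← integral_Ioi_mul_exp_half]
    refine setIntegral_congr_fun measurableSet_Ioi fun x hx => ?_
    rw [abs_of_pos (ha.trans_lt hx)]
  have h3 : ∫ w in Set.Iic (-a), |w| * Real.exp (-w ^ 2 / 2) = Real.exp (-a ^ 2 / 2) := by
    rw [← h2]
    have := integral_comp_neg_Iic (-a) (fun w => |w| * Real.exp (-w ^ 2 / 2))
    simpa using this
  rw [h1, setIntegral_union (by
    rw [Set.disjoint_left]; intro x hx hx'; simp at hx hx'; linarith) measurableSet_Ioi
    hI.integrableOn hI.integrableOn, h2, h3]; ring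

/-- Averaging over the normal law multiplies frequency `w` by `exp(-w²/2)`, so the band-limited mean
and the full Fourier integral differ only by the frequencies outside `[-a, a]`. There `max 1 |w| =
|w|`, because `1 ≤ a`, and `|w| exp(-w²/2)` has an explicit tail integral. The general `p` serves
both the cosine (kernel) and `w` times the sine (derivative). -/
lemma abs_bandlimit_sub_le {a : ℝ} (ha : 1 ≤ a) (t y : ℝ) {p : ℝ → ℝ → ℝ}
    (hp : Continuous (Function.uncurry p)) (hb : ∀ w s, |p w s| ≤ max 1 |w|)
    (hg : ∀ w, ∫ x, p w (y - x) ∂(gaussianReal t 1) = p w (y - t) * Real.exp (-w ^ 2 / 2)) :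
    |∫ x, (2 * Real.pi)⁻¹ * (∫ w in -a..a, p w (y - x)) ∂(gaussianReal t 1)
      - (2 * Real.pi)⁻¹ * ∫ w, p w (y - t) * Real.exp (-w ^ 2 / 2)| ≤ Real.exp (-a ^ 2 / 2) := by
  have hle : -a ≤ a := by linarith
  have hpi : (3:ℝ) < Real.pi := Real.pi_gt_three
  have hI : Integrable (fun w : ℝ => p w (y - t) * Real.exp (-w ^ 2 / 2)) := by
    refine (integrable_exp_half.add integrable_mul_exp_half.abs).mono'
      (by fun_prop) (ae_of_all _ fun w => ?_)
    rw [norm_mul, Real.norm_eq_abs, Real.norm_eq_abs, Real.abs_exp, Pi.add_apply, abs_mul,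
      Real.abs_exp, ← one_add_mul]
    gcongr
    exact (hb w _).trans (max_le (by linarith [abs_nonneg w]) (by linarith))
  have hswap : ∫ x, (∫ w in -a..a, p w (y - x)) ∂(gaussianReal t 1)
      = ∫ w in -a..a, p w (y - t) * Real.exp (-w ^ 2 / 2) := by
    simp_rw [← hg, intervalIntegral.integral_of_le hle]
    refine integral_integral_swap ?_
    refine Integrable.of_bound (C := a) (by fun_prop) ?_
    have : ∀ᵐ z ∂((gaussianReal t 1).prod (volume.restrict (Set.Ioc (-a) a))),
        z.2 ∈ Set.Ioc (-a) a :=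
      Measure.quasiMeasurePreserving_snd.ae (ae_restrict_mem measurableSet_Ioc)
    filter_upwards [this] with z hz
    exact (hb _ _).trans (max_le ha (abs_le.2 ⟨hz.1.le, hz.2⟩))
  rw [integral_const_mul, hswap, ← mul_sub, intervalIntegral.integral_of_le hle,
    ← integral_add_compl measurableSet_Ioc hI, sub_add_cancel_left, abs_mul, abs_neg,
    abs_of_pos (by positivity)]
  have h1 : |∫ w in (Set.Ioc (-a) a)ᶜ, p w (y - t) * Real.exp (-w ^ 2 / 2)|
      ≤ ∫ w in (Set.Ioc (-a) a)ᶜ, |w| * Real.exp (-w ^ 2 / 2) := by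
    rw [← Real.norm_eq_abs]
    refine norm_integral_le_of_norm_le ?_ ?_
    · exact (integrable_mul_exp_half.abs.congr (ae_of_all _ fun w => by simp [abs_mul])).integrableOn
    · filter_upwards [ae_restrict_mem measurableSet_Ioc.compl] with w hw
      rw [norm_mul, Real.norm_eq_abs, Real.norm_eq_abs, Real.abs_exp]
      refine mul_le_mul_of_nonneg_right ((hb w _).trans (max_le ?_ le_rfl)) (Real.exp_pos _).le
      by_contra! h
      exact hw ⟨by linarith [(abs_lt.1 h).1], by linarith [(abs_lt.1 h).2]⟩
  rw [integral_compl_Ioc_abs_mul_exp_half (by linarith)] at h1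
  calc _ ≤ (2 * Real.pi)⁻¹ * (2 * Real.exp (-a ^ 2 / 2)) := by gcongr
    _ = Real.pi⁻¹ * Real.exp (-a ^ 2 / 2) := by field_simp
    _ ≤ 1 * Real.exp (-a ^ 2 / 2) := by
        gcongr; exact inv_le_one_of_one_le₀ (by linarith)
    _ = _ := one_mul _

/-- The kernel is nearly unbiased for the normal density. -/
lemma abs_integral_bandKernel_sub_le {a : ℝ} (ha : 1 ≤ a) (t y : ℝ) :
    |∫ x, bandKernel a (y - x) ∂(gaussianReal t 1) - phi (y - t)| ≤ Real.exp (-a ^ 2 / 2) := by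
  have h := abs_bandlimit_sub_le ha t y (p := fun w s => Real.cos (w * s)) (by fun_prop)
    (fun w s => (Real.abs_cos_le_one _).trans (le_max_left _ _))
    (fun w => integral_cos_gaussianReal t y w)
  simp only [integral_cos_mul_exp, ← bandKernel_eq_integral] at h
  rwa [inv_mul_cancel_left₀ (by positivity)] at h

lemma abs_integral_bandKernelDeriv_sub_le {a : ℝ} (ha : 1 ≤ a) (t y : ℝ) :
    |∫ x, bandKernelDeriv a (y - x) ∂(gaussianReal t 1) - -(y - t) * phi (y - t)|
      ≤ Real.exp (-a ^ 2 / 2) := by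
  have h := abs_bandlimit_sub_le ha t y (p := fun w s => -(w * Real.sin (w * s))) (by fun_prop)
    (fun w s => by
      rw [abs_neg, abs_mul]
      exact (mul_le_of_le_one_right (abs_nonneg _) (Real.abs_sin_le_one _)).trans (le_max_right _ _))
    (fun w => by rw [integral_neg, integral_const_mul, integral_sin_gaussianReal]; ring)
  simp only [neg_mul, integral_neg, integral_mul_sin_mul_exp, intervalIntegral.integral_neg] at h
  simp only [bandKernelDeriv]
  rw [mul_neg, inv_mul_cancel_left₀ (by positivity)] at h
  convert h using 2
  rw [neg_mul, sub_neg_eq_add, sub_neg_eq_add]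
  congr 1
  exact integral_congr_ae (ae_of_all _ fun x => by ring)

/-! ### Gaussian tails -/

lemma lintegral_gaussianReal_one (t : ℝ) {F : ℝ → ℝ≥0∞} (hF : Measurable F) :
    ∫⁻ x, F x ∂(gaussianReal t 1) = ∫⁻ x, ENNReal.ofReal (phi (x - t)) * F x := by
  rw [gaussianReal_of_var_ne_zero _ (by simp), lintegral_withDensity_eq_lintegral_mul _
    (measurable_gaussianPDF _ _) hF]
  simp [gaussianPDF, gaussianPDFReal_one]

lemma phi_even (x : ℝ) : phi (-x) = phi x := by simp [phi]

lemma phi_add_le {s y : ℝ} : phi (s + y) ≤ phi s * Real.exp (-(s * y)) := by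
  unfold phi
  rw [div_mul_eq_mul_div, ← Real.exp_add]
  gcongr
  nlinarith [sq_nonneg y]

lemma integral_tail_exp {s : ℝ} (hs : 0 < s) (A B : ℝ) :
    Integrable (fun y => (A + B * y ^ 2) * Real.exp (-(s * y))) (volume.restrict (Set.Ioi 0)) ∧
    ∫ y in Set.Ioi 0, (A + B * y ^ 2) * Real.exp (-(s * y)) = A / s + 2 * B / s ^ 3 := by
  have h1 := Real.integral_rpow_mul_exp_neg_mul_Ioi (a := 1) (r := s) (by norm_num) hs
  have h2 := Real.integral_rpow_mul_exp_neg_mul_Ioi (a := 3) (r := s) (by norm_num) hs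
  have i1 : IntegrableOn (fun y : ℝ => Real.exp (-(s * y))) (Set.Ioi 0) := by
    simpa using integrableOn_exp_mul_Ioi (a := -s) (by linarith) 0
  have i2 : IntegrableOn (fun y : ℝ => y ^ 2 * Real.exp (-(s * y))) (Set.Ioi 0) := by
    have := integrableOn_rpow_mul_exp_neg_mul_rpow (p := 1) (s := 2) (b := s) (by norm_num)
      (by norm_num) hs
    simpa using this
  have h3 : ∀ y : ℝ, (A + B * y ^ 2) * Real.exp (-(s * y)) =
      A * Real.exp (-(s * y)) + B * (y ^ 2 * Real.exp (-(s * y))) := fun y => by ring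
  simp_rw [h3]
  refine ⟨(i1.const_mul A).add (i2.const_mul B), ?_⟩
  rw [integral_add (i1.const_mul A) (i2.const_mul B), integral_const_mul, integral_const_mul]
  have h4 : Real.Gamma 3 = 2 := by
    have := Real.Gamma_nat_eq_factorial 2
    norm_num at this ⊢
  norm_num [h4] at h1 h2
  rw [show (∫ y in Set.Ioi 0, y ^ 2 * Real.exp (-(s * y))) = (s ^ 3)⁻¹ * 2 by
    rw [← h2], h1]
  ring

/-- A tail moment bound for the standard normal law. -/
lemma lintegral_tail_le {s A B : ℝ} (hs : 0 < s) (hA : 0 ≤ A) (hB : 0 ≤ B) :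
    ∫⁻ z, ENNReal.ofReal ((Set.Ioi s).indicator (fun v => A + B * (v - s) ^ 2) |z|)
      ∂(gaussianReal 0 1) ≤ ENNReal.ofReal (2 * phi s * (A / s + 2 * B / s ^ 3)) := by
  have hm : Measurable (fun v => (Set.Ioi s).indicator (fun v => A + B * (v - s) ^ 2) v) :=
    (by fun_prop : Measurable fun v => A + B * (v - s) ^ 2).indicator measurableSet_Ioi
  have hm2 : Measurable (fun v =>
      ENNReal.ofReal ((Set.Ioi s).indicator (fun v => A + B * (v - s) ^ 2) |v|)) :=
    (hm.comp measurable_abs).ennreal_ofReal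
  rw [lintegral_gaussianReal_one _ hm2]
  set G : ℝ → ℝ≥0∞ := fun z => ENNReal.ofReal (phi (z - 0)) *
    ENNReal.ofReal ((Set.Ioi s).indicator (fun v => A + B * (v - s) ^ 2) |z|) with hG
  have hGe : ∀ z, G (-z) = G z := by intro z; simp [hG, phi_even]
  have hGm : Measurable G :=
    (by have := continuous_phi; fun_prop : Measurable fun z => ENNReal.ofReal (phi (z - 0))).mul hm2
  have h1 : ∫⁻ z, G z = 2 * ∫⁻ z in Set.Ioi 0, G z := by
    rw [← lintegral_add_compl G measurableSet_Ioi (A := Set.Ioi (0:ℝ)), two_mul]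
    congr 1
    rw [Set.compl_Ioi, ← (Measure.measurePreserving_neg (volume : Measure ℝ)).setLIntegral_comp_preimage measurableSet_Iic hGm]
    simp only [hGe]
    simp only [Set.neg_preimage, Set.neg_Iic, neg_zero]
    exact setLIntegral_congr Ioi_ae_eq_Ici.symm
  have h2 : ∫⁻ z in Set.Ioi 0, G z ≤ ENNReal.ofReal (phi s * (A / s + 2 * B / s ^ 3)) := by
    obtain ⟨i1, i2⟩ := integral_tail_exp hs A B
    have hs0 : ∀ z, z ∈ Set.Ioi (0:ℝ) → z ∉ Set.Ioi s → G z = 0 := by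
      intro z hz hz'
      have : |z| ∉ Set.Ioi s := by rwa [abs_of_pos hz]
      simp [hG, Set.indicator_of_notMem this]
    calc ∫⁻ z in Set.Ioi 0, G z = ∫⁻ z in Set.Ioi s, G z := by
          rw [← lintegral_indicator measurableSet_Ioi, ← lintegral_indicator measurableSet_Ioi]
          refine lintegral_congr fun z => ?_
          by_cases hz : z ∈ Set.Ioi s
          · rw [Set.indicator_of_mem hz, Set.indicator_of_mem (show z ∈ Set.Ioi (0:ℝ) from hs.trans hz)]
          · rw [Set.indicator_of_notMem hz]
            by_cases hz0 : z ∈ Set.Ioi (0:ℝ)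
            · rw [Set.indicator_of_mem hz0, hs0 z hz0 hz]
            · rw [Set.indicator_of_notMem hz0]
      -- Seen from `s`, the normal density decays at least as fast as `exp(-s y)`, which reduces the
      -- tail moments to Gamma integrals.
      _ = ∫⁻ y in Set.Ioi 0, G (y + s) := by
          rw [← (measurePreserving_add_right (volume : Measure ℝ) s).setLIntegral_comp_preimage
            measurableSet_Ioi hGm]
          simp
      _ ≤ ∫⁻ y in Set.Ioi 0, ENNReal.ofReal (phi s * ((A + B * y ^ 2) * Real.exp (-(s * y)))) := by
          refine setLIntegral_mono' measurableSet_Ioi fun y hy => ?_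
          have hy' : (0:ℝ) < y := hy
          have hab : |y + s| = y + s := abs_of_pos (by linarith)
          simp only [hG, sub_zero, hab]
          rw [Set.indicator_of_mem (show y + s ∈ Set.Ioi s by simpa using hy'),
            ← ENNReal.ofReal_mul (phi_pos _).le, add_sub_cancel_right, add_comm y s]
          refine ENNReal.ofReal_le_ofReal ?_
          calc _ ≤ phi s * Real.exp (-(s * y)) * (A + B * y ^ 2) := by
                gcongr; exact phi_add_le
            _ = _ := by ring
      _ = ENNReal.ofReal (phi s * (A / s + 2 * B / s ^ 3)) := by
          rw [← ofReal_integral_eq_lintegral_ofReal (i1.const_mul _), integral_const_mul, i2]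
          exact ae_of_all _ fun y => by
            have := phi_pos s
            positivity
  rw [h1]
  calc _ ≤ 2 * ENNReal.ofReal (phi s * (A / s + 2 * B / s ^ 3)) := by gcongr
    _ = _ := by
      rw [mul_assoc, ENNReal.ofReal_mul zero_le_two, ENNReal.ofReal_ofNat]

/-! ### The normal mixture density -/

/-- The average of the normal densities centred at `θ`. -/
def mixDens {n : ℕ} (θ : Fin n → ℝ) (y : ℝ) : ℝ := (1 / n) * ∑ k, phi (y - θ k)

/-- The derivative of `mixDens θ`. -/
def mixDeriv {n : ℕ} (θ : Fin n → ℝ) (y : ℝ) : ℝ := (1 / n) * ∑ k, -(y - θ k) * phi (y - θ k)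

/-- The second moment of `y - θ` against the normal densities. -/
def mixSq {n : ℕ} (θ : Fin n → ℝ) (y : ℝ) : ℝ := (1 / n) * ∑ k, (y - θ k) ^ 2 * phi (y - θ k)

lemma continuous_mixDens {n : ℕ} (θ : Fin n → ℝ) : Continuous (mixDens θ) := by
  have := continuous_phi; unfold mixDens; fun_prop

lemma continuous_mixDeriv {n : ℕ} (θ : Fin n → ℝ) : Continuous (mixDeriv θ) := by
  have := continuous_phi; unfold mixDeriv; fun_prop

lemma mixDens_pos {n : ℕ} (hn : 0 < n) (θ : Fin n → ℝ) (y : ℝ) : 0 < mixDens θ y := by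
  have : Nonempty (Fin n) := ⟨⟨0, hn⟩⟩
  have hn' : (0:ℝ) < n := by exact_mod_cast hn
  unfold mixDens
  have : 0 < ∑ k, phi (y - θ k) := Finset.sum_pos (fun k _ => phi_pos _) Finset.univ_nonempty
  positivity

lemma mixSq_nonneg {n : ℕ} (θ : Fin n → ℝ) (y : ℝ) : 0 ≤ mixSq θ y := by
  unfold mixSq
  exact mul_nonneg (by positivity)
    (Finset.sum_nonneg fun k _ => mul_nonneg (sq_nonneg _) (phi_pos _).le)

/-- Cauchy–Schwarz with the normal densities as weights, each split as `√φ · √φ`. -/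
lemma mixDeriv_sq_le {n : ℕ} (θ : Fin n → ℝ) (y : ℝ) :
    mixDeriv θ y ^ 2 ≤ mixDens θ y * mixSq θ y := by
  unfold mixDeriv mixDens mixSq
  have h := Finset.sum_mul_sq_le_sq_mul_sq Finset.univ (fun k => √(phi (y - θ k)))
    (fun k => -(y - θ k) * √(phi (y - θ k)))
  have h1 : ∀ k, √(phi (y - θ k)) * (-(y - θ k) * √(phi (y - θ k)))
      = -(y - θ k) * phi (y - θ k) := fun k => by
    rw [mul_left_comm, Real.mul_self_sqrt (phi_pos _).le]
  have h2 : ∀ k, (-(y - θ k) * √(phi (y - θ k))) ^ 2 = (y - θ k) ^ 2 * phi (y - θ k) := fun k => by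
    rw [mul_pow, Real.sq_sqrt (phi_pos _).le]; ring
  simp only [h1, h2, fun k => Real.sq_sqrt (phi_pos (y - θ k)).le] at h
  calc _ = (1 / (n:ℝ)) ^ 2 * (∑ k, -(y - θ k) * phi (y - θ k)) ^ 2 := by ring
    _ ≤ (1 / (n:ℝ)) ^ 2 * ((∑ k, phi (y - θ k)) * ∑ k, (y - θ k) ^ 2 * phi (y - θ k)) := by gcongr
    _ = _ := by ring

lemma phi_le_half (x : ℝ) : phi x ≤ Real.exp (-x ^ 2 / 2) / 2 := by
  unfold phi
  gcongr
  refine Real.le_sqrt_of_sq_le ?_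
  nlinarith [Real.pi_gt_three]

lemma phi_le (x : ℝ) : phi x ≤ 1 / 2 :=
  (phi_le_half x).trans (by gcongr; rw [Real.exp_le_one_iff]; nlinarith [sq_nonneg x])

/-- For `|d| ≤ a` the first term suffices. Beyond `a`, the function `d² exp(-d²/2)` is decreasing,
so its value at `a` bounds it. -/
lemma sq_mul_phi_le {a : ℝ} (ha : 2 ≤ a) (d : ℝ) :
    d ^ 2 * phi d ≤ a ^ 2 * phi d + a ^ 2 * Real.exp (-a ^ 2 / 2) := by
  have hp := phi_pos d
  rcases le_total (d ^ 2) (a ^ 2) with h | h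
  · have : 0 ≤ a ^ 2 * Real.exp (-a ^ 2 / 2) := by positivity
    nlinarith
  · have h1 : d ^ 2 * Real.exp (-d ^ 2 / 2) ≤ a ^ 2 * Real.exp (-a ^ 2 / 2) := by
      have h2 := Real.add_one_le_exp ((d ^ 2 - a ^ 2) / 2)
      have h3 : Real.exp (-a ^ 2 / 2) = Real.exp ((d ^ 2 - a ^ 2) / 2) * Real.exp (-d ^ 2 / 2) := by
        rw [← Real.exp_add]; congr 1; ring
      rw [h3, ← mul_assoc]
      refine mul_le_mul_of_nonneg_right ?_ (Real.exp_pos _).le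
      have h4 : a ^ 2 * ((d ^ 2 - a ^ 2) / 2 + 1) ≤ a ^ 2 * Real.exp ((d ^ 2 - a ^ 2) / 2) := by
        gcongr
      nlinarith [mul_nonneg (show 0 ≤ a ^ 2 / 2 - 1 by nlinarith) (sub_nonneg.2 h)]
    have h2 := phi_le_half d
    nlinarith [sq_nonneg d, mul_pos (show 0 < a ^ 2 by positivity) hp]

lemma abs_mul_phi_le {a : ℝ} (ha : 2 ≤ a) (d : ℝ) :
    |d| * phi d ≤ a * phi d + a * Real.exp (-a ^ 2 / 2) := by
  have hp := phi_pos d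
  rcases le_total |d| a with h | h
  · have : 0 ≤ a * Real.exp (-a ^ 2 / 2) := by positivity
    nlinarith
  · have h1 := sq_mul_phi_le ha d
    rw [← sq_abs] at h1
    have h2 : a * (|d| * phi d) ≤ a * (a * phi d + a * Real.exp (-a ^ 2 / 2)) := by
      nlinarith [mul_nonneg (abs_nonneg d) hp.le]
    exact le_of_mul_le_mul_left h2 (by linarith)

/-- If `|s| ≤ a`, the exponential tilt is at most `exp(a|d|)`. If `|s| ≥ a`, then `|s + d| ≥ a -
|d|`, and the density is small by itself. -/
lemma phi_add_le_exp_mul {a : ℝ} (s d : ℝ) (hd : |d| ≤ a) :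
    phi (s + d) ≤ Real.exp (a * |d|) * (phi s + Real.exp (-a ^ 2 / 2)) := by
  have hpos : 0 < Real.exp (a * |d|) := Real.exp_pos _
  have he : 0 < Real.exp (-a ^ 2 / 2) := Real.exp_pos _
  rcases le_total |s| a with h | h
  · calc phi (s + d) ≤ phi s * Real.exp (-(s * d)) := phi_add_le
      _ ≤ phi s * Real.exp (a * |d|) := by
        have := phi_pos s
        gcongr
        calc -(s * d) ≤ |s * d| := neg_le_abs _
          _ = |s| * |d| := abs_mul _ _
          _ ≤ _ := by gcongr
      _ ≤ _ := by nlinarith [phi_pos s]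
  · have h1 : a - |d| ≤ |s + d| := by
      have := abs_sub_abs_le_abs_sub s (-d)
      rw [abs_neg, sub_neg_eq_add] at this; linarith
    have h2 : (a - |d|) ^ 2 ≤ (s + d) ^ 2 := by
      rw [← sq_abs (s + d)]; gcongr
    calc phi (s + d) ≤ Real.exp (-(s + d) ^ 2 / 2) / 2 := phi_le_half _
      _ ≤ Real.exp (-(s + d) ^ 2 / 2) := by linarith [Real.exp_pos (-(s + d) ^ 2 / 2)]
      _ ≤ Real.exp (a * |d| + -a ^ 2 / 2) := by
        gcongr; nlinarith [sq_nonneg d, sq_abs d]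
      _ ≤ _ := by rw [Real.exp_add]; nlinarith [phi_pos s]

section avg
variable {n : ℕ}

lemma avg_le_avg {f g : Fin n → ℝ} (h : ∀ k, f k ≤ g k) :
    (1 / (n:ℝ)) * ∑ k, f k ≤ (1 / (n:ℝ)) * ∑ k, g k := by
  gcongr with k; exact h k

lemma avg_const (hn : 0 < n) (c : ℝ) : (1 / (n:ℝ)) * ∑ _k : Fin n, c = c := by
  have hn' : (n:ℝ) ≠ 0 := by exact_mod_cast hn.ne'
  simp; field_simp

lemma avg_affine (hn : 0 < n) (c d : ℝ) (f : Fin n → ℝ) :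
    (1 / (n:ℝ)) * ∑ k, (c * f k + d) = c * ((1 / (n:ℝ)) * ∑ k, f k) + d := by
  rw [Finset.sum_add_distrib, mul_add, avg_const hn, ← Finset.mul_sum]; ring

end avg

lemma mixSq_le {n : ℕ} (hn : 0 < n) {a : ℝ} (ha : 2 ≤ a) (θ : Fin n → ℝ) (y : ℝ) :
    mixSq θ y ≤ a ^ 2 * mixDens θ y + a ^ 2 * Real.exp (-a ^ 2 / 2) := by
  unfold mixSq mixDens
  rw [← avg_affine hn]
  exact avg_le_avg fun k => sq_mul_phi_le ha _

lemma abs_mixDeriv_le {n : ℕ} (hn : 0 < n) {a : ℝ} (ha : 2 ≤ a) (θ : Fin n → ℝ) (y : ℝ) :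
    |mixDeriv θ y| ≤ a * mixDens θ y + a * Real.exp (-a ^ 2 / 2) := by
  unfold mixDeriv mixDens
  rw [← avg_affine hn, abs_mul, abs_of_nonneg (by positivity : (0:ℝ) ≤ 1 / n)]
  refine (mul_le_mul_of_nonneg_left (Finset.abs_sum_le_sum_abs _ _) (by positivity)).trans ?_
  refine avg_le_avg fun k => ?_
  rw [abs_mul, abs_neg, abs_of_pos (phi_pos _)]
  exact abs_mul_phi_le ha _

lemma mixDens_le_half {n : ℕ} (hn : 0 < n) (θ : Fin n → ℝ) (y : ℝ) : mixDens θ y ≤ 1 / 2 := by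
  rw [← avg_const hn (1 / 2)]
  exact avg_le_avg fun k => phi_le _

/-- With `a = √(2 log n)` the factor `exp a` is smaller than any power of `n`. The variance of the
estimator at `y`, which depends on the density near `y`, can thus be charged to the density at `y`
itself. -/
lemma mixDens_le_exp_mul {n : ℕ} (hn : 0 < n) {a : ℝ} (ha : 2 ≤ a) (θ : Fin n → ℝ) {x y : ℝ}
    (hxy : |x - y| ≤ 1) :
    mixDens θ x ≤ Real.exp a * (mixDens θ y + Real.exp (-a ^ 2 / 2)) := by
  rw [mul_add]
  unfold mixDens
  rw [← avg_affine hn]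
  refine avg_le_avg fun k => ?_
  rw [← mul_add]
  have := phi_add_le_exp_mul (a := a) (y - θ k) (x - y) (by linarith)
  rw [show y - θ k + (x - y) = x - θ k by ring] at this
  refine this.trans ?_
  have := phi_pos (y - θ k)
  gcongr
  nlinarith

/-! ### Mean of the envelope -/

lemma integral_envelope {a : ℝ} (ha : 0 < a) (y : ℝ) :
    Integrable (fun x => envelope a (y - x)) ∧ ∫ x, envelope a (y - x) = Real.pi * a := by
  have h0 : ∀ x, envelope a x = a ^ 2 * (1 + (a * x) ^ 2)⁻¹ := fun x => by
    rw [envelope, div_eq_mul_inv]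
  have hi : Integrable (envelope a) := by
    have := (integrable_inv_one_add_sq.comp_mul_left' ha.ne').const_mul (a ^ 2)
    exact this.congr (ae_of_all _ fun x => (h0 x).symm)
  refine ⟨hi.comp_sub_left y, ?_⟩
  rw [integral_sub_left_eq_self (envelope a) volume y]
  simp_rw [h0]
  rw [integral_const_mul, Measure.integral_comp_mul_left (fun x => (1 + x ^ 2)⁻¹) a,
    integral_univ_inv_one_add_sq, abs_of_pos (inv_pos.2 ha)]
  simp only [smul_eq_mul]; field_simp

lemma envelope_le_sq (a y : ℝ) : envelope a y ≤ a ^ 2 :=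
  div_le_self (sq_nonneg _) (by nlinarith [sq_nonneg (a * y)])

lemma envelope_le_one {a y : ℝ} (hy : 1 ≤ |y|) : envelope a y ≤ 1 := by
  rw [envelope, div_le_one (by positivity)]
  have : 1 ≤ y ^ 2 := by rw [← sq_abs]; nlinarith
  nlinarith [sq_nonneg a]

lemma continuous_envelope (a : ℝ) : Continuous (envelope a) := by
  unfold envelope
  exact continuous_const.div (by fun_prop) fun x => by positivity

lemma integrable_phi_sub (t : ℝ) : Integrable (fun x => phi (x - t)) := by
  have := integrable_gaussianPDFReal t 1
  exact this.congr (ae_of_all _ fun x => gaussianPDFReal_one t x)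

lemma integral_phi_sub (t : ℝ) : ∫ x, phi (x - t) = 1 := by
  have := integral_gaussianPDFReal_eq_one t (v := 1) (by simp)
  simpa only [gaussianPDFReal_one] using this

/-- Within distance `1` of `y` the density is at most `q` and the envelope has mass `πa`; farther
away the envelope is at most `1` and the density has mass `1`. -/
lemma avg_integral_envelope_le {n : ℕ} (hn : 0 < n) {a : ℝ} (ha : 0 < a) (θ : Fin n → ℝ) {y q : ℝ}
    (hq : ∀ x, |x - y| ≤ 1 → mixDens θ x ≤ q) :
    (1 / (n:ℝ)) * ∑ k, ∫ x, envelope a (y - x) ∂(gaussianReal (θ k) 1) ≤ q * (Real.pi * a) + 1 := by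
  have hq0 : 0 ≤ q := (mixDens_pos hn θ y).le.trans (hq y (by simp))
  obtain ⟨h1, h2⟩ := integral_envelope ha y
  simp_rw [integral_gaussianReal_one]
  have hi : ∀ k, Integrable (fun x => phi (x - θ k) * envelope a (y - x)) := fun k => by
    refine (integrable_phi_sub (θ k)).mul_bdd (c := a ^ 2)
      (((continuous_envelope a).comp (by fun_prop)).aestronglyMeasurable) (ae_of_all _ fun x => ?_)
    rw [Real.norm_eq_abs, abs_of_nonneg (envelope_nonneg _ _)]
    exact envelope_le_sq _ _
  have hf : Integrable (mixDens θ) :=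
    (integrable_finsetSum _ fun k _ => integrable_phi_sub (θ k)).const_mul _
  have hf1 : ∫ x, mixDens θ x = 1 := by
    unfold mixDens
    rw [integral_const_mul, integral_finsetSum _ fun k _ => integrable_phi_sub (θ k)]
    simp only [integral_phi_sub]
    exact avg_const hn 1
  have hrhs : q * (Real.pi * a) + 1 = ∫ x, (q * envelope a (y - x) + mixDens θ x) := by
    rw [integral_add (h1.const_mul q) hf, integral_const_mul, h2, hf1]
  rw [← integral_finsetSum _ fun k _ => hi k, ← integral_const_mul, hrhs]
  refine integral_mono ((integrable_finsetSum _ fun k _ => hi k).const_mul _)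
    ((h1.const_mul q).add hf) fun x => ?_
  simp only
  rw [← Finset.sum_mul, ← mul_assoc]
  change mixDens θ x * envelope a (y - x) ≤ _
  have hp := (mixDens_pos hn θ x).le
  have he := envelope_nonneg a (y - x)
  rcases le_total |x - y| 1 with h | h
  · nlinarith [mul_le_mul_of_nonneg_right (hq x h) he]
  · rw [abs_sub_comm] at h
    nlinarith [mul_le_mul_of_nonneg_left (envelope_le_one (a := a) h) hp, mul_nonneg hq0 he]

/-! ### Fourth moments of sums of independent variables -/

/-- Induction on the index set: by independence and centring, adding `Y` to `S` leaves only `S⁴`, `6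
S² Y²` and `Y⁴` in the fourth moment. The last is at most `B² Y²`, and the cross term fits into the
increase of `3 V²`, where `V` is the total variance. -/
lemma integral_sum_moments {Ω ι : Type*} {mΩ : MeasurableSpace Ω} {P : Measure Ω}
    [IsProbabilityMeasure P] [DecidableEq ι] {Y : ι → Ω → ℝ} {B : ℝ} (hm : ∀ i, Measurable (Y i))
    (hB : ∀ i w, |Y i w| ≤ B) (hY : iIndepFun Y P) (h0 : ∀ i, ∫ w, Y i w ∂P = 0) (s : Finset ι) :
    ∫ w, (∑ i ∈ s, Y i w) ^ 2 ∂P = ∑ i ∈ s, ∫ w, Y i w ^ 2 ∂P ∧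
    ∫ w, (∑ i ∈ s, Y i w) ^ 4 ∂P ≤ B ^ 2 * ∑ i ∈ s, ∫ w, Y i w ^ 2 ∂P
      + 3 * (∑ i ∈ s, ∫ w, Y i w ^ 2 ∂P) ^ 2 := by
  have hint : ∀ {F : Ω → ℝ} {C : ℝ}, Measurable F → (∀ w, |F w| ≤ C) → Integrable F P :=
    fun hF hC => Integrable.of_bound hF.aestronglyMeasurable _ (ae_of_all _ hC)
  induction s using Finset.induction_on with
  | empty => simp
  | insert i s hi ih =>
    obtain ⟨ih2, ih4⟩ := ih
    set S : Ω → ℝ := fun w => ∑ j ∈ s, Y j w with hS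
    replace ih2 : ∫ w, S w ^ 2 ∂P = ∑ j ∈ s, ∫ w, Y j w ^ 2 ∂P := ih2
    replace ih4 : ∫ w, S w ^ 4 ∂P ≤ B ^ 2 * ∑ j ∈ s, ∫ w, Y j w ^ 2 ∂P
      + 3 * (∑ j ∈ s, ∫ w, Y j w ^ 2 ∂P) ^ 2 := ih4
    have hSm : Measurable S := Finset.measurable_sum _ fun j _ => hm j
    have hSB : ∀ w, |S w| ≤ s.card * B := fun w =>
      (Finset.abs_sum_le_sum_abs _ _).trans ((Finset.sum_le_card_nsmul _ _ _ fun j _ => hB j w).trans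
        (by simp))
    have hind : IndepFun S (Y i) P := by
      have := hY.indepFun_finsetSum_of_notMem hm hi
      convert this using 1
      ext w; simp [hS]
    have hpow : ∀ p q : ℕ, ∫ w, S w ^ p * Y i w ^ q ∂P = (∫ w, S w ^ p ∂P) * ∫ w, Y i w ^ q ∂P :=
      fun p q => (hind.comp (measurable_id.pow_const p) (measurable_id.pow_const q)).integral_mul_eq_mul_integral
        (hSm.pow_const p).aestronglyMeasurable ((hm i).pow_const q).aestronglyMeasurable
    have hI : ∀ p q : ℕ, Integrable (fun w => S w ^ p * Y i w ^ q) P := fun p q =>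
      hint (C := (s.card * B) ^ p * B ^ q) ((hSm.pow_const p).mul ((hm i).pow_const q)) fun w => by
        rw [abs_mul, abs_pow, abs_pow]
        have := hSB w; have := hB i w
        have : 0 ≤ s.card * B := (abs_nonneg _).trans (hSB w)
        gcongr
    have hS0 : ∫ w, S w ∂P = 0 := by
      rw [integral_finsetSum _ fun j _ => hint (hm j) (hB j)]; simp [h0]
    have e1 : ∀ w, (∑ j ∈ insert i s, Y j w) = S w + Y i w := fun w => by
      rw [Finset.sum_insert hi, add_comm]
    simp_rw [e1, Finset.sum_insert hi]
    have hv0 : 0 ≤ ∫ w, Y i w ^ 2 ∂P := integral_nonneg fun w => sq_nonneg _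
    have hV0 : 0 ≤ ∑ j ∈ s, ∫ w, Y j w ^ 2 ∂P :=
      Finset.sum_nonneg fun j _ => integral_nonneg fun w => sq_nonneg _
    constructor
    · have : ∀ w, (S w + Y i w) ^ 2
          = S w ^ 2 * Y i w ^ 0 + (2 * (S w ^ 1 * Y i w ^ 1) + S w ^ 0 * Y i w ^ 2) := fun w => by ring
      have i1 : Integrable (fun w => 2 * (S w ^ 1 * Y i w ^ 1) + S w ^ 0 * Y i w ^ 2) P :=
        ((hI 1 1).const_mul 2).add (hI 0 2)
      simp_rw [this]
      rw [integral_add (hI 2 0) i1, integral_add ((hI 1 1).const_mul 2) (hI 0 2),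
        integral_const_mul, hpow, hpow, hpow]
      simp [h0, hS0, ih2]; ring
    · have : ∀ w, (S w + Y i w) ^ 4
          = S w ^ 4 * Y i w ^ 0 + (4 * (S w ^ 3 * Y i w ^ 1) + (6 * (S w ^ 2 * Y i w ^ 2) +
            (4 * (S w ^ 1 * Y i w ^ 3) + S w ^ 0 * Y i w ^ 4))) := fun w => by ring
      have i1 : Integrable (fun w => 4 * (S w ^ 1 * Y i w ^ 3) + S w ^ 0 * Y i w ^ 4) P :=
        ((hI 1 3).const_mul 4).add (hI 0 4)
      have i2 : Integrable (fun w => 6 * (S w ^ 2 * Y i w ^ 2) +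
          (4 * (S w ^ 1 * Y i w ^ 3) + S w ^ 0 * Y i w ^ 4)) P := ((hI 2 2).const_mul 6).add i1
      have i3 : Integrable (fun w => 4 * (S w ^ 3 * Y i w ^ 1) + (6 * (S w ^ 2 * Y i w ^ 2) +
          (4 * (S w ^ 1 * Y i w ^ 3) + S w ^ 0 * Y i w ^ 4))) P := ((hI 3 1).const_mul 4).add i2
      simp_rw [this]
      rw [integral_add (hI 4 0) i3, integral_add ((hI 3 1).const_mul 4) i2,
        integral_add ((hI 2 2).const_mul 6) i1, integral_add ((hI 1 3).const_mul 4) (hI 0 4),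
        integral_const_mul, integral_const_mul, integral_const_mul, hpow, hpow, hpow, hpow, hpow]
      have h4 : ∫ w, Y i w ^ 4 ∂P ≤ B ^ 2 * ∫ w, Y i w ^ 2 ∂P := by
        rw [← integral_const_mul]
        refine integral_mono ?_ ?_ fun w => ?_
        · simpa using hI 0 4
        · simpa using (hI 0 2).const_mul (B ^ 2)
        · have : Y i w ^ 2 ≤ B ^ 2 := by rw [← sq_abs]; gcongr; exact hB i w
          simp only; nlinarith [sq_nonneg (Y i w)]
      simp only [pow_zero, pow_one, h0, hS0, integral_const, probReal_univ, smul_eq_mul, ih2]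
      nlinarith [sq_nonneg (∫ w, Y i w ^ 2 ∂P)]

/-! ### The kernel estimators under the normal means law -/

/-- The law of the observations given the means. -/
def obsLaw {n : ℕ} (θ : Fin n → ℝ) : Measure (Fin n → ℝ) :=
  Measure.pi fun k => gaussianReal (θ k) 1

instance {n : ℕ} (θ : Fin n → ℝ) : IsProbabilityMeasure (obsLaw θ) := by
  unfold obsLaw; infer_instance

lemma map_eval_obsLaw {n : ℕ} (θ : Fin n → ℝ) (k : Fin n) :
    (obsLaw θ).map (fun x => x k) = gaussianReal (θ k) 1 :=
  (measurePreserving_eval (fun k => gaussianReal (θ k) 1) k).map_eq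

lemma integral_eval_obsLaw {n : ℕ} (θ : Fin n → ℝ) (k : Fin n) {F : ℝ → ℝ} (hF : Measurable F) :
    ∫ x, F (x k) ∂(obsLaw θ) = ∫ x, F x ∂(gaussianReal (θ k) 1) := by
  rw [← map_eval_obsLaw θ k, integral_map (measurable_pi_apply k).aemeasurable
    hF.aestronglyMeasurable]

lemma lintegral_eval_obsLaw {n : ℕ} (θ : Fin n → ℝ) (k : Fin n) {F : ℝ → ℝ≥0∞}
    (hF : Measurable F) :
    ∫⁻ x, F (x k) ∂(obsLaw θ) = ∫⁻ x, F x ∂(gaussianReal (θ k) 1) := by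
  rw [← map_eval_obsLaw θ k, lintegral_map hF (measurable_pi_apply k)]

lemma iIndepFun_obsLaw {n : ℕ} (θ : Fin n → ℝ) {F : Fin n → ℝ → ℝ} (hF : ∀ k, Measurable (F k)) :
    iIndepFun (fun k x => F k (x k)) (obsLaw θ) :=
  iIndepFun_pi fun k => (hF k).aemeasurable

/-- Split into the centred average and the bias, using `(s + b)² ≤ 2(s² + b²)` and `(s + b)⁴ ≤ 8(s⁴
+ b⁴)`. Centring doubles the uniform bound, hence `4 B²` in the fourth moment. -/
lemma avg_moments {n : ℕ} (hn : 0 < n) (θ : Fin n → ℝ) {ψ : ℝ → ℝ} (hψ : Continuous ψ) {B : ℝ}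
    (hB : ∀ y, |ψ y| ≤ B) (y : ℝ) {T e c : ℝ}
    (hT : (1 / (n:ℝ)) * ∑ k, ∫ x, ψ (y - x) ^ 2 ∂(gaussianReal (θ k) 1) ≤ T)
    (hc : |(1 / (n:ℝ)) * (∑ k, ∫ x, ψ (y - x) ∂(gaussianReal (θ k) 1)) - c| ≤ e) :
    ∫ x, ((1 / (n:ℝ)) * (∑ k, ψ (y - x k)) - c) ^ 2 ∂(obsLaw θ) ≤ 2 * (T / n + e ^ 2) ∧
    ∫ x, ((1 / (n:ℝ)) * (∑ k, ψ (y - x k)) - c) ^ 4 ∂(obsLaw θ)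
      ≤ 8 * (4 * B ^ 2 * T / n ^ 3 + 3 * T ^ 2 / n ^ 2 + e ^ 4) := by
  have hn' : (0:ℝ) < n := by exact_mod_cast hn
  set M : Fin n → ℝ := fun k => ∫ x, ψ (y - x) ∂(gaussianReal (θ k) 1) with hM
  set Y : Fin n → (Fin n → ℝ) → ℝ := fun k x => ψ (y - x k) - M k with hY
  have hB0 : 0 ≤ B := (abs_nonneg _).trans (hB 0)
  have hψi : ∀ k, Integrable (fun x => ψ (y - x)) (gaussianReal (θ k) 1) := fun k =>
    Integrable.of_bound (by fun_prop) B (ae_of_all _ fun x => hB _)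
  have hMB : ∀ k, |M k| ≤ B := fun k => by
    have := norm_integral_le_of_norm_le_const (μ := gaussianReal (θ k) 1)
      (f := fun x => ψ (y - x)) (C := B) (ae_of_all _ fun x => hB (y - x))
    simpa using this
  have hYm : ∀ k, Measurable (Y k) := fun k => by
    have := hψ.measurable
    fun_prop
  have hYB : ∀ k x, |Y k x| ≤ 2 * B := fun k x => by
    calc |Y k x| ≤ |ψ (y - x k)| + |M k| := abs_sub _ _
      _ ≤ _ := by linarith [hB (y - x k), hMB k]
  have hY0 : ∀ k, ∫ x, Y k x ∂(obsLaw θ) = 0 := fun k => by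
    have := integral_eval_obsLaw θ k (F := fun z => ψ (y - z) - M k)
      (by have := hψ.measurable; fun_prop)
    rw [hY]; simp only
    rw [this, integral_sub (hψi k) (integrable_const _)]
    simp [hM]
  have hY2 : ∀ k, ∫ x, Y k x ^ 2 ∂(obsLaw θ) ≤ ∫ x, ψ (y - x) ^ 2 ∂(gaussianReal (θ k) 1) := by
    intro k
    have := integral_eval_obsLaw θ k (F := fun z => (ψ (y - z) - M k) ^ 2)
      (by have := hψ.measurable; fun_prop)
    rw [hY]; simp only
    rw [this]
    have h2 : Integrable (fun x => ψ (y - x) ^ 2) (gaussianReal (θ k) 1) :=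
      Integrable.of_bound (by fun_prop) (B ^ 2) (ae_of_all _ fun x => by
        rw [Real.norm_eq_abs, abs_pow]; gcongr; exact hB _)
    have h3 : ∀ z, (ψ (y - z) - M k) ^ 2 = ψ (y - z) ^ 2 + (-(2 * M k) * ψ (y - z) + M k ^ 2) :=
      fun z => by ring
    have h4 : Integrable (fun z => -(2 * M k) * ψ (y - z) + M k ^ 2) (gaussianReal (θ k) 1) :=
      ((hψi k).const_mul _).add (integrable_const _)
    simp_rw [h3]
    rw [integral_add h2 h4, integral_add ((hψi k).const_mul _) (integrable_const _),
      integral_const_mul, integral_const]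
    simp only [probReal_univ, smul_eq_mul]
    change _ + (_ * M k + _) ≤ _
    nlinarith [sq_nonneg (M k)]
  obtain ⟨m2, m4⟩ := integral_sum_moments hYm hYB
    (iIndepFun_obsLaw θ (F := fun k z => ψ (y - z) - M k)
      (fun k => by have := hψ.measurable; fun_prop)) hY0 Finset.univ
  have hT' : ∑ k, ∫ x, Y k x ^ 2 ∂(obsLaw θ) ≤ n * T := by
    calc _ ≤ ∑ k, ∫ x, ψ (y - x) ^ 2 ∂(gaussianReal (θ k) 1) := Finset.sum_le_sum fun k _ => hY2 k
      _ = n * ((1 / (n:ℝ)) * ∑ k, ∫ x, ψ (y - x) ^ 2 ∂(gaussianReal (θ k) 1)) := by field_simp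
      _ ≤ n * T := by gcongr
  have hV0 : 0 ≤ ∑ k, ∫ x, Y k x ^ 2 ∂(obsLaw θ) :=
    Finset.sum_nonneg fun k _ => integral_nonneg fun x => sq_nonneg _
  set b : ℝ := (1 / (n:ℝ)) * (∑ k, M k) - c with hb
  have hdec : ∀ x : Fin n → ℝ, (1 / (n:ℝ)) * (∑ k, ψ (y - x k)) - c
      = (1 / (n:ℝ)) * (∑ k, Y k x) + b := fun x => by
    simp only [hY, hb, Finset.sum_sub_distrib]; ring
  have hSm : Measurable fun x => ∑ k, Y k x := Finset.measurable_sum _ fun k _ => hYm k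
  have hSB : ∀ x, |∑ k, Y k x| ≤ n * (2 * B) := fun x =>
    (Finset.abs_sum_le_sum_abs _ _).trans ((Finset.sum_le_card_nsmul _ _ _ fun j _ => hYB j x).trans
      (by simp))
  have hSi : ∀ p : ℕ, Integrable (fun x => (∑ k, Y k x) ^ p) (obsLaw θ) := fun p =>
    Integrable.of_bound (hSm.pow_const p).aestronglyMeasurable ((n * (2 * B)) ^ p)
      (ae_of_all _ fun x => by rw [Real.norm_eq_abs, abs_pow]; gcongr; exact hSB x)
  have hDi : ∀ p : ℕ, Integrable (fun x => ((1 / (n:ℝ)) * (∑ k, Y k x) + b) ^ p) (obsLaw θ) :=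
    fun p => Integrable.of_bound
      (((hSm.const_mul _).add_const _).pow_const p).aestronglyMeasurable
      (((1 / (n:ℝ)) * (n * (2 * B)) + |b|) ^ p)
      (ae_of_all _ fun x => by
        rw [Real.norm_eq_abs, abs_pow]; gcongr
        refine (abs_add_le _ _).trans ?_
        rw [abs_mul, abs_of_nonneg (by positivity : (0:ℝ) ≤ 1 / n)]
        gcongr; exact hSB x)
  have hbe2 : b ^ 2 ≤ e ^ 2 := by rw [← sq_abs]; gcongr
  simp_rw [hdec]
  constructor
  · calc ∫ x, ((1 / (n:ℝ)) * (∑ k, Y k x) + b) ^ 2 ∂(obsLaw θ)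
        ≤ ∫ x, ((2 / (n:ℝ) ^ 2) * (∑ k, Y k x) ^ 2 + 2 * b ^ 2) ∂(obsLaw θ) := by
          refine integral_mono (hDi 2) (((hSi 2).const_mul _).add (integrable_const _)) fun x => ?_
          have h := sq_nonneg ((1 / (n:ℝ)) * (∑ k, Y k x) - b)
          have : (2 / (n:ℝ) ^ 2) * (∑ k, Y k x) ^ 2 = 2 * ((1 / (n:ℝ)) * (∑ k, Y k x)) ^ 2 := by ring
          simp only
          rw [this]; nlinarith
      _ = (2 / (n:ℝ) ^ 2) * (∑ k, ∫ x, Y k x ^ 2 ∂(obsLaw θ)) + 2 * b ^ 2 := by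
          rw [integral_add ((hSi 2).const_mul _) (integrable_const _), integral_const_mul, m2]
          simp
      _ ≤ (2 / (n:ℝ) ^ 2) * (n * T) + 2 * e ^ 2 := by gcongr
      _ = _ := by field_simp
  · calc ∫ x, ((1 / (n:ℝ)) * (∑ k, Y k x) + b) ^ 4 ∂(obsLaw θ)
        ≤ ∫ x, ((8 / (n:ℝ) ^ 4) * (∑ k, Y k x) ^ 4 + 8 * b ^ 4) ∂(obsLaw θ) := by
          refine integral_mono (hDi 4) (((hSi 4).const_mul _).add (integrable_const _)) fun x => ?_
          have : (8 / (n:ℝ) ^ 4) * (∑ k, Y k x) ^ 4 = 8 * ((1 / (n:ℝ)) * (∑ k, Y k x)) ^ 4 := by ring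
          simp only
          rw [this]
          generalize (1 / (n:ℝ)) * (∑ k, Y k x) = s
          have h1 : (s + b) ^ 2 ≤ 2 * (s ^ 2 + b ^ 2) := by nlinarith [sq_nonneg (s - b)]
          have h2 : (s ^ 2 + b ^ 2) ^ 2 ≤ 2 * (s ^ 4 + b ^ 4) := by
            nlinarith [sq_nonneg (s ^ 2 - b ^ 2)]
          calc (s + b) ^ 4 = ((s + b) ^ 2) ^ 2 := by ring
            _ ≤ (2 * (s ^ 2 + b ^ 2)) ^ 2 := by gcongr
            _ ≤ _ := by nlinarith
      _ ≤ (8 / (n:ℝ) ^ 4) * ((2 * B) ^ 2 * (∑ k, ∫ x, Y k x ^ 2 ∂(obsLaw θ))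
            + 3 * (∑ k, ∫ x, Y k x ^ 2 ∂(obsLaw θ)) ^ 2) + 8 * b ^ 4 := by
          rw [integral_add ((hSi 4).const_mul _) (integrable_const _), integral_const_mul]
          simp only [integral_const, probReal_univ, smul_eq_mul, one_mul]
          gcongr
      _ ≤ (8 / (n:ℝ) ^ 4) * ((2 * B) ^ 2 * (n * T) + 3 * (n * T) ^ 2) + 8 * e ^ 4 := by
          have : b ^ 4 ≤ e ^ 4 := by
            calc b ^ 4 = (b ^ 2) ^ 2 := by ring
              _ ≤ (e ^ 2) ^ 2 := by gcongr
              _ = _ := by ring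
          gcongr
      _ = _ := by field_simp; ring

/-- The kernel estimate of `mixDens`. -/
def kde {n : ℕ} (a : ℝ) (x : Fin n → ℝ) (y : ℝ) : ℝ := (1 / n) * ∑ k, bandKernel a (y - x k)

/-- The kernel estimate of `mixDeriv`. -/
def kdeDeriv {n : ℕ} (a : ℝ) (x : Fin n → ℝ) (y : ℝ) : ℝ :=
  (1 / n) * ∑ k, bandKernelDeriv a (y - x k)

lemma phiHat_eq_kde {n : ℕ} (x : Fin n → ℝ) : phiHat x = kde √(2 * Real.log n) x := rfl

lemma hasDerivAt_kde {n : ℕ} (a : ℝ) (x : Fin n → ℝ) (y : ℝ) :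
    HasDerivAt (kde a x) (kdeDeriv a x y) y := by
  unfold kde kdeDeriv
  refine HasDerivAt.const_mul _ (HasDerivAt.fun_sum fun k _ => ?_)
  exact (hasDerivAt_bandKernel a (y - x k)).comp_sub_const y (x k)

lemma deriv_phiHat {n : ℕ} (x : Fin n → ℝ) (y : ℝ) :
    deriv (phiHat x) y = kdeDeriv √(2 * Real.log n) x y := by
  rw [phiHat_eq_kde, (hasDerivAt_kde _ x y).deriv]

lemma gebRule_eq {n : ℕ} (ρ : ℝ) (x : Fin n → ℝ) (y : ℝ) :
    gebRule ρ x y = y + kdeDeriv √(2 * Real.log n) x y / max (kde √(2 * Real.log n) x y) ρ := by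
  rw [gebRule, deriv_phiHat]; rfl

lemma continuous_kde {n : ℕ} (a : ℝ) :
    Continuous (fun z : (Fin n → ℝ) × ℝ => kde a z.1 z.2) := by
  have := continuous_bandKernel a
  unfold kde; fun_prop

lemma continuous_kdeDeriv {n : ℕ} (a : ℝ) :
    Continuous (fun z : (Fin n → ℝ) × ℝ => kdeDeriv a z.1 z.2) := by
  have := continuous_bandKernelDeriv a
  unfold kdeDeriv; fun_prop

/-- The estimated score, regularized at level `ρ`. -/
def score {n : ℕ} (a ρ : ℝ) (x : Fin n → ℝ) (y : ℝ) : ℝ := kdeDeriv a x y / max (kde a x y) ρ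

lemma continuous_score {n : ℕ} (a : ℝ) {ρ : ℝ} (hρ : 0 < ρ) :
    Continuous (fun z : (Fin n → ℝ) × ℝ => score a ρ z.1 z.2) := by
  unfold score
  exact (continuous_kdeDeriv a).div ((continuous_kde a).max continuous_const)
    fun z => (lt_max_of_lt_right hρ).ne'

lemma abs_avg_le {n : ℕ} (hn : 0 < n) {f : Fin n → ℝ} {B : ℝ} (h : ∀ k, |f k| ≤ B) :
    |(1 / (n:ℝ)) * ∑ k, f k| ≤ B := by
  rw [abs_mul, abs_of_nonneg (by positivity : (0:ℝ) ≤ 1 / n)]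
  refine (mul_le_mul_of_nonneg_left (Finset.abs_sum_le_sum_abs _ _) (by positivity)).trans ?_
  rw [← avg_const hn B]
  exact avg_le_avg h

lemma abs_bandKernel_le' {a : ℝ} (ha : 0 ≤ a) (y : ℝ) : |bandKernel a y| ≤ a / 2 :=
  (abs_bandKernel_le ha y).trans (by gcongr; linarith [Real.pi_gt_three])

lemma abs_bandKernelDeriv_le' {a : ℝ} (ha : 0 ≤ a) (y : ℝ) : |bandKernelDeriv a y| ≤ a ^ 2 / 2 :=
  (abs_bandKernelDeriv_le ha y).trans (by gcongr; linarith [Real.pi_gt_three])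

lemma abs_score_le {n : ℕ} (hn : 0 < n) {a ρ : ℝ} (ha : 0 ≤ a) (hρ : 0 < ρ) (x : Fin n → ℝ)
    (y : ℝ) : |score a ρ x y| ≤ a ^ 2 / ρ := by
  rw [score, abs_div, abs_of_pos (lt_max_of_lt_right hρ)]
  gcongr
  · exact (abs_avg_le hn fun k => abs_bandKernelDeriv_le' ha _).trans (by nlinarith [sq_nonneg a])
  · exact le_max_right _ _

/-- With `m = max f ρ` and `M = max V ρ`, the difference of the ratios is `((U - g) + (U/M)(m -
M))/m`, and `|m - M| ≤ |V - f|`. Dividing by the deterministic `m` keeps the factor `1/m²`, which is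
much better than `1/ρ²` where the density is large; powers of `1/ρ` multiply only fourth-order
errors. -/
lemma score_sub_sq_le {a ρ U V f g : ℝ} (ha : 0 < a) (hρ : 0 < ρ)
    (hg : |g| ≤ 2 * a * max f ρ) :
    (U / max V ρ - g / max f ρ) ^ 2 ≤ 4 / max f ρ ^ 2 *
      ((U - g) ^ 2 + ((U - g) ^ 4 / a ^ 2 + a ^ 2 * (V - f) ^ 4) / (2 * ρ ^ 2)
        + 4 * a ^ 2 * (V - f) ^ 2 + 4 * a ^ 2 * (V - f) ^ 4 / ρ ^ 2) := by
  set m := max f ρ with hm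
  set M := max V ρ with hM
  have hm0 : 0 < m := lt_max_of_lt_right hρ
  have hM0 : 0 < M := lt_max_of_lt_right hρ
  have hMρ : ρ ≤ M := le_max_right _ _
  have hmM : |m - M| ≤ |V - f| := by
    rw [abs_sub_comm V f]; exact abs_max_sub_max_le_abs f V ρ
  set u := |U - g| with hu
  set v := |V - f| with hv
  have hu0 : 0 ≤ u := abs_nonneg _
  have hv0 : 0 ≤ v := abs_nonneg _
  have h1 : m / M ≤ 1 + v / ρ := by
    rw [div_le_iff₀ hM0]
    have : m ≤ M + v := by linarith [(abs_le.1 hmM).2]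
    have : v ≤ v / ρ * M := by
      rw [div_mul_eq_mul_div, le_div_iff₀ hρ]; gcongr
    linarith
  have h2 : |U| / M ≤ u / ρ + 2 * a * (1 + v / ρ) := by
    have h3 : |U| ≤ u + |g| := by
      calc |U| = |(U - g) + g| := by ring_nf
        _ ≤ _ := abs_add_le _ _
    calc |U| / M ≤ (u + 2 * a * m) / M := by gcongr; linarith
      _ = u / M + 2 * a * (m / M) := by ring
      _ ≤ _ := by gcongr
  have h4 : |U / M - g / m| ≤ (u + v * (u / ρ + 2 * a * (1 + v / ρ))) / m := by
    have : U / M - g / m = ((U - g) + (U / M) * (m - M)) / m := by field_simp; ring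
    rw [this, abs_div, abs_of_pos hm0]
    gcongr
    refine (abs_add_le _ _).trans ?_
    rw [abs_mul, abs_div, abs_of_pos hM0, mul_comm (|U| / M)]
    gcongr
  have hU2 : (U - g) ^ 2 = u ^ 2 := (sq_abs _).symm
  have hU4 : (U - g) ^ 4 = u ^ 4 := by rw [hu]; exact (Even.pow_abs (by decide) _).symm
  have hV2 : (V - f) ^ 2 = v ^ 2 := (sq_abs _).symm
  have hV4 : (V - f) ^ 4 = v ^ 4 := by rw [hv]; exact (Even.pow_abs (by decide) _).symm
  rw [hU2, hU4, hV2, hV4, ← sq_abs]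
  calc |U / M - g / m| ^ 2 ≤ ((u + v * (u / ρ + 2 * a * (1 + v / ρ))) / m) ^ 2 := by gcongr
    _ = (u + u * v / ρ + 2 * a * v + 2 * a * v ^ 2 / ρ) ^ 2 / m ^ 2 := by
      rw [div_pow]; congr 2; field_simp; ring
    _ ≤ (4 * (u ^ 2 + (u * v / ρ) ^ 2 + (2 * a * v) ^ 2 + (2 * a * v ^ 2 / ρ) ^ 2)) / m ^ 2 := by
      gcongr
      generalize u * v / ρ = p
      generalize 2 * a * v ^ 2 / ρ = q
      generalize 2 * a * v = r
      nlinarith [sq_nonneg (u - p), sq_nonneg (u - q), sq_nonneg (u - r), sq_nonneg (p - q),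
        sq_nonneg (p - r), sq_nonneg (q - r)]
    _ ≤ 4 / m ^ 2 * (u ^ 2 + (u ^ 4 / a ^ 2 + a ^ 2 * v ^ 4) / (2 * ρ ^ 2) + 4 * a ^ 2 * v ^ 2
          + 4 * a ^ 2 * v ^ 4 / ρ ^ 2) := by
      have h5 : (u * v / ρ) ^ 2 ≤ (u ^ 4 / a ^ 2 + a ^ 2 * v ^ 4) / (2 * ρ ^ 2) := by
        rw [div_pow, div_le_div_iff₀ (by positivity) (by positivity)]
        have : 2 * (u * v) ^ 2 ≤ u ^ 4 / a ^ 2 + a ^ 2 * v ^ 4 := by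
          have h6 := sq_nonneg (u ^ 2 / a - a * v ^ 2)
          have h7 : (u ^ 2 / a - a * v ^ 2) ^ 2 = u ^ 4 / a ^ 2 + a ^ 2 * v ^ 4 - 2 * (u * v) ^ 2 := by
            field_simp; ring
          linarith
        nlinarith [sq_nonneg ρ]
      have h8 : (2 * a * v) ^ 2 = 4 * a ^ 2 * v ^ 2 := by ring
      have h9 : (2 * a * v ^ 2 / ρ) ^ 2 = 4 * a ^ 2 * v ^ 4 / ρ ^ 2 := by field_simp; ring
      rw [mul_div_right_comm]
      gcongr
      exact h8.le
      exact h9.le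

/-- The mean squared error of the estimated score. -/
lemma integral_score_sub_sq_le {n : ℕ} (hn : 0 < n) {a ρ τ : ℝ} (ha : 2 ≤ a) (han : a ^ 2 ≤ n)
    (hae : Real.exp (-a ^ 2 / 2) ≤ 1 / n) (hρ : 1 / n ≤ ρ) (hτ : 1 ≤ τ) (θ : Fin n → ℝ) (y : ℝ)
    (henv : (1 / (n:ℝ)) * ∑ k, ∫ x, envelope a (y - x) ∂(gaussianReal (θ k) 1) ≤ τ) :
    ∫ x, (score a ρ x y - mixDeriv θ y / max (mixDens θ y) ρ) ^ 2 ∂(obsLaw θ)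
      ≤ a ^ 2 * τ / (n * max (mixDens θ y) ρ ^ 2) * (80 + 1280 * (τ / (n * ρ ^ 2))) := by
  have hn' : (0:ℝ) < n := by exact_mod_cast hn
  have hρ0 : 0 < ρ := lt_of_lt_of_le (by positivity) hρ
  have ha0 : 0 < a := by linarith
  set f := mixDens θ y with hf
  set g := mixDeriv θ y with hg
  set m := max f ρ with hm
  have hm0 : 0 < m := lt_max_of_lt_right hρ0
  have hf0 : 0 < f := mixDens_pos hn θ y
  have hei : ∀ k, Integrable (fun x => envelope a (y - x)) (gaussianReal (θ k) 1) := fun k =>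
    Integrable.of_bound (((continuous_envelope a).comp (by fun_prop)).aestronglyMeasurable) (a ^ 2)
      (ae_of_all _ fun x => by
        rw [Real.norm_eq_abs, abs_of_nonneg (envelope_nonneg _ _)]; exact envelope_le_sq _ _)
  have hgm : |g| ≤ 2 * a * m := by
    have h1 := abs_mixDeriv_le hn ha θ y
    have h2 : f ≤ m := le_max_left _ _
    have h3 : ρ ≤ m := le_max_right _ _
    have h4 : Real.exp (-a ^ 2 / 2) ≤ m := hae.trans (hρ.trans h3)
    calc |g| ≤ a * f + a * Real.exp (-a ^ 2 / 2) := h1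
      _ ≤ a * m + a * m := by gcongr
      _ = _ := by ring
  obtain ⟨v2, v4⟩ := avg_moments hn θ (continuous_bandKernel a) (fun z => (abs_bandKernel_le' ha0.le z).trans
      (by linarith : a / 2 ≤ a)) y (T := τ) (e := 1 / n) (c := f)
    (by
      refine le_trans (avg_le_avg fun k => ?_) henv
      refine integral_mono_of_nonneg (ae_of_all _ fun x => sq_nonneg _) (hei k)
        (ae_of_all _ fun x => bandKernel_sq_le ha0.le _))
    (by
      rw [hf, mixDens, ← mul_sub, ← Finset.sum_sub_distrib]
      exact abs_avg_le hn fun k => (abs_integral_bandKernel_sub_le (by linarith) _ _).trans hae)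
  obtain ⟨u2, u4⟩ := avg_moments hn θ (continuous_bandKernelDeriv a) (fun z => (abs_bandKernelDeriv_le' ha0.le z).trans
      (by nlinarith : a ^ 2 / 2 ≤ a ^ 2)) y (T := a ^ 2 * τ) (e := 1 / n) (c := g)
    (by
      refine le_trans (avg_le_avg (g := fun k => a ^ 2 * ∫ x, envelope a (y - x)
        ∂(gaussianReal (θ k) 1)) fun k => ?_) ?_
      · rw [← integral_const_mul]
        exact integral_mono_of_nonneg (ae_of_all _ fun x => sq_nonneg _) ((hei k).const_mul _)
          (ae_of_all _ fun x => bandKernelDeriv_sq_le ha0.le _)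
      · rw [← Finset.mul_sum, mul_left_comm]
        gcongr)
    (by
      rw [hg, mixDeriv, ← mul_sub, ← Finset.sum_sub_distrib]
      exact abs_avg_le hn fun k => (abs_integral_bandKernelDeriv_sub_le (by linarith) _ _).trans hae)
  change ∫ x, (kde a x y - f) ^ 2 ∂(obsLaw θ) ≤ _ at v2
  change ∫ x, (kde a x y - f) ^ 4 ∂(obsLaw θ) ≤ _ at v4
  change ∫ x, (kdeDeriv a x y - g) ^ 2 ∂(obsLaw θ) ≤ _ at u2
  change ∫ x, (kdeDeriv a x y - g) ^ 4 ∂(obsLaw θ) ≤ _ at u4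
  have hn1 : (1:ℝ) ≤ n := by exact_mod_cast hn
  have hr : 1 / (n:ℝ) ≤ τ := ((div_le_one hn').2 hn1).trans hτ
  have v2' : ∫ x, (kde a x y - f) ^ 2 ∂(obsLaw θ) ≤ 4 * (τ / n) := by
    refine v2.trans ?_
    have : (1 / (n:ℝ)) ^ 2 ≤ τ / n := by
      rw [sq, div_eq_mul_one_div τ]; gcongr
    linarith
  have hr4 : (1 / (n:ℝ)) ^ 4 ≤ τ ^ 2 / n ^ 2 := by
    calc (1 / (n:ℝ)) ^ 4 = (1 / (n:ℝ)) ^ 2 * (1 / (n:ℝ)) ^ 2 := by ring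
      _ ≤ τ ^ 2 * (1 / (n:ℝ)) ^ 2 := by gcongr
      _ = _ := by ring
  -- Since `a² ≤ n` and `1 ≤ τ`, the fourth-moment contribution of single summands is dominated by
  -- the squared variance.
  have hq : a ^ 2 * τ / (n:ℝ) ^ 3 ≤ τ ^ 2 / n ^ 2 := by
    rw [div_le_div_iff₀ (by positivity) (by positivity)]
    calc a ^ 2 * τ * (n:ℝ) ^ 2 ≤ n * (τ * τ) * n ^ 2 := by gcongr; nlinarith
      _ = _ := by ring
  have v4' : ∫ x, (kde a x y - f) ^ 4 ∂(obsLaw θ) ≤ 64 * (τ ^ 2 / n ^ 2) := by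
    refine v4.trans ?_
    have h1 : 4 * a ^ 2 * τ / (n:ℝ) ^ 3 = 4 * (a ^ 2 * τ / (n:ℝ) ^ 3) := by ring
    have h2 : 3 * τ ^ 2 / (n:ℝ) ^ 2 = 3 * (τ ^ 2 / (n:ℝ) ^ 2) := by ring
    rw [h1, h2]; linarith
  have ha1 : 1 ≤ a ^ 2 := by nlinarith
  have u2' : ∫ x, (kdeDeriv a x y - g) ^ 2 ∂(obsLaw θ) ≤ a ^ 2 * (4 * (τ / n)) := by
    refine u2.trans ?_
    have : (1 / (n:ℝ)) ^ 2 ≤ a ^ 2 * (τ / n) := by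
      calc (1 / (n:ℝ)) ^ 2 ≤ 1 * (τ / n) := by
            rw [sq, div_eq_mul_one_div τ, one_mul]; gcongr
        _ ≤ _ := by gcongr
    have h2 : a ^ 2 * τ / n = a ^ 2 * (τ / n) := by ring
    rw [h2]; linarith
  have u4' : ∫ x, (kdeDeriv a x y - g) ^ 4 ∂(obsLaw θ) ≤ a ^ 4 * (64 * (τ ^ 2 / n ^ 2)) := by
    refine u4.trans ?_
    have h1 : 4 * (a ^ 2) ^ 2 * (a ^ 2 * τ) / (n:ℝ) ^ 3 = a ^ 4 * (4 * (a ^ 2 * τ / (n:ℝ) ^ 3)) := by ring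
    have h2 : 3 * (a ^ 2 * τ) ^ 2 / (n:ℝ) ^ 2 = a ^ 4 * (3 * (τ ^ 2 / (n:ℝ) ^ 2)) := by ring
    have h3 : (1 / (n:ℝ)) ^ 4 ≤ a ^ 4 * (τ ^ 2 / n ^ 2) := by
      refine hr4.trans (le_mul_of_one_le_left (by positivity) ?_)
      nlinarith
    have h4 : a ^ 4 * (a ^ 2 * τ / (n:ℝ) ^ 3) ≤ a ^ 4 * (τ ^ 2 / n ^ 2) := by gcongr
    rw [h1, h2]; linarith
  have hVi : ∀ p : ℕ, Integrable (fun x => (kde a x y - f) ^ p) (obsLaw θ) := fun p =>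
    Integrable.of_bound (C := (a + |f|) ^ p)
      ((((continuous_kde a).comp (by fun_prop : Continuous fun x : Fin n → ℝ => (x, y))).sub
        continuous_const).pow p).aestronglyMeasurable (ae_of_all _ fun x => by
        rw [Real.norm_eq_abs, abs_pow]; gcongr
        refine (abs_sub _ _).trans (add_le_add_left ?_ _)
        exact (abs_avg_le hn fun k => abs_bandKernel_le' ha0.le _).trans (by linarith))
  have hUi : ∀ p : ℕ, Integrable (fun x => (kdeDeriv a x y - g) ^ p) (obsLaw θ) := fun p =>
    Integrable.of_bound (C := (a ^ 2 + |g|) ^ p)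
      ((((continuous_kdeDeriv a).comp (by fun_prop : Continuous fun x : Fin n → ℝ => (x, y))).sub
        continuous_const).pow p).aestronglyMeasurable (ae_of_all _ fun x => by
        rw [Real.norm_eq_abs, abs_pow]; gcongr
        refine (abs_sub _ _).trans (add_le_add_left ?_ _)
        exact (abs_avg_le hn fun k => abs_bandKernelDeriv_le' ha0.le _).trans (by nlinarith))
  have j1 : Integrable (fun x => ((kdeDeriv a x y - g) ^ 4 / a ^ 2
      + a ^ 2 * (kde a x y - f) ^ 4) / (2 * ρ ^ 2)) (obsLaw θ) :=
    (((hUi 4).div_const _).add ((hVi 4).const_mul _)).div_const _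
  have j2 : Integrable (fun x => (kdeDeriv a x y - g) ^ 2 + ((kdeDeriv a x y - g) ^ 4 / a ^ 2
      + a ^ 2 * (kde a x y - f) ^ 4) / (2 * ρ ^ 2)) (obsLaw θ) := (hUi 2).add j1
  have j3 : Integrable (fun x => (kdeDeriv a x y - g) ^ 2 + ((kdeDeriv a x y - g) ^ 4 / a ^ 2
      + a ^ 2 * (kde a x y - f) ^ 4) / (2 * ρ ^ 2) + 4 * a ^ 2 * (kde a x y - f) ^ 2) (obsLaw θ) :=
    j2.add ((hVi 2).const_mul (4 * a ^ 2))
  have j4 : Integrable (fun x => 4 * a ^ 2 * (kde a x y - f) ^ 4 / ρ ^ 2) (obsLaw θ) :=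
    ((hVi 4).const_mul _).div_const _
  calc ∫ x, (score a ρ x y - g / m) ^ 2 ∂(obsLaw θ)
      ≤ ∫ x, 4 / m ^ 2 * ((kdeDeriv a x y - g) ^ 2 + ((kdeDeriv a x y - g) ^ 4 / a ^ 2
        + a ^ 2 * (kde a x y - f) ^ 4) / (2 * ρ ^ 2) + 4 * a ^ 2 * (kde a x y - f) ^ 2
        + 4 * a ^ 2 * (kde a x y - f) ^ 4 / ρ ^ 2) ∂(obsLaw θ) := by
        refine integral_mono_of_nonneg (ae_of_all _ fun x => sq_nonneg _)
          ((j3.add j4).const_mul _) (ae_of_all _ fun x => ?_)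
        exact score_sub_sq_le ha0 hρ0 hgm
    _ = 4 / m ^ 2 * (∫ x, (kdeDeriv a x y - g) ^ 2 ∂(obsLaw θ)
        + ((∫ x, (kdeDeriv a x y - g) ^ 4 ∂(obsLaw θ)) / a ^ 2
          + a ^ 2 * ∫ x, (kde a x y - f) ^ 4 ∂(obsLaw θ)) / (2 * ρ ^ 2)
        + 4 * a ^ 2 * (∫ x, (kde a x y - f) ^ 2 ∂(obsLaw θ))
        + 4 * a ^ 2 * (∫ x, (kde a x y - f) ^ 4 ∂(obsLaw θ)) / ρ ^ 2) := by
        rw [integral_const_mul, integral_add j3 j4, integral_add j2 ((hVi 2).const_mul _),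
          integral_add (hUi 2) j1, integral_div, integral_add ((hUi 4).div_const _)
          ((hVi 4).const_mul _), integral_div, integral_div, integral_const_mul, integral_const_mul,
          integral_const_mul]
    _ ≤ 4 / m ^ 2 * (a ^ 2 * (4 * (τ / n))
        + ((a ^ 4 * (64 * (τ ^ 2 / n ^ 2))) / a ^ 2
          + a ^ 2 * (64 * (τ ^ 2 / n ^ 2))) / (2 * ρ ^ 2)
        + 4 * a ^ 2 * (4 * (τ / n))
        + 4 * a ^ 2 * (64 * (τ ^ 2 / n ^ 2)) / ρ ^ 2) := by gcongr
    _ = _ := by field_simp; ring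

/-! ### Separable rules -/

/-- The average risk of the separable rule `t` at the means `θ`. -/
def sepRisk {n : ℕ} (θ : Fin n → ℝ) (t : ℝ → ℝ) : ℝ≥0∞ :=
  (n : ℝ≥0∞)⁻¹ * ∑ k, ∫⁻ y, ENNReal.ofReal ((t y - θ k) ^ 2) ∂(gaussianReal (θ k) 1)

/-- The weighted loss of the value `w` at the observation `y`. -/
def mixLoss {n : ℕ} (θ : Fin n → ℝ) (y w : ℝ) : ℝ :=
  (1 / n) * ∑ k, phi (y - θ k) * (w - θ k) ^ 2

lemma mixLoss_nonneg {n : ℕ} (θ : Fin n → ℝ) (y w : ℝ) : 0 ≤ mixLoss θ y w :=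
  mul_nonneg (by positivity)
    (Finset.sum_nonneg fun k _ => mul_nonneg (phi_pos _).le (sq_nonneg _))

lemma continuous_mixLoss {n : ℕ} (θ : Fin n → ℝ) :
    Continuous (fun z : ℝ × ℝ => mixLoss θ z.1 z.2) := by
  have := continuous_phi
  unfold mixLoss; fun_prop

/-- Pythagoras for the weights `φ(y - θ k)`: the weighted mean of the `θ k` is `y + f'/f` by
Tweedie's formula, and any other value loses `f` times the squared distance. -/
lemma mixLoss_eq {n : ℕ} (hn : 0 < n) (θ : Fin n → ℝ) (y w : ℝ) :
    mixLoss θ y w = mixDens θ y * (w - (y + mixDeriv θ y / mixDens θ y)) ^ 2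
      + mixLoss θ y (y + mixDeriv θ y / mixDens θ y) := by
  have hf := (mixDens_pos hn θ y).ne'
  have h : ∀ w, mixLoss θ y w = (w - y) ^ 2 * mixDens θ y - 2 * (w - y) * mixDeriv θ y
      + mixSq θ y := fun w => by
    simp only [mixLoss, mixDens, mixDeriv, mixSq, Finset.mul_sum]
    rw [← Finset.sum_sub_distrib, ← Finset.sum_add_distrib]
    exact Finset.sum_congr rfl fun k _ => by ring
  rw [h, h]
  field_simp; ring

lemma mixLoss_le {n : ℕ} (hn : 0 < n) (θ : Fin n → ℝ) (y w w' : ℝ) :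
    mixLoss θ y w ≤ mixDens θ y * (w - (y + mixDeriv θ y / mixDens θ y)) ^ 2 + mixLoss θ y w' := by
  rw [mixLoss_eq hn θ y w, mixLoss_eq hn θ y w']
  have := mul_nonneg (mixDens_pos hn θ y).le (sq_nonneg (w' - (y + mixDeriv θ y / mixDens θ y)))
  linarith

lemma ofReal_avg {n : ℕ} (hn : 0 < n) {f : Fin n → ℝ} (hf : ∀ k, 0 ≤ f k) :
    ENNReal.ofReal ((1 / (n:ℝ)) * ∑ k, f k) = (n : ℝ≥0∞)⁻¹ * ∑ k, ENNReal.ofReal (f k) := by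
  rw [ENNReal.ofReal_mul (by positivity), ENNReal.ofReal_sum_of_nonneg fun k _ => hf k, one_div,
    ENNReal.ofReal_inv_of_pos (by exact_mod_cast hn), ENNReal.ofReal_natCast]

lemma avg_lintegral_gaussianReal {n : ℕ} (hn : 0 < n) (θ : Fin n → ℝ) {F : Fin n → ℝ → ℝ}
    (hF : ∀ k, Measurable (F k)) (h0 : ∀ k y, 0 ≤ F k y) :
    (n : ℝ≥0∞)⁻¹ * ∑ k, ∫⁻ y, ENNReal.ofReal (F k y) ∂(gaussianReal (θ k) 1)
      = ∫⁻ y, ENNReal.ofReal ((1 / (n:ℝ)) * ∑ k, phi (y - θ k) * F k y) := by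
  have hm : ∀ k, Measurable fun y => ENNReal.ofReal (F k y) := fun k => (hF k).ennreal_ofReal
  have hp : ∀ k, Measurable fun y => phi (y - θ k) := fun k => by
    have := continuous_phi.measurable; fun_prop
  have hpm : ∀ k, Measurable fun y => ENNReal.ofReal (phi (y - θ k) * F k y) := fun k =>
    ((hp k).mul (hF k)).ennreal_ofReal
  simp_rw [fun y => ofReal_avg hn (f := fun k => phi (y - θ k) * F k y)
    fun k => mul_nonneg (phi_pos _).le (h0 k y)]
  rw [lintegral_const_mul _ (Finset.measurable_sum _ fun k _ => hpm k),
    lintegral_finsetSum _ fun k _ => hpm k]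
  congr 1
  refine Finset.sum_congr rfl fun k _ => ?_
  rw [lintegral_gaussianReal_one _ (hm k)]
  exact lintegral_congr fun y => (ENNReal.ofReal_mul (phi_pos _).le).symm

lemma sepRisk_eq {n : ℕ} (hn : 0 < n) (θ : Fin n → ℝ) {t : ℝ → ℝ} (ht : Measurable t) :
    sepRisk θ t = ∫⁻ y, ENNReal.ofReal (mixLoss θ y (t y)) := by
  rw [sepRisk, avg_lintegral_gaussianReal hn θ (F := fun k y => (t y - θ k) ^ 2)
    (fun k => by fun_prop) (fun k y => sq_nonneg _)]
  rfl

/-- The risk of an estimated score applied to a fresh observation. -/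
lemma lintegral_sepRisk_le {n : ℕ} (hn : 0 < n) (θ : Fin n → ℝ) {s : (Fin n → ℝ) → ℝ → ℝ}
    (hs : Measurable (Function.uncurry s)) {t : ℝ → ℝ} (ht : Measurable t) :
    ∫⁻ x, sepRisk θ (fun y => y + s x y) ∂(obsLaw θ)
      ≤ (∫⁻ y, ∫⁻ x, ENNReal.ofReal (mixDens θ y * (s x y - mixDeriv θ y / mixDens θ y) ^ 2)
          ∂(obsLaw θ)) + sepRisk θ t := by
  have hf := (continuous_mixDens θ).measurable
  have hg := (continuous_mixDeriv θ).measurable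
  have hs' : ∀ x, Measurable (s x) := fun x => hs.comp (by fun_prop : Measurable fun y => (x, y))
  have hm1 : Measurable (fun z : (Fin n → ℝ) × ℝ =>
      ENNReal.ofReal (mixDens θ z.2 * (s z.1 z.2 - mixDeriv θ z.2 / mixDens θ z.2) ^ 2)) := by
    have : Measurable fun z : (Fin n → ℝ) × ℝ => s z.1 z.2 := hs
    exact ((hf.comp measurable_snd).mul ((this.sub ((hg.comp measurable_snd).div
      (hf.comp measurable_snd))).pow_const 2)).ennreal_ofReal
  have hm2 : Measurable fun y => ENNReal.ofReal (mixLoss θ y (t y)) :=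
    ((continuous_mixLoss θ).measurable.comp (measurable_id.prodMk ht)).ennreal_ofReal
  calc ∫⁻ x, sepRisk θ (fun y => y + s x y) ∂(obsLaw θ)
      = ∫⁻ x, (∫⁻ y, ENNReal.ofReal (mixLoss θ y (y + s x y))) ∂(obsLaw θ) := by
        refine lintegral_congr fun x => sepRisk_eq hn θ (measurable_id.add (hs' x))
    _ ≤ ∫⁻ x, (∫⁻ y, (ENNReal.ofReal (mixDens θ y * (s x y - mixDeriv θ y / mixDens θ y) ^ 2)
          + ENNReal.ofReal (mixLoss θ y (t y)))) ∂(obsLaw θ) := by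
        refine lintegral_mono fun x => lintegral_mono fun y => ?_
        rw [← ENNReal.ofReal_add (mul_nonneg (mixDens_pos hn θ y).le (sq_nonneg _))
          (mixLoss_nonneg _ _ _)]
        refine ENNReal.ofReal_le_ofReal ?_
        have := mixLoss_le hn θ y (y + s x y) (t y)
        rwa [add_sub_add_left_eq_sub] at this
    _ = ∫⁻ x, ((∫⁻ y, ENNReal.ofReal (mixDens θ y * (s x y - mixDeriv θ y / mixDens θ y) ^ 2))
          + sepRisk θ t) ∂(obsLaw θ) := by
        refine lintegral_congr fun x => ?_
        rw [lintegral_add_right _ hm2, sepRisk_eq hn θ ht]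
    _ = (∫⁻ x, (∫⁻ y, ENNReal.ofReal (mixDens θ y * (s x y - mixDeriv θ y / mixDens θ y) ^ 2))
          ∂(obsLaw θ)) + sepRisk θ t := by
        rw [lintegral_add_right _ measurable_const]; simp
    _ = _ := by rw [lintegral_lintegral_swap hm1.aemeasurable]

/-- Two bounds are needed: `a³/(nm)` is the real rate, used on a bounded window, while a multiple of
`f` is integrable over the whole line and controls the rest. The first uses `τ ≤ 3a`, the second the
local bound for `τ`. -/
lemma variance_bound_le {n a ρ Q f m τ I : ℝ} (hn' : 0 < n) (ha0 : 0 < a) (hρ0 : 0 < ρ)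
    (hQ : a ^ 2 / (n * ρ ^ 2) ≤ Q) (hexp : a ^ 3 * Real.exp a / (n * ρ) ≤ 1) (hf0 : 0 < f)
    (hfm : f ≤ m) (hρm : ρ ≤ m) (hnm : 1 / n ≤ m) (hτ1 : 1 ≤ τ) (hτ3 : τ ≤ 3 * a)
    (hτ2 : τ ≤ Real.exp a * (f + 1 / n) * (4 * a) + 1) (hτQ : τ / (n * ρ ^ 2) ≤ 3 * Q)
    (hkey : I ≤ a ^ 2 * τ / (n * m ^ 2) * (80 + 1280 * (τ / (n * ρ ^ 2)))) :
    f * I ≤ (80 + 3840 * Q) * (9 + Q) * min (a ^ 3 / (n * m)) f := by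
  have hm0 : 0 < m := hρ0.trans_le hρm
  have hQ0 : 0 ≤ Q := le_trans (by positivity) hQ
  have h1 : f * (a ^ 2 * τ / (n * m ^ 2)) ≤ (9 + Q) * min (a ^ 3 / (n * m)) f := by
    rw [mul_min_of_nonneg _ _ (by positivity : 0 ≤ 9 + Q)]
    refine le_min ?_ ?_
    · calc f * (a ^ 2 * τ / (n * m ^ 2)) ≤ m * (a ^ 2 * (3 * a) / (n * m ^ 2)) := by gcongr
        _ = 3 * (a ^ 3 / (n * m)) := by field_simp
        _ ≤ _ := by gcongr; linarith
    · rw [mul_comm (9 + Q)]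
      gcongr
      calc a ^ 2 * τ / (n * m ^ 2)
          ≤ a ^ 2 * (Real.exp a * (m + m) * (4 * a) + 1) / (n * m ^ 2) := by
            gcongr
            refine hτ2.trans ?_
            gcongr
        _ = 8 * (a ^ 3 * Real.exp a / (n * m)) + a ^ 2 / (n * m ^ 2) := by field_simp; ring
        _ ≤ 8 * (a ^ 3 * Real.exp a / (n * ρ)) + a ^ 2 / (n * ρ ^ 2) := by gcongr
        _ ≤ 9 + Q := by linarith
  calc f * I
      ≤ f * (a ^ 2 * τ / (n * m ^ 2) * (80 + 1280 * (τ / (n * ρ ^ 2)))) := by gcongr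
    _ = f * (a ^ 2 * τ / (n * m ^ 2)) * (80 + 1280 * (τ / (n * ρ ^ 2))) := by ring
    _ ≤ ((9 + Q) * min (a ^ 3 / (n * m)) f) * (80 + 1280 * (3 * Q)) := by gcongr
    _ = _ := by ring

/-- Where `f ≥ ρ` the regularization does nothing. Elsewhere it shrinks the score towards zero, so
the error is at most the score itself, and `f (g/f)² = g²/f ≤ h`. -/
lemma regularization_bias_le {f g h ρ : ℝ} (hf0 : 0 < f) (hρ0 : 0 < ρ) (hg : g ^ 2 ≤ f * h) :
    f * (g / max f ρ - g / f) ^ 2 ≤ if f < ρ then h else 0 := by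
  set m := max f ρ with hm
  have hm0 : 0 < m := lt_max_of_lt_right hρ0
  have hfm : f ≤ m := le_max_left _ _
  split_ifs with hlt
  · have hmρ : m = ρ := max_eq_right hlt.le
    have h1 : (g / m - g / f) ^ 2 ≤ (g / f) ^ 2 := by
      have : g / m - g / f = -(1 - f / m) * (g / f) := by field_simp; ring
      rw [this, mul_pow]
      refine mul_le_of_le_one_left (sq_nonneg _) ?_
      have h2 : 0 ≤ f / m := by positivity
      have h3 : f / m ≤ 1 := (div_le_one hm0).2 hfm
      nlinarith
    calc f * (g / m - g / f) ^ 2 ≤ f * (g / f) ^ 2 := by gcongr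
      _ = g ^ 2 / f := by field_simp
      _ ≤ h := by
        rw [div_le_iff₀ hf0, mul_comm]; exact hg
  · have : m = f := max_eq_left (not_lt.1 hlt)
    rw [this]; simp

/-- The pointwise regret of the estimated score. -/
lemma lintegral_score_regret_le {n : ℕ} (hn : 0 < n) {a ρ Q : ℝ} (ha : 2 ≤ a) (han : a ^ 2 ≤ n)
    (hae : Real.exp (-a ^ 2 / 2) = 1 / n) (hρ : 1 / n ≤ ρ) (hQ : a ^ 2 / (n * ρ ^ 2) ≤ Q)
    (hexp : a ^ 3 * Real.exp a / (n * ρ) ≤ 1) (θ : Fin n → ℝ) (y : ℝ) :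
    ∫⁻ x, ENNReal.ofReal (mixDens θ y * (score a ρ x y - mixDeriv θ y / mixDens θ y) ^ 2)
        ∂(obsLaw θ)
      ≤ ENNReal.ofReal (2 * ((80 + 3840 * Q) * (9 + Q)) *
          min (a ^ 3 / (n * max (mixDens θ y) ρ)) (mixDens θ y)
        + 2 * if mixDens θ y < ρ then mixSq θ y else 0) := by
  have hn' : (0:ℝ) < n := by exact_mod_cast hn
  have hρ0 : 0 < ρ := lt_of_lt_of_le (by positivity) hρ
  have ha0 : 0 < a := by linarith
  set f := mixDens θ y with hf
  set g := mixDeriv θ y with hg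
  set m := max f ρ with hm
  have hm0 : 0 < m := lt_max_of_lt_right hρ0
  have hf0 : 0 < f := mixDens_pos hn θ y
  have hfm : f ≤ m := le_max_left _ _
  have hρm : ρ ≤ m := le_max_right _ _
  have hnm : 1 / (n:ℝ) ≤ m := hρ.trans hρm
  have hQ0 : 0 ≤ Q := le_trans (by positivity) hQ
  have hpi := Real.pi_gt_three
  have hpi4 := Real.pi_lt_four
  -- Both choices bound the envelope mean: `τ₁` by the global bound `1/2` on the density, `τ₂` by
  -- comparison with the density at `y`.
  set τ₁ := 1 / 2 * (Real.pi * a) + 1 with hτ₁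
  set τ₂ := Real.exp a * (f + 1 / n) * (Real.pi * a) + 1 with hτ₂
  set τ := min τ₁ τ₂ with hτ
  have hτ1 : 1 ≤ τ := le_min (le_add_of_nonneg_left (by positivity))
    (le_add_of_nonneg_left (by positivity))
  have henv : (1 / (n:ℝ)) * ∑ k, ∫ x, envelope a (y - x) ∂(gaussianReal (θ k) 1) ≤ τ := by
    refine le_min ?_ ?_
    · exact avg_integral_envelope_le hn ha0 θ fun x _ => mixDens_le_half hn θ x
    · refine avg_integral_envelope_le hn ha0 θ fun x hx => ?_
      rw [← hae]
      exact mixDens_le_exp_mul hn ha θ hx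
  have hkey := integral_score_sub_sq_le hn ha han hae.le hρ hτ1 θ y henv
  have hτ3 : τ ≤ 3 * a := (min_le_left _ _).trans (by rw [hτ₁]; nlinarith)
  have hτQ : τ / (n * ρ ^ 2) ≤ 3 * Q := by
    calc τ / (n * ρ ^ 2) ≤ 3 * a ^ 2 / (n * ρ ^ 2) := by gcongr; nlinarith
      _ = 3 * (a ^ 2 / (n * ρ ^ 2)) := by ring
      _ ≤ _ := by gcongr
  have hE : f * ∫ x, (score a ρ x y - g / m) ^ 2 ∂(obsLaw θ)
      ≤ (80 + 3840 * Q) * (9 + Q) * min (a ^ 3 / (n * m)) f :=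
    variance_bound_le hn' ha0 hρ0 hQ hexp hf0 hfm hρm hnm hτ1 hτ3
      ((min_le_right _ _).trans (by rw [hτ₂]; gcongr)) hτQ hkey
  have hbias : f * (g / m - g / f) ^ 2 ≤ if f < ρ then mixSq θ y else 0 :=
    regularization_bias_le hf0 hρ0 (mixDeriv_sq_le θ y)
  have hsc : Measurable fun x => score a ρ x y :=
    ((continuous_score a hρ0).comp (by fun_prop : Continuous fun x : Fin n → ℝ => (x, y))).measurable
  have hi : Integrable (fun x => (score a ρ x y - g / m) ^ 2) (obsLaw θ) :=
    Integrable.of_bound (C := (a ^ 2 / ρ + |g / m|) ^ 2)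
      ((hsc.sub_const _).pow_const 2).aestronglyMeasurable (ae_of_all _ fun x => by
        rw [Real.norm_eq_abs, abs_pow]; gcongr
        exact (abs_sub _ _).trans (add_le_add_left (abs_score_le hn ha0.le hρ0 x y) _))
  calc _ ≤ ∫⁻ x, ENNReal.ofReal (2 * f * (score a ρ x y - g / m) ^ 2
          + 2 * (f * (g / m - g / f) ^ 2)) ∂(obsLaw θ) := by
        refine lintegral_mono fun x => ENNReal.ofReal_le_ofReal ?_
        have h : (score a ρ x y - g / f) ^ 2
            ≤ 2 * (score a ρ x y - g / m) ^ 2 + 2 * (g / m - g / f) ^ 2 := by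
          nlinarith [sq_nonneg ((score a ρ x y - g / m) - (g / m - g / f))]
        nlinarith [mul_le_mul_of_nonneg_left h hf0.le]
    _ = ENNReal.ofReal (∫ x, (2 * f * (score a ρ x y - g / m) ^ 2
          + 2 * (f * (g / m - g / f) ^ 2)) ∂(obsLaw θ)) :=
        (ofReal_integral_eq_lintegral_ofReal ((hi.const_mul _).add (integrable_const _))
          (ae_of_all _ fun x => add_nonneg (mul_nonneg (by positivity) (sq_nonneg _))
            (mul_nonneg zero_le_two (mul_nonneg hf0.le (sq_nonneg _))))).symm
    _ = ENNReal.ofReal (2 * (f * ∫ x, (score a ρ x y - g / m) ^ 2 ∂(obsLaw θ))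
          + 2 * (f * (g / m - g / f) ^ 2)) := by
        rw [integral_add (hi.const_mul _) (integrable_const _),
          integral_const_mul]
        simp [mul_assoc]
    _ ≤ _ := by
        refine ENNReal.ofReal_le_ofReal ?_
        linarith

/-! ### Gaussian moments -/

lemma lintegral_sq_gaussianReal :
    ∫⁻ z, ENNReal.ofReal (z ^ 2) ∂(gaussianReal 0 1) = 1 := by
  have hi : Integrable (fun z : ℝ => z ^ 2) (gaussianReal 0 1) :=
    (memLp_id_gaussianReal 2).integrable_sq
  rw [← ofReal_integral_eq_lintegral_ofReal hi (ae_of_all _ fun z => sq_nonneg z)]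
  have h := variance_fun_id_gaussianReal (μ := 0) (v := 1)
  rw [variance_of_integral_eq_zero (by fun_prop) (by simp)] at h
  simpa using h

/-- A crude constant suffices: `z⁴ ≤ 24 (e^z + e^{-z})`, whose mean is `48 e^{1/2} ≤ 96`. -/
lemma lintegral_pow_four_gaussianReal :
    ∫⁻ z, ENNReal.ofReal (z ^ 4) ∂(gaussianReal 0 1) ≤ 96 := by
  have hi : ∀ t : ℝ, Integrable (fun z : ℝ => Real.exp (t * z)) (gaussianReal 0 1) :=
    fun t => integrable_exp_mul_gaussianReal t
  have hv : ∀ t : ℝ, ∫ z, Real.exp (t * z) ∂(gaussianReal 0 1) = Real.exp (t ^ 2 / 2) := fun t => by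
    have := congrFun (mgf_id_gaussianReal (μ := 0) (v := 1)) t
    simpa [mgf] using this
  have he : Real.exp (1 / 2) ≤ 2 := by
    have h1 := Real.exp_one_lt_d9
    have h2 : Real.exp (1 / 2) ^ 2 = Real.exp 1 := by rw [← Real.exp_nat_mul]; norm_num
    nlinarith [Real.exp_pos (1 / 2)]
  calc ∫⁻ z, ENNReal.ofReal (z ^ 4) ∂(gaussianReal 0 1)
      ≤ ∫⁻ z, ENNReal.ofReal (24 * (Real.exp (1 * z) + Real.exp (-1 * z))) ∂(gaussianReal 0 1) := by
        refine lintegral_mono fun z => ENNReal.ofReal_le_ofReal ?_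
        have h1 := Real.sum_le_exp_of_nonneg (abs_nonneg z) 5
        have h2 : |z| ^ 4 / 24 ≤ Real.exp |z| := by
          simp only [Finset.sum_range_succ, Nat.factorial] at h1
          norm_num at h1
          have := abs_nonneg z
          nlinarith [pow_nonneg this 2, pow_nonneg this 3]
        rw [Even.pow_abs (by decide)] at h2
        have h3 : Real.exp |z| ≤ Real.exp (1 * z) + Real.exp (-1 * z) := by
          rcases abs_cases z with ⟨h, _⟩ | ⟨h, _⟩ <;> rw [h]
          · rw [one_mul]; linarith [Real.exp_pos (-1 * z)]
          · rw [neg_one_mul]; linarith [Real.exp_pos (1 * z)]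
        linarith
    _ = ENNReal.ofReal (24 * (Real.exp (1 ^ 2 / 2) + Real.exp ((-1) ^ 2 / 2))) := by
        have hi2 : Integrable (fun z : ℝ => Real.exp (1 * z) + Real.exp (-1 * z))
          (gaussianReal 0 1) := (hi 1).add (hi (-1))
        rw [← ofReal_integral_eq_lintegral_ofReal (hi2.const_mul 24)
          (ae_of_all _ fun z => by positivity), integral_const_mul, integral_add (hi 1) (hi (-1)),
          hv, hv]
    _ ≤ ENNReal.ofReal 96 := ENNReal.ofReal_le_ofReal (by norm_num at he ⊢; linarith)
    _ = 96 := by simp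

/-! ### Losses at large observations -/

/-- The part of `E (K + 2 (X - u)²)`, `X ∼ N(u, 1)`, that comes from `|X| > T`. -/
def tailLoss (K T u : ℝ) : ℝ≥0∞ :=
  ∫⁻ y, ENNReal.ofReal ((Set.Ioi T).indicator (fun _ => K + 2 * (y - u) ^ 2) |y|)
    ∂(gaussianReal u 1)

lemma measurable_indicator_abs (T : ℝ) {F : ℝ → ℝ} (hF : Measurable F) :
    Measurable fun y => (Set.Ioi T).indicator (fun _ => F y) |y| := by
  have : (fun y => (Set.Ioi T).indicator (fun _ => F y) |y|)
      = {y | T < |y|}.indicator F := by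
    ext y; simp [Set.indicator_apply]
  rw [this]
  exact hF.indicator (measurableSet_lt measurable_const measurable_abs)

lemma tailLoss_eq (K T u : ℝ) :
    tailLoss K T u = ∫⁻ z, ENNReal.ofReal ((Set.Ioi T).indicator (fun _ => K + 2 * z ^ 2) |u + z|)
      ∂(gaussianReal 0 1) := by
  have h := gaussianReal_map_const_add (μ := 0) (v := 1) u
  rw [zero_add] at h
  rw [tailLoss, ← h, lintegral_map (measurable_indicator_abs T (by fun_prop)).ennreal_ofReal
    (by fun_prop)]
  simp

lemma lintegral_quadratic_gaussianReal {K : ℝ} (hK : 0 ≤ K) :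
    ∫⁻ z, ENNReal.ofReal (K + 2 * z ^ 2) ∂(gaussianReal 0 1) = ENNReal.ofReal (K + 2) := by
  have : ∀ z : ℝ, ENNReal.ofReal (K + 2 * z ^ 2)
      = ENNReal.ofReal K + 2 * ENNReal.ofReal (z ^ 2) := fun z => by
    rw [ENNReal.ofReal_add hK (by positivity), ENNReal.ofReal_mul zero_le_two,
      ENNReal.ofReal_ofNat]
  simp_rw [this]
  rw [lintegral_add_left measurable_const, lintegral_const_mul _ (by fun_prop),
    lintegral_sq_gaussianReal, ENNReal.ofReal_add hK zero_le_two]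
  simp

lemma tailLoss_le_const {K : ℝ} (hK : 0 ≤ K) (T u : ℝ) : tailLoss K T u ≤ ENNReal.ofReal (K + 2) := by
  rw [tailLoss_eq, ← lintegral_quadratic_gaussianReal hK]
  refine lintegral_mono fun z => ENNReal.ofReal_le_ofReal ?_
  refine Set.indicator_apply_le' (fun _ => le_rfl) fun _ => by positivity

/-- An observation beyond `T` forces noise beyond `s`; then `2 z² ≤ 4 s² + 4 (|z| - s)²` brings in
the Gaussian tail moments. -/
lemma tailLoss_le_of_add_le {K : ℝ} (hK : 0 ≤ K) {s T u : ℝ} (hs : 1 ≤ s) (h : |u| + s ≤ T) :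
    tailLoss K T u ≤ ENNReal.ofReal ((K + 12) * s * Real.exp (-s ^ 2 / 2)) := by
  have hs0 : 0 < s := by linarith
  rw [tailLoss_eq]
  calc _ ≤ ∫⁻ z, ENNReal.ofReal ((Set.Ioi s).indicator
        (fun v => (K + 4 * s ^ 2) + 4 * (v - s) ^ 2) |z|) ∂(gaussianReal 0 1) := by
        refine lintegral_mono fun z => ENNReal.ofReal_le_ofReal ?_
        refine Set.indicator_apply_le' (fun hz => ?_) fun _ =>
          Set.indicator_nonneg (fun v _ => by positivity) _
        have h1 : T < |u + z| := hz
        have h2 : |z| ∈ Set.Ioi s := by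
          have := abs_add_le u z
          simp only [Set.mem_Ioi]; linarith
        rw [Set.indicator_of_mem h2, ← sq_abs z]
        nlinarith [sq_nonneg (|z| - 2 * s)]
    _ ≤ ENNReal.ofReal (2 * phi s * ((K + 4 * s ^ 2) / s + 2 * 4 / s ^ 3)) :=
        lintegral_tail_le hs0 (by positivity) (by norm_num)
    _ ≤ _ := by
        refine ENNReal.ofReal_le_ofReal ?_
        have h1 := phi_le_half s
        have h2 : (K + 4 * s ^ 2) / s + 2 * 4 / s ^ 3 ≤ (K + 12) * s := by
          have h3 : 2 * 4 / s ^ 3 ≤ 8 * s := by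
            rw [div_le_iff₀ (by positivity)]
            have : 1 ≤ s ^ 4 := one_le_pow₀ hs
            nlinarith
          have h4 : (K + 4 * s ^ 2) / s ≤ K * s + 4 * s := by
            rw [div_le_iff₀ hs0]
            nlinarith [mul_le_mul_of_nonneg_left (show 1 ≤ s * s by nlinarith) hK]
          linarith
        calc 2 * phi s * ((K + 4 * s ^ 2) / s + 2 * 4 / s ^ 3)
            ≤ 2 * (Real.exp (-s ^ 2 / 2) / 2) * ((K + 12) * s) := by gcongr
          _ = _ := by ring

/-- The threshold is `|u| = 1/T`. Below it, moving the cut from `T` to `T - 1/T` changes the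
Gaussian factor by at most `e`. Between `1/T` and `1`, noise beyond `3T/4` satisfies `1 ≤ (16/9) u²
z²`, which produces the factor `u²`. Above `1` the trivial bound suffices. -/
lemma tailLoss_le_sq {K : ℝ} (hK : 0 ≤ K) {T u : ℝ} (hT : 4 ≤ T) :
    tailLoss K T u ≤ ENNReal.ofReal (3 * (K + 12) * T * Real.exp (-T ^ 2 / 2)
      + (2 * K + 400) * min (u ^ 2) 1) := by
  have hT0 : 0 < T := by linarith
  have hmin : 0 ≤ min (u ^ 2) 1 := le_min (sq_nonneg _) zero_le_one
  have hE : 0 ≤ 3 * (K + 12) * T * Real.exp (-T ^ 2 / 2) := by positivity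
  rcases le_or_gt |u| (1 / T) with h1 | h1
  · have hT1 : 1 / T ≤ 1 / 4 := by gcongr
    refine (tailLoss_le_of_add_le hK (s := T - 1 / T) (by linarith) (by linarith)).trans
      (ENNReal.ofReal_le_ofReal ?_)
    have he : Real.exp (-(T - 1 / T) ^ 2 / 2) ≤ 3 * Real.exp (-T ^ 2 / 2) := by
      have : Real.exp 1 ≤ 3 := by linarith [Real.exp_one_lt_d9]
      calc Real.exp (-(T - 1 / T) ^ 2 / 2) ≤ Real.exp (1 + -T ^ 2 / 2) := by
            gcongr
            have : T * (1 / T) = 1 := by field_simp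
            nlinarith [sq_nonneg (1 / T)]
        _ = Real.exp 1 * Real.exp (-T ^ 2 / 2) := Real.exp_add _ _
        _ ≤ _ := by gcongr
    have h2 : T - 1 / T ≤ T := by have : 0 < 1 / T := by positivity
                                  linarith
    have h3 : 0 ≤ T - 1 / T := by linarith
    calc (K + 12) * (T - 1 / T) * Real.exp (-(T - 1 / T) ^ 2 / 2)
        ≤ (K + 12) * T * (3 * Real.exp (-T ^ 2 / 2)) := by gcongr
      _ ≤ _ := by
        have : 0 ≤ (2 * K + 400) * min (u ^ 2) 1 := by positivity
        linarith
  · suffices h : tailLoss K T u ≤ ENNReal.ofReal ((2 * K + 400) * min (u ^ 2) 1) from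
      h.trans (ENNReal.ofReal_le_ofReal (by linarith))
    by_cases h1u : 1 ≤ u ^ 2
    · rw [min_eq_right h1u]
      exact (tailLoss_le_const hK T u).trans (ENNReal.ofReal_le_ofReal (by linarith))
    · rw [min_eq_left (not_le.1 h1u).le, tailLoss_eq]
      have hu1 : |u| ≤ T / 4 := by
        have : |u| ≤ 1 := by rw [← sq_le_one_iff_abs_le_one]; exact (not_le.1 h1u).le
        linarith
      have hu2 : 1 / T ^ 2 ≤ u ^ 2 := by
        rw [← sq_abs u, ← one_div_pow]; exact pow_le_pow_left₀ (by positivity) h1.le 2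
      have hm4 : Measurable fun z : ℝ => ENNReal.ofReal (z ^ 4) := by fun_prop
      calc _ ≤ ∫⁻ z, (ENNReal.ofReal (16 / 9 * u ^ 2 * K) * ENNReal.ofReal (z ^ 2)
            + ENNReal.ofReal (32 / 9 * u ^ 2) * ENNReal.ofReal (z ^ 4)) ∂(gaussianReal 0 1) := by
            refine lintegral_mono fun z => ?_
            rw [← ENNReal.ofReal_mul (by positivity), ← ENNReal.ofReal_mul (by positivity),
              ← ENNReal.ofReal_add (by positivity) (by positivity)]
            refine ENNReal.ofReal_le_ofReal ?_
            refine Set.indicator_apply_le' (fun hz => ?_) fun _ => by positivity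
            have h3 : T < |u + z| := hz
            have h4 : 3 / 4 * T ≤ |z| := by
              have := abs_add_le u z
              linarith
            have h5 : 9 / 16 * T ^ 2 ≤ z ^ 2 := by
              rw [← sq_abs z]
              calc 9 / 16 * T ^ 2 = (3 / 4 * T) ^ 2 := by ring
                _ ≤ _ := by gcongr
            have h6 : 1 ≤ 16 / 9 * u ^ 2 * z ^ 2 := by
              calc (1:ℝ) = 16 / 9 * (1 / T ^ 2) * (9 / 16 * T ^ 2) := by field_simp
                _ ≤ _ := by gcongr
            have h7 : 0 ≤ K + 2 * z ^ 2 := by positivity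
            calc K + 2 * z ^ 2 ≤ (16 / 9 * u ^ 2 * z ^ 2) * (K + 2 * z ^ 2) :=
                  le_mul_of_one_le_left h7 h6
              _ = _ := by ring
        _ ≤ ENNReal.ofReal (16 / 9 * u ^ 2 * K) * 1 + ENNReal.ofReal (32 / 9 * u ^ 2) * 96 := by
            rw [lintegral_add_left (by fun_prop), lintegral_const_mul _ (by fun_prop),
              lintegral_const_mul _ hm4, lintegral_sq_gaussianReal]
            gcongr
            exact lintegral_pow_four_gaussianReal
        _ = ENNReal.ofReal (16 / 9 * u ^ 2 * K + 32 / 9 * u ^ 2 * 96) := by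
            rw [ENNReal.ofReal_add (by positivity) (by positivity),
              ENNReal.ofReal_mul (p := 32 / 9 * u ^ 2) (by positivity), mul_one,
              ENNReal.ofReal_ofNat]
        _ ≤ _ := ENNReal.ofReal_le_ofReal (by nlinarith [sq_nonneg u, mul_nonneg hK (sq_nonneg u)])

/-- The proportion of the means exceeding `x` in absolute value. -/
def tailAvg {n : ℕ} (θ : Fin n → ℝ) (x : ℝ) : ℝ :=
  (1 / n) * ∑ k, (Set.Ioi x).indicator (fun _ => (1:ℝ)) |θ k|

/-- The average of `min (θ², c)`. -/
def truncSq {n : ℕ} (θ : Fin n → ℝ) (c : ℝ) : ℝ := (1 / n) * ∑ k, min (θ k ^ 2) c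

lemma avg_tailLoss_le_ofReal {n : ℕ} (hn : 0 < n) {K T : ℝ} {θ f : Fin n → ℝ} (hf : ∀ k, 0 ≤ f k)
    (h : ∀ k, tailLoss K T (θ k) ≤ ENNReal.ofReal (f k)) :
    (n : ℝ≥0∞)⁻¹ * ∑ k, tailLoss K T (θ k) ≤ ENNReal.ofReal ((1 / (n:ℝ)) * ∑ k, f k) := by
  rw [ofReal_avg hn hf]
  gcongr with k
  exact h k

/-- Means beyond `x` pay the full constant; the others lie at distance at least `a` from the cut `x
+ a`. -/
lemma avg_tailLoss_le_tailAvg {n : ℕ} (hn : 0 < n) {K : ℝ} (hK : 0 ≤ K) {a : ℝ} (ha : 1 ≤ a)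
    (θ : Fin n → ℝ) (x : ℝ) :
    (n : ℝ≥0∞)⁻¹ * ∑ k, tailLoss K (x + a) (θ k)
      ≤ ENNReal.ofReal ((K + 2) * tailAvg θ x + (K + 12) * a * Real.exp (-a ^ 2 / 2)) := by
  rw [tailAvg, ← avg_affine hn]
  have hE : 0 ≤ (K + 12) * a * Real.exp (-a ^ 2 / 2) := by positivity
  have hI : ∀ k, 0 ≤ (Set.Ioi x).indicator (fun _ => (1:ℝ)) |θ k| := fun k =>
    Set.indicator_nonneg (fun _ _ => zero_le_one) _
  refine avg_tailLoss_le_ofReal hn (fun k => add_nonneg (mul_nonneg (by linarith) (hI k)) hE)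
    fun k => ?_
  by_cases h : x < |θ k|
  · rw [Set.indicator_of_mem (show |θ k| ∈ Set.Ioi x from h)]
    exact (tailLoss_le_const hK _ _).trans (ENNReal.ofReal_le_ofReal (by linarith))
  · rw [Set.indicator_of_notMem (show |θ k| ∉ Set.Ioi x from h), mul_zero, zero_add]
    exact tailLoss_le_of_add_le hK ha (by linarith)

lemma avg_tailLoss_le_truncSq {n : ℕ} (hn : 0 < n) {K : ℝ} (hK : 0 ≤ K) {T : ℝ} (hT : 4 ≤ T)
    (θ : Fin n → ℝ) :
    (n : ℝ≥0∞)⁻¹ * ∑ k, tailLoss K T (θ k)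
      ≤ ENNReal.ofReal ((2 * K + 400) * truncSq θ 1 + 3 * (K + 12) * T * Real.exp (-T ^ 2 / 2)) := by
  rw [truncSq, ← avg_affine hn]
  have hmin : ∀ k, 0 ≤ min (θ k ^ 2) 1 := fun k => le_min (sq_nonneg _) zero_le_one
  refine avg_tailLoss_le_ofReal hn (fun k => by have := hmin k; positivity) fun k => ?_
  rw [add_comm]
  exact tailLoss_le_sq hK hT

/-! ### Integrated regret -/

/-- The bound for the pointwise regret of the estimated score. -/
def regretBound {n : ℕ} (K a ρ : ℝ) (θ : Fin n → ℝ) (y : ℝ) : ℝ :=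
  K * min (a ^ 3 / (n * max (mixDens θ y) ρ)) (mixDens θ y)
    + 2 * if mixDens θ y < ρ then mixSq θ y else 0

/-- Outside the window the regret bound is at most `K f + 2 mixSq`, which is exactly the average of
the densities of `K + 2 (X - θ k)²`. -/
lemma lintegral_regretBound_le {n : ℕ} (hn : 0 < n) {K a ρ T c : ℝ} {W : ℝ → ℝ} (hK : 0 ≤ K)
    (θ : Fin n → ℝ) (hin : ∀ y, |y| ≤ T → regretBound K a ρ θ y ≤ W y)
    (hW : ∫⁻ y in Set.Icc (-T) T, ENNReal.ofReal (W y) ≤ ENNReal.ofReal c) :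
    ∫⁻ y, ENNReal.ofReal (regretBound K a ρ θ y)
      ≤ ENNReal.ofReal c + (n : ℝ≥0∞)⁻¹ * ∑ k, tailLoss K T (θ k) := by
  have hS : MeasurableSet (Set.Icc (-T) T) := measurableSet_Icc
  rw [← lintegral_add_compl _ hS]
  refine add_le_add ((setLIntegral_mono' hS fun y hy =>
    ENNReal.ofReal_le_ofReal (hin y (abs_le.2 hy))).trans hW) ?_
  simp only [tailLoss]
  rw [avg_lintegral_gaussianReal hn θ
    (F := fun k y => (Set.Ioi T).indicator (fun _ => K + 2 * (y - θ k) ^ 2) |y|)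
    (fun k => measurable_indicator_abs T (by fun_prop))
    (fun k y => Set.indicator_nonneg (fun _ _ => by positivity) _),
    ← lintegral_indicator hS.compl]
  refine lintegral_mono fun y => ?_
  by_cases hy : y ∈ (Set.Icc (-T) T)ᶜ
  · have h1 : |y| ∈ Set.Ioi T := by
      simp only [Set.mem_Ioi]; by_contra! h; exact hy (abs_le.1 h)
    rw [Set.indicator_of_mem hy]
    simp only [Set.indicator_of_mem h1]
    refine ENNReal.ofReal_le_ofReal ?_
    have h2 : (1 / (n:ℝ)) * ∑ k, phi (y - θ k) * (K + 2 * (y - θ k) ^ 2)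
        = K * mixDens θ y + 2 * mixSq θ y := by
      simp only [mixDens, mixSq, Finset.mul_sum, ← Finset.sum_add_distrib]
      exact Finset.sum_congr rfl fun k _ => by ring
    rw [h2, regretBound]
    have h3 := mixSq_nonneg θ y
    gcongr
    · exact min_le_right _ _
    · split_ifs <;> linarith
  · rw [Set.indicator_of_notMem hy]; exact zero_le

/-- The integrated regret in terms of the tail of the means. -/
lemma lintegral_regretBound_le_tailAvg {n : ℕ} (hn : 0 < n) {K a ρ x : ℝ} (hK : 0 ≤ K)
    (ha : 2 ≤ a) (hae : Real.exp (-a ^ 2 / 2) = 1 / n) (hρ : 1 / n ≤ ρ) (hx : 0 ≤ x)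
    (θ : Fin n → ℝ) :
    ∫⁻ y, ENNReal.ofReal (regretBound K a ρ θ y)
      ≤ ENNReal.ofReal ((K * (a ^ 3 / (n * ρ)) + 4 * a ^ 2 * ρ) * (2 * (x + a))
        + ((K + 2) * tailAvg θ x + (K + 12) * a / n)) := by
  have hn' : (0:ℝ) < n := by exact_mod_cast hn
  have hρ0 : 0 < ρ := lt_of_lt_of_le (by positivity) hρ
  have hta : 0 ≤ tailAvg θ x := mul_nonneg (by positivity)
    (Finset.sum_nonneg fun k _ => Set.indicator_nonneg (fun _ _ => zero_le_one) _)
  refine (lintegral_regretBound_le hn (T := x + a) (W := fun _ => K * (a ^ 3 / (n * ρ)) + 4 * a ^ 2 * ρ)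
    hK θ (fun y _ => ?_) (c := (K * (a ^ 3 / (n * ρ)) + 4 * a ^ 2 * ρ) * (2 * (x + a))) ?_).trans ?_
  · rw [regretBound]
    have h1 := mixSq_le hn ha θ y
    rw [hae] at h1
    have h2 : (if mixDens θ y < ρ then mixSq θ y else 0) ≤ 2 * a ^ 2 * ρ := by
      split_ifs with h
      · calc mixSq θ y ≤ a ^ 2 * ρ + a ^ 2 * ρ := by
              refine h1.trans ?_
              gcongr
          _ = _ := by ring
      · positivity
    have h3 : min (a ^ 3 / (n * max (mixDens θ y) ρ)) (mixDens θ y) ≤ a ^ 3 / (n * ρ) := by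
      refine (min_le_left _ _).trans ?_
      gcongr
      exact le_max_right _ _
    have h4 := mul_le_mul_of_nonneg_left h3 hK
    linarith
  · rw [setLIntegral_const, Real.volume_Icc, ← ENNReal.ofReal_mul (by positivity)]
    refine ENNReal.ofReal_le_ofReal (le_of_eq (by ring))
  · rw [ENNReal.ofReal_add (by positivity) (by positivity)]
    gcongr
    refine (avg_tailLoss_le_tailAvg hn hK (by linarith) θ x).trans ?_
    rw [hae]
    exact ENNReal.ofReal_le_ofReal (le_of_eq (by ring))

/-- On the window `y² ≤ T |y|`, so the integrand is dominated by exponentials of rate `T/2`, whose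
integral gains `4/T ≤ 1`. -/
lemma lintegral_exp_half_sq_le {T : ℝ} (hT : 4 ≤ T) {c : ℝ} (hc : 0 ≤ c) :
    ∫⁻ y in Set.Icc (-T) T, ENNReal.ofReal (c * Real.exp (y ^ 2 / 2))
      ≤ ENNReal.ofReal (c * Real.exp (T ^ 2 / 2)) := by
  have hT0 : 0 < T := by linarith
  have hi : ∀ t : ℝ, IntegrableOn (fun y => Real.exp (t * y)) (Set.Icc (-T) T) := fun t =>
    (by fun_prop : Continuous fun y => Real.exp (t * y)).continuousOn.integrableOn_Icc
  have hv : ∀ t : ℝ, t ≠ 0 → ∫ y in Set.Icc (-T) T, Real.exp (t * y)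
      = (Real.exp (t * T) - Real.exp (t * -T)) / t := fun t ht => by
    rw [integral_Icc_eq_integral_Ioc, ← intervalIntegral.integral_of_le (by linarith),
      intervalIntegral.integral_comp_mul_left (fun y => Real.exp y) ht, integral_exp]
    simp only [smul_eq_mul]; field_simp
  have hi2 : IntegrableOn (fun y => c * (Real.exp (T / 2 * y) + Real.exp (-(T / 2) * y)))
      (Set.Icc (-T) T) := ((hi _).add (hi _)).const_mul c
  calc _ ≤ ∫⁻ y in Set.Icc (-T) T,
        ENNReal.ofReal (c * (Real.exp (T / 2 * y) + Real.exp (-(T / 2) * y))) := by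
        refine setLIntegral_mono' measurableSet_Icc fun y hy => ENNReal.ofReal_le_ofReal ?_
        gcongr
        have h1 := Real.exp_pos (T / 2 * y)
        have h2 := Real.exp_pos (-(T / 2) * y)
        rcases le_total 0 y with h | h
        · have : Real.exp (y ^ 2 / 2) ≤ Real.exp (T / 2 * y) := by
            gcongr; nlinarith [hy.2]
          linarith
        · have : Real.exp (y ^ 2 / 2) ≤ Real.exp (-(T / 2) * y) := by
            gcongr; nlinarith [hy.1]
          linarith
    _ = ENNReal.ofReal (c * ((Real.exp (T / 2 * T) - Real.exp (T / 2 * -T)) / (T / 2)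
          + (Real.exp (-(T / 2) * T) - Real.exp (-(T / 2) * -T)) / (-(T / 2)))) := by
        rw [← ofReal_integral_eq_lintegral_ofReal hi2 (ae_of_all _ fun y => by positivity),
          integral_const_mul, integral_add (hi _) (hi _), hv _ (by positivity),
          hv _ (by simp; positivity)]
    _ ≤ _ := by
        refine ENNReal.ofReal_le_ofReal ?_
        gcongr
        have e1 : T / 2 * T = T ^ 2 / 2 := by ring
        have e2 : -(T / 2) * -T = T ^ 2 / 2 := by ring
        have e3 : T / 2 * -T = -(T ^ 2 / 2) := by ring
        have e4 : -(T / 2) * T = -(T ^ 2 / 2) := by ring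
        rw [e1, e2, e3, e4]
        have h1 := Real.exp_pos (T ^ 2 / 2)
        have h2 := Real.exp_pos (-(T ^ 2 / 2))
        have : (Real.exp (T ^ 2 / 2) - Real.exp (-(T ^ 2 / 2))) / (T / 2)
          + (Real.exp (-(T ^ 2 / 2)) - Real.exp (T ^ 2 / 2)) / (-(T / 2))
          = 4 * (Real.exp (T ^ 2 / 2) - Real.exp (-(T ^ 2 / 2))) / T := by field_simp; ring
        rw [this, div_le_iff₀ hT0]
        nlinarith

/-- A mean with `|θ k| ≤ 1/T` changes the density at `|y| ≤ T` only by a bounded factor. Each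
summand is thus at least `(2/25) exp(-y²/2) (1 - T² min(θ k², 1))`, the right side being negative or
zero for the other means; averaging loses at most half. -/
lemma mixDens_ge {n : ℕ} (hn : 0 < n) {T : ℝ} (hT : 4 ≤ T) (θ : Fin n → ℝ)
    (hθ : T ^ 2 * truncSq θ 1 ≤ 1 / 2) {y : ℝ} (hy : |y| ≤ T) :
    Real.exp (-y ^ 2 / 2) / 25 ≤ mixDens θ y := by
  have hT0 : 0 < T := by linarith
  set E := Real.exp (-y ^ 2 / 2) with hE
  have hE0 : 0 < E := Real.exp_pos _
  have hk : ∀ k, -(2 / 25 * T ^ 2 * E) * min (θ k ^ 2) 1 + 2 / 25 * E ≤ phi (y - θ k) := by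
    intro k
    rcases le_or_gt (θ k ^ 2) (1 / T ^ 2) with h | h
    · have h0 : 0 ≤ min (θ k ^ 2) 1 := le_min (sq_nonneg _) zero_le_one
      have h1 : |θ k| ≤ 1 / T := by
        rw [← one_div_pow] at h
        exact abs_le.2 (abs_le_of_sq_le_sq' h (by positivity))
      have h2 : -(y - θ k) ^ 2 / 2 ≥ -y ^ 2 / 2 - 9 / 8 := by
        have h3 : |y * θ k| ≤ 1 := by
          rw [abs_mul]
          calc |y| * |θ k| ≤ T * (1 / T) := by gcongr
            _ = 1 := by field_simp
        have h4 : θ k ^ 2 ≤ 1 / 4 := h.trans (by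
          rw [div_le_div_iff₀ (by positivity) (by norm_num)]; nlinarith)
        nlinarith [(abs_le.1 h3).1]
      have h5 : E * (1 / 4) ≤ Real.exp (-(y - θ k) ^ 2 / 2) := by
        have h6 : Real.exp (9 / 8) ≤ 4 := by
          have h7 := Real.exp_one_lt_d9
          have h8 := Real.add_one_le_exp (-(1 / 8))
          have h9 : Real.exp (9 / 8) * Real.exp (-(1 / 8)) = Real.exp 1 := by
            rw [← Real.exp_add]; norm_num
          nlinarith [Real.exp_pos (9 / 8)]
        have h7 : (1:ℝ) / 4 ≤ Real.exp (-(9 / 8)) := by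
          rw [Real.exp_neg, ← one_div]; gcongr
        calc E * (1 / 4) ≤ Real.exp (-y ^ 2 / 2) * Real.exp (-(9 / 8)) := by gcongr
          _ ≤ _ := by rw [← Real.exp_add]; gcongr; linarith
      have h6 : √(2 * Real.pi) ≤ 5 / 2 + 1 / 50 := by
        rw [Real.sqrt_le_left (by norm_num)]
        nlinarith [Real.pi_lt_d2]
      have h7 : 2 / 25 * E ≤ phi (y - θ k) := by
        rw [phi, le_div_iff₀ (by positivity)]
        nlinarith
      have h8 : 0 ≤ 2 / 25 * T ^ 2 * E * min (θ k ^ 2) 1 := by positivity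
      linarith
    · have h1 : 1 ≤ T ^ 2 * min (θ k ^ 2) 1 := by
        rcases min_cases (θ k ^ 2) 1 with ⟨h2, _⟩ | ⟨h2, _⟩ <;> rw [h2]
        · rw [div_lt_iff₀ (by positivity)] at h; linarith
        · nlinarith
      have h2 := phi_pos (y - θ k)
      nlinarith
  have := avg_le_avg hk
  rw [avg_affine hn] at this
  change _ * truncSq θ 1 + _ ≤ mixDens θ y at this
  nlinarith

/-- The integrated regret when most of the means are close to zero. -/
lemma lintegral_regretBound_le_truncSq {n : ℕ} (hn : 0 < n) {K a ρ T : ℝ} (hK : 0 ≤ K)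
    (ha : 0 < a) (hT : 4 ≤ T) (hTρ : Real.exp (-T ^ 2 / 2) = 25 * ρ) (θ : Fin n → ℝ)
    (hθ : T ^ 2 * truncSq θ 1 ≤ 1 / 2) :
    ∫⁻ y, ENNReal.ofReal (regretBound K a ρ θ y)
      ≤ ENNReal.ofReal (K * (a ^ 3 / (n * ρ)) +
        ((2 * K + 400) * truncSq θ 1 + 75 * (K + 12) * T * ρ)) := by
  have hn' : (0:ℝ) < n := by exact_mod_cast hn
  have hρ0 : 0 < ρ := by have := Real.exp_pos (-T ^ 2 / 2); linarith
  have htr : 0 ≤ truncSq θ 1 := mul_nonneg (by positivity)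
    (Finset.sum_nonneg fun k _ => le_min (sq_nonneg _) zero_le_one)
  refine (lintegral_regretBound_le hn (T := T)
    (W := fun y => (25 * K * a ^ 3 / n) * Real.exp (y ^ 2 / 2))
    hK θ (fun y hy => ?_) (c := K * (a ^ 3 / (n * ρ))) ?_).trans ?_
  · have h1 := mixDens_ge hn hT θ hθ hy
    -- This is why `exp(-T²/2) = 25ρ`: the lower bound on the density still reaches `ρ` at the edge
    -- of the window, so the regularization bias vanishes inside.
    have h2 : ρ ≤ mixDens θ y := by
      have : Real.exp (-T ^ 2 / 2) ≤ Real.exp (-y ^ 2 / 2) := by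
        rw [← sq_abs y]
        gcongr
      linarith
    rw [regretBound, if_neg (not_lt.2 h2), mul_zero, add_zero, max_eq_left h2]
    have hE : Real.exp (y ^ 2 / 2) = (Real.exp (-y ^ 2 / 2))⁻¹ := by
      rw [← Real.exp_neg]; congr 1; ring
    calc K * min (a ^ 3 / (n * mixDens θ y)) (mixDens θ y)
        ≤ K * (a ^ 3 / (n * (Real.exp (-y ^ 2 / 2) / 25))) := by
          gcongr
          refine (min_le_left _ _).trans ?_
          gcongr
      _ = _ := by rw [hE]; have := Real.exp_pos (-y ^ 2 / 2); field_simp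
  · refine (lintegral_exp_half_sq_le hT (by positivity)).trans
      (ENNReal.ofReal_le_ofReal (le_of_eq ?_))
    have hE : Real.exp (T ^ 2 / 2) = (25 * ρ)⁻¹ := by
      rw [← hTρ, ← Real.exp_neg]; congr 1; ring
    rw [hE]; field_simp
  · rw [ENNReal.ofReal_add (by positivity) (by positivity)]
    gcongr
    refine (avg_tailLoss_le_truncSq hn hK hT θ).trans ?_
    rw [hTρ]
    exact ENNReal.ofReal_le_ofReal (le_of_eq (by ring))

/-! ### Removing an observation from its own estimator -/

lemma abs_avg_sub_avg_le {n : ℕ} {F : ℝ → ℝ} {B : ℝ} (hB : ∀ z, |F z| ≤ B / 2)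
    {x x' : Fin n → ℝ} (k : Fin n) (h : ∀ j, j ≠ k → x j = x' j) (y : ℝ) :
    |(1 / (n:ℝ)) * (∑ j, F (y - x j)) - (1 / (n:ℝ)) * ∑ j, F (y - x' j)| ≤ B / n := by
  rw [← mul_sub, ← Finset.sum_sub_distrib, Finset.sum_eq_single_of_mem k (Finset.mem_univ k)
    fun j _ hj => by rw [h j hj, sub_self], abs_mul, abs_of_nonneg (by positivity)]
  have h1 : |F (y - x k) - F (y - x' k)| ≤ B := by
    have := abs_sub (F (y - x k)) (F (y - x' k))
    linarith [hB (y - x k), hB (y - x' k)]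
  calc _ ≤ 1 / (n:ℝ) * B := by gcongr
    _ = _ := by ring

/-- One observation moves the density estimate by at most `a/n` and its derivative by at most
`a²/n`, while the denominator stays above `ρ`. The bound is relative to the score, since a uniform
bound on the score would be too large. -/
lemma abs_score_sub_score_le {n : ℕ} {a ρ : ℝ} (ha : 1 ≤ a) (hρ : 0 < ρ)
    {x x' : Fin n → ℝ} (k : Fin n) (h : ∀ j, j ≠ k → x j = x' j) (y : ℝ) :
    |score a ρ x y - score a ρ x' y| ≤ a ^ 2 / (n * ρ) * (1 + |score a ρ x' y|) := by
  have ha0 : 0 ≤ a := by linarith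
  have hU : |kdeDeriv a x y - kdeDeriv a x' y| ≤ a ^ 2 / n :=
    abs_avg_sub_avg_le (abs_bandKernelDeriv_le' ha0) k h y
  have hV : |kde a x y - kde a x' y| ≤ a / n :=
    abs_avg_sub_avg_le (abs_bandKernel_le' ha0) k h y
  unfold score
  set M := max (kde a x y) ρ with hM
  set M' := max (kde a x' y) ρ with hM'
  have hM0 : 0 < M := lt_max_of_lt_right hρ
  have hM'0 : 0 < M' := lt_max_of_lt_right hρ
  have hMρ : ρ ≤ M := le_max_right _ _
  have hMM : |M' - M| ≤ a / n := by
    rw [abs_sub_comm]; exact (abs_max_sub_max_le_abs _ _ _).trans hV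
  set U := kdeDeriv a x y
  set U' := kdeDeriv a x' y
  have hn : (0:ℝ) < n := by
    have : 0 < n := k.pos
    exact_mod_cast this
  have e : U / M - U' / M' = (U - U') / M + U' / M' * ((M' - M) / M) := by field_simp; ring
  rw [e]
  calc |(U - U') / M + U' / M' * ((M' - M) / M)|
      ≤ |U - U'| / M + |U' / M'| * (|M' - M| / M) := by
        refine (abs_add_le _ _).trans ?_
        rw [abs_mul, abs_div (U - U'), abs_div (M' - M), abs_of_pos hM0]
    _ ≤ (a ^ 2 / n) / ρ + |U' / M'| * ((a ^ 2 / n) / ρ) := by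
        gcongr
        refine hMM.trans ?_
        gcongr
        nlinarith
    _ = _ := by field_simp

lemma sq_le_of_abs_sub_le {A B Z δ : ℝ} (hδ0 : 0 ≤ δ) (hδ : δ ≤ 1)
    (h : |A - B| ≤ δ * (1 + |B| + |Z|)) :
    A ^ 2 ≤ (1 + 9 * δ) * B ^ 2 + 9 * δ * (1 + Z ^ 2) := by
  set w := 1 + |B| + |Z| with hw
  have hB := abs_nonneg B
  have hZ := abs_nonneg Z
  have hw0 : 0 ≤ w := by positivity
  have h1 : |A| ≤ |B| + δ * w := by
    have : |A| ≤ |A - B| + |B| := by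
      calc |A| = |(A - B) + B| := by ring_nf
        _ ≤ _ := abs_add_le _ _
    linarith
  have h2 : A ^ 2 ≤ (|B| + δ * w) ^ 2 := by rw [← sq_abs A]; gcongr
  have h3 : |B| * w ≤ w * w := by gcongr; linarith
  have h4 : w ^ 2 ≤ 3 * (1 + B ^ 2 + Z ^ 2) := by
    rw [← sq_abs B, ← sq_abs Z]
    nlinarith [sq_nonneg (1 - |B|), sq_nonneg (1 - |Z|), sq_nonneg (|B| - |Z|)]
  have h5 : (|B| + δ * w) ^ 2 ≤ B ^ 2 + 3 * δ * w ^ 2 := by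
    have : (|B| + δ * w) ^ 2 = B ^ 2 + 2 * δ * (|B| * w) + δ * δ * w ^ 2 := by
      rw [← sq_abs B]; ring
    rw [this]
    have h6 : δ * δ * w ^ 2 ≤ δ * 1 * w ^ 2 := by gcongr
    have h7 : 2 * δ * (|B| * w) ≤ 2 * δ * (w * w) := by gcongr
    linarith
  have h6 : 3 * δ * w ^ 2 ≤ 3 * δ * (3 * (1 + B ^ 2 + Z ^ 2)) := by gcongr
  linarith

lemma lintegral_obsLaw_insertNth {m : ℕ} (θ : Fin (m + 1) → ℝ) (k : Fin (m + 1))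
    {F : (Fin (m + 1) → ℝ) → ℝ≥0∞} (hF : Measurable F) :
    ∫⁻ x, F x ∂(obsLaw θ) = ∫⁻ r, ∫⁻ y, F (k.insertNth (α := fun _ => ℝ) y r) ∂(gaussianReal (θ k) 1)
      ∂(obsLaw fun j => θ (k.succAbove j)) := by
  have h := (measurePreserving_piFinSuccAbove (fun j => gaussianReal (θ j) 1) k).symm
  unfold obsLaw
  rw [← h.lintegral_comp hF, lintegral_prod_symm]
  · rfl
  · exact (hF.comp (MeasurableEquiv.measurable _)).aemeasurable

lemma measurable_insertNth {m : ℕ} (k : Fin (m + 1)) :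
    Measurable fun z : ℝ × (Fin m → ℝ) => (k.insertNth (α := fun _ => ℝ) z.1 z.2) :=
  (MeasurableEquiv.piFinSuccAbove (fun _ : Fin (m + 1) => ℝ) k).symm.measurable

lemma lintegral_one_add_sq_gaussianReal (u : ℝ) {c : ℝ} (hc : 0 ≤ c) :
    ∫⁻ y, ENNReal.ofReal (c * (1 + (y - u) ^ 2)) ∂(gaussianReal u 1) = ENNReal.ofReal (2 * c) := by
  have h := gaussianReal_map_const_add (μ := 0) (v := 1) u
  rw [zero_add] at h
  rw [← h, lintegral_map (by fun_prop) (by fun_prop)]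
  simp only [add_sub_cancel_left]
  have : ∀ z : ℝ, ENNReal.ofReal (c * (1 + z ^ 2))
      = ENNReal.ofReal c + ENNReal.ofReal c * ENNReal.ofReal (z ^ 2) := fun z => by
    rw [← ENNReal.ofReal_mul hc, ← ENNReal.ofReal_add hc (by positivity)]; ring_nf
  simp_rw [this]
  rw [lintegral_add_left measurable_const, lintegral_const_mul _ (by fun_prop),
    lintegral_sq_gaussianReal, two_mul, ENNReal.ofReal_add hc hc]
  simp

/-- The risk of the rule `x ↦ y + s x y` at the `k`-th observation. -/
def selfRisk {n : ℕ} (s : (Fin n → ℝ) → ℝ → ℝ) (θ : Fin n → ℝ) (k : Fin n) : ℝ≥0∞ :=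
  ∫⁻ x, ENNReal.ofReal ((x k + s x (x k) - θ k) ^ 2) ∂(obsLaw θ)

/-- Inside the estimator, the observation `y` is replaced by an independent copy `z`, at relative
cost `δ`. The pair is then a sample together with a fresh observation, after the names of `y` and
`z` are exchanged. Here `c` is the coordinate concerned and `ins` inserts it into the remaining
ones. -/
lemma lintegral_self_le {𝒳 R : Type*} [MeasurableSpace 𝒳] [MeasurableSpace R] {P : Measure 𝒳}
    {ν : Measure R} [IsProbabilityMeasure ν] {u : ℝ} {ins : ℝ → R → 𝒳}
    (hins : Measurable fun z : ℝ × R => ins z.1 z.2)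
    (hP : ∀ F : 𝒳 → ℝ≥0∞, Measurable F →
      ∫⁻ x, F x ∂P = ∫⁻ r, ∫⁻ y, F (ins y r) ∂(gaussianReal u 1) ∂ν)
    {c : 𝒳 → ℝ} (hc : Measurable c) (hcins : ∀ y r, c (ins y r) = y) {s : 𝒳 → ℝ → ℝ} {δ : ℝ}
    (hδ0 : 0 ≤ δ) (hδ : δ ≤ 1) (hs : Measurable fun z : 𝒳 × ℝ => s z.1 z.2)
    (hpert : ∀ y z r, |s (ins y r) y - s (ins z r) y| ≤ δ * (1 + |s (ins z r) y|)) :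
    ∫⁻ x, ENNReal.ofReal ((c x + s x (c x) - u) ^ 2) ∂P ≤ ENNReal.ofReal (1 + 9 * δ) *
      (∫⁻ x, ∫⁻ y, ENNReal.ofReal ((y + s x y - u) ^ 2) ∂(gaussianReal u 1) ∂P)
        + ENNReal.ofReal (18 * δ) := by
  have hF : Measurable fun z : 𝒳 × ℝ => ENNReal.ofReal ((z.2 + s z.1 z.2 - u) ^ 2) :=
    (((measurable_snd.add hs).sub_const u).pow_const 2).ennreal_ofReal
  have hF1 : Measurable fun x => ENNReal.ofReal ((c x + s x (c x) - u) ^ 2) := by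
    have h : Measurable fun x => s x (c x) := hs.comp (measurable_id.prodMk hc)
    exact (((hc.add h).sub_const u).pow_const 2).ennreal_ofReal
  have hF2 : Measurable fun x => ∫⁻ y, ENNReal.ofReal ((y + s x y - u) ^ 2) ∂(gaussianReal u 1) :=
    hF.lintegral_prod_right'
  rw [hP _ hF1, hP _ hF2]
  simp only [hcins]
  have hG : ∀ r, Measurable fun z : ℝ × ℝ => ENNReal.ofReal
      ((z.1 + s (ins z.2 r) z.1 - u) ^ 2) := fun r => by
    have h1 : Measurable fun z : ℝ × ℝ => ins z.2 r :=
      hins.comp (measurable_snd.prodMk measurable_const)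
    have h : Measurable fun z : ℝ × ℝ => s (ins z.2 r) z.1 := hs.comp (h1.prodMk measurable_fst)
    exact (((measurable_fst.add h).sub_const u).pow_const 2).ennreal_ofReal
  have hG2 : Measurable fun r => ∫⁻ y, ∫⁻ z, ENNReal.ofReal
      ((z + s (ins y r) z - u) ^ 2) ∂(gaussianReal u 1) ∂(gaussianReal u 1) := by
    have h1 : Measurable fun w : R × ℝ => ins w.2 w.1 := hins.comp measurable_swap
    have h2 : Measurable fun w : R × ℝ => ∫⁻ z, ENNReal.ofReal
      ((z + s (ins w.2 w.1) z - u) ^ 2) ∂(gaussianReal u 1) := hF2.comp h1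
    exact h2.lintegral_prod_right'
  rw [← lintegral_const_mul _ hG2]
  have hone : (∫⁻ _r, ENNReal.ofReal (18 * δ) ∂ν)
      = ENNReal.ofReal (18 * δ) := by simp
  rw [← hone, ← lintegral_add_right _ measurable_const]
  refine lintegral_mono fun r => ?_
  calc _ ≤ ∫⁻ y, ∫⁻ z, (ENNReal.ofReal (1 + 9 * δ) * ENNReal.ofReal
        ((y + s (ins z r) y - u) ^ 2)
        + ENNReal.ofReal (9 * δ * (1 + (y - u) ^ 2))) ∂(gaussianReal u 1)
        ∂(gaussianReal u 1) := by
        refine lintegral_mono fun y => ?_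
        -- A dummy integration over the copy `z`, so that the perturbation bound can be applied
        -- under the double integral.
        have h1 : ∀ e : ℝ≥0∞, e = ∫⁻ _z, e ∂(gaussianReal u 1) := fun e => by simp
        rw [h1 (ENNReal.ofReal _)]
        refine lintegral_mono fun z => ?_
        rw [← ENNReal.ofReal_mul (by positivity), ← ENNReal.ofReal_add (by positivity) (by positivity)]
        refine ENNReal.ofReal_le_ofReal (sq_le_of_abs_sub_le hδ0 hδ ?_)
        have h2 := hpert y z r
        rw [sub_sub_sub_cancel_right, add_sub_add_left_eq_sub]
        refine h2.trans ?_
        rw [add_assoc]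
        gcongr
        generalize s (ins z r) y = s'
        calc |s'| = |(y + s' - u) - (y - u)| := by ring_nf
          _ ≤ _ := abs_sub _ _
    _ = ENNReal.ofReal (1 + 9 * δ) * (∫⁻ y, ∫⁻ z, ENNReal.ofReal
        ((y + s (ins z r) y - u) ^ 2) ∂(gaussianReal u 1)
        ∂(gaussianReal u 1)) + ENNReal.ofReal (18 * δ) := by
        have h3 : ∀ y, Measurable fun z => ENNReal.ofReal
          ((y + s (ins z r) y - u) ^ 2) := fun y => by
            have h1 : Measurable fun z => ins z r := hins.comp (measurable_id.prodMk measurable_const)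
            have h : Measurable fun z => s (ins z r) y := hs.comp (h1.prodMk measurable_const)
            exact (((h.const_add y).sub_const u).pow_const 2).ennreal_ofReal
        simp_rw [fun y => lintegral_add_right (μ := gaussianReal u 1) (fun z =>
          ENNReal.ofReal (1 + 9 * δ) * ENNReal.ofReal
          ((y + s (ins z r) y - u) ^ 2))
          (g := fun _ => ENNReal.ofReal (9 * δ * (1 + (y - u) ^ 2))) measurable_const,
          fun y => lintegral_const_mul (μ := gaussianReal u 1) (ENNReal.ofReal (1 + 9 * δ)) (h3 y)]
        rw [lintegral_add_right _ (by fun_prop), lintegral_const_mul _ (hG r).lintegral_prod_right']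
        congr 1
        simp only [lintegral_const, measure_univ, mul_one]
        rw [lintegral_one_add_sq_gaussianReal _ (by positivity)]
        congr 1; ring
    _ = _ := by
        rw [lintegral_lintegral_swap (hG r).aemeasurable]

lemma selfRisk_score_le {n : ℕ} {a ρ : ℝ} (ha : 1 ≤ a) (hρ : 0 < ρ)
    (hδ : a ^ 2 / (n * ρ) ≤ 1) (θ : Fin n → ℝ) (k : Fin n) :
    selfRisk (score a ρ) θ k ≤ ENNReal.ofReal (1 + 9 * (a ^ 2 / (n * ρ))) *
      (∫⁻ x, ∫⁻ y, ENNReal.ofReal ((y + score a ρ x y - θ k) ^ 2) ∂(gaussianReal (θ k) 1)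
        ∂(obsLaw θ)) + ENNReal.ofReal (18 * (a ^ 2 / (n * ρ))) := by
  obtain ⟨m, rfl⟩ : ∃ m, n = m + 1 := ⟨n - 1, by have := k.pos; omega⟩
  refine lintegral_self_le (ins := fun y r => k.insertNth (α := fun _ => ℝ) y r)
    (measurable_insertNth k) (fun F hF => lintegral_obsLaw_insertNth θ k hF)
    (measurable_pi_apply k) (fun y r => by simp) (by positivity) hδ
    (continuous_score a hρ).measurable fun y z r => ?_
  refine abs_score_sub_score_le ha hρ k (fun j hj => ?_) y
  obtain ⟨i, rfl⟩ := Fin.exists_succAbove_eq hj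
  simp

lemma sepRisk_id {n : ℕ} (hn : 0 < n) (θ : Fin n → ℝ) : sepRisk θ (fun y => y) = 1 := by
  have h : ∀ k, ∫⁻ y, ENNReal.ofReal ((y - θ k) ^ 2) ∂(gaussianReal (θ k) 1) = 1 := fun k => by
    have h := gaussianReal_map_const_add (μ := 0) (v := 1) (θ k)
    rw [zero_add] at h
    rw [← h, lintegral_map (by fun_prop) (by fun_prop)]
    simp only [add_sub_cancel_left, lintegral_sq_gaussianReal]
  simp only [sepRisk, h]
  simp only [Finset.sum_const, Finset.card_univ, Fintype.card_fin, nsmul_eq_mul, mul_one]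
  exact ENNReal.inv_mul_cancel (by exact_mod_cast hn.ne') (by simp)

/-- The regret of the general empirical Bayes rule against any separable rule. -/
lemma avg_selfRisk_score_le {n : ℕ} (hn : 0 < n) {a ρ Q B : ℝ} (ha : 2 ≤ a) (han : a ^ 2 ≤ n)
    (hae : Real.exp (-a ^ 2 / 2) = 1 / n) (hρ : 1 / n ≤ ρ) (hQ : a ^ 2 / (n * ρ ^ 2) ≤ Q)
    (hexp : a ^ 3 * Real.exp a / (n * ρ) ≤ 1) (hδ : a ^ 2 / (n * ρ) ≤ 1) (hB0 : 0 ≤ B)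
    (θ : Fin n → ℝ)
    (hB : ∫⁻ y, ENNReal.ofReal (regretBound (2 * ((80 + 3840 * Q) * (9 + Q))) a ρ θ y)
      ≤ ENNReal.ofReal B) {t : ℝ → ℝ} (ht : Measurable t) :
    (n : ℝ≥0∞)⁻¹ * ∑ k, selfRisk (score a ρ) θ k
      ≤ sepRisk θ t + ENNReal.ofReal (10 * B + 27 * (a ^ 2 / (n * ρ))) := by
  have hn' : (0:ℝ) < n := by exact_mod_cast hn
  have hρ0 : 0 < ρ := lt_of_lt_of_le (by positivity) hρ
  set δ := a ^ 2 / (n * ρ) with hδd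
  have hδ0 : 0 ≤ δ := by positivity
  have hs : Measurable fun z : (Fin n → ℝ) × ℝ => score a ρ z.1 z.2 :=
    (continuous_score a hρ0).measurable
  have hF : ∀ k, Measurable fun z : (Fin n → ℝ) × ℝ =>
      ENNReal.ofReal ((z.2 + score a ρ z.1 z.2 - θ k) ^ 2) := fun k =>
    (((measurable_snd.add hs).sub_const _).pow_const 2).ennreal_ofReal
  have h1 : ∀ u : ℝ → ℝ, Measurable u → (n : ℝ≥0∞)⁻¹ * ∑ k, selfRisk (score a ρ) θ k
      ≤ ENNReal.ofReal (1 + 9 * δ) * (ENNReal.ofReal B + sepRisk θ u) + ENNReal.ofReal (18 * δ) := by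
    intro u hu
    calc (n : ℝ≥0∞)⁻¹ * ∑ k, selfRisk (score a ρ) θ k
        ≤ (n : ℝ≥0∞)⁻¹ * ∑ k, (ENNReal.ofReal (1 + 9 * δ) *
          (∫⁻ x, ∫⁻ y, ENNReal.ofReal ((y + score a ρ x y - θ k) ^ 2) ∂(gaussianReal (θ k) 1)
          ∂(obsLaw θ)) + ENNReal.ofReal (18 * δ)) := by
          gcongr with k
          exact selfRisk_score_le (by linarith) hρ0 hδ θ k
      _ = ENNReal.ofReal (1 + 9 * δ) * (∫⁻ x, sepRisk θ (fun y => y + score a ρ x y) ∂(obsLaw θ))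
          + ENNReal.ofReal (18 * δ) := by
          simp only [sepRisk]
          rw [lintegral_const_mul _ (Finset.measurable_sum _ fun k _ =>
            (hF k).lintegral_prod_right'), lintegral_finsetSum _ fun k _ =>
            (hF k).lintegral_prod_right', Finset.sum_add_distrib, mul_add, ← Finset.mul_sum,
            mul_left_comm]
          congr 1
          simp only [Finset.sum_const, Finset.card_univ, Fintype.card_fin, nsmul_eq_mul]
          rw [← mul_assoc, ENNReal.inv_mul_cancel (by exact_mod_cast hn.ne') (by simp), one_mul]
      _ ≤ _ := by
          gcongr
          refine (lintegral_sepRisk_le hn θ (s := score a ρ) hs hu).trans (add_le_add_left (le_trans ?_ hB) _)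
          exact lintegral_mono fun y => lintegral_score_regret_le hn ha han hae hρ hQ hexp θ y
  -- If the comparison risk is at most `1`, the multiplicative error `9δ` costs at most `9δ`, which
  -- with `18δ` gives the `27`. A rule of larger risk is replaced by the identity, whose risk is
  -- `1`.
  have h2 : ∀ u : ℝ → ℝ, Measurable u → sepRisk θ u ≤ 1 →
      (n : ℝ≥0∞)⁻¹ * ∑ k, selfRisk (score a ρ) θ k
      ≤ sepRisk θ u + ENNReal.ofReal (10 * B + 27 * δ) := by
    intro u hu hu1
    refine (h1 u hu).trans ?_
    have hfin : sepRisk θ u ≠ ∞ := (hu1.trans_lt ENNReal.one_lt_top).ne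
    rw [← ENNReal.ofReal_toReal hfin, ← ENNReal.ofReal_add hB0 ENNReal.toReal_nonneg,
      ← ENNReal.ofReal_mul (by positivity), ← ENNReal.ofReal_add (by positivity) (by positivity),
      ← ENNReal.ofReal_add (by positivity) (by positivity)]
    refine ENNReal.ofReal_le_ofReal ?_
    have h3 : (sepRisk θ u).toReal ≤ 1 := ENNReal.toReal_le_of_le_ofReal zero_le_one (by simpa)
    have h4 : (0:ℝ) ≤ (sepRisk θ u).toReal := ENNReal.toReal_nonneg
    nlinarith [mul_le_mul_of_nonneg_left h3 hδ0, mul_le_mul_of_nonneg_right hδ hB0]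
  rcases le_total (sepRisk θ t) 1 with h | h
  · exact h2 t ht h
  · refine (h2 (fun y => y) measurable_id (sepRisk_id hn θ).le).trans ?_
    rw [sepRisk_id hn]
    gcongr

/-! ### Soft thresholding -/

/-- Soft thresholding subtracts the projection onto `[-l, l]`; continuity, the shift bound and the
Lipschitz property are read off from this form. -/
lemma softThreshold_eq {l : ℝ} (hl : 0 ≤ l) (y : ℝ) :
    softThreshold l y = y - max (-l) (min l y) := by
  unfold softThreshold
  rcases lt_trichotomy y 0 with h | h | h
  · rw [Real.sign_of_neg h, abs_of_neg h, min_eq_right (by linarith)]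
    rcases le_total (-l) y with h' | h'
    · rw [max_eq_right h', max_eq_right (by linarith)]; ring
    · rw [max_eq_left h', max_eq_left (by linarith)]; ring
  · subst h; simp [hl]
  · rw [Real.sign_of_pos h, abs_of_pos h]
    rcases le_total l y with h' | h'
    · rw [min_eq_left h', max_eq_left (by linarith), max_eq_right (by linarith)]; ring
    · rw [min_eq_right h', max_eq_right (by linarith), max_eq_right (by linarith)]; ring

lemma continuous_softThreshold {l : ℝ} (hl : 0 ≤ l) : Continuous (softThreshold l) := by
  rw [show softThreshold l = fun y => y - max (-l) (min l y) from funext (softThreshold_eq hl)]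
  fun_prop

lemma abs_softThreshold_sub_le {l : ℝ} (hl : 0 ≤ l) (y : ℝ) : |softThreshold l y - y| ≤ l := by
  rw [softThreshold_eq hl, sub_sub_cancel_left, abs_neg, abs_le]
  exact ⟨le_max_left _ _, max_le (by linarith) (min_le_left _ _)⟩

lemma sq_softThreshold_sub_le {l : ℝ} (hl : 0 ≤ l) (u y : ℝ) :
    (softThreshold l y - u) ^ 2 ≤ 2 * l ^ 2 + 2 * (y - u) ^ 2 := by
  have h := sq_le_sq' (neg_le_of_abs_le (abs_softThreshold_sub_le hl y))
    (le_of_abs_le (abs_softThreshold_sub_le hl y))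
  nlinarith [sq_nonneg (softThreshold l y - y - (y - u))]

/-- Thresholding is `1`-Lipschitz, so removing the mean costs `|u|`, and the bias costs another
`|u|`; pure noise leaves `(|z| - l)⁺`. -/
lemma abs_softThreshold_add_sub_le {l : ℝ} (hl : 0 ≤ l) (u z : ℝ) :
    |softThreshold l (u + z) - u| ≤ (Set.Ioi l).indicator (fun v => v - l) |z| + 2 * |u| := by
  have h1 : |softThreshold l z| = (Set.Ioi l).indicator (fun v => v - l) |z| := by
    rw [softThreshold_eq hl, Set.indicator_apply]
    simp only [Set.mem_Ioi]
    split_ifs with h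
    · rcases lt_abs.1 h with h | h
      · rw [min_eq_left h.le, max_eq_right (by linarith), abs_of_pos (by linarith : 0 < z),
          abs_of_pos (by linarith)]
      · rw [min_eq_right (by linarith), max_eq_left (by linarith), abs_of_neg (by linarith : z < 0),
          abs_of_neg (by linarith)]; ring
    · obtain ⟨h2, h3⟩ := abs_le.1 (not_lt.1 h)
      rw [min_eq_right h3, max_eq_right h2]; simp
  have h2 : |softThreshold l (u + z) - softThreshold l z| ≤ |u| := by
    rw [softThreshold_eq hl, softThreshold_eq hl]
    rcases abs_cases u with ⟨h, _⟩ | ⟨h, _⟩ <;> rw [h, abs_le] <;>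
    rcases max_cases (-l) (min l (u + z)) with ⟨h3, _⟩ | ⟨h3, _⟩ <;>
    rcases max_cases (-l) (min l z) with ⟨h4, _⟩ | ⟨h4, _⟩ <;> rw [h3, h4] <;>
    rcases min_cases l (u + z) with ⟨h5, _⟩ | ⟨h5, _⟩ <;>
    rcases min_cases l z with ⟨h6, _⟩ | ⟨h6, _⟩ <;> constructor <;> linarith
  rw [← h1]
  calc |softThreshold l (u + z) - u|
      = |softThreshold l z + (softThreshold l (u + z) - softThreshold l z) - u| := by ring_nf
    _ ≤ |softThreshold l z| + |softThreshold l (u + z) - softThreshold l z| + |u| :=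
        (abs_sub _ _).trans (by gcongr; exact abs_add_le _ _)
    _ ≤ _ := by linarith

/-- The square is split unevenly, `(m + 2|u|)² ≤ (3/2) m² + 12 u²`, to keep the noise coefficient
small: with `l = √(2 log n)` the constant `6` leads to `3/(2√π) < 1`, as the additive term of the
theorem requires. An even split would exceed it. -/
lemma lintegral_softThreshold_le {l : ℝ} (hl : 1 ≤ l) (u : ℝ) :
    ∫⁻ y, ENNReal.ofReal ((softThreshold l y - u) ^ 2) ∂(gaussianReal u 1)
      ≤ ENNReal.ofReal (12 * min (u ^ 2) (l ^ 2) + 6 * phi l / l ^ 3) := by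
  have hl0 : 0 < l := by linarith
  have hp := phi_pos l
  have hc := (continuous_softThreshold hl0.le).measurable
  have h := gaussianReal_map_const_add (μ := 0) (v := 1) u
  rw [zero_add] at h
  rcases le_or_gt (u ^ 2) (l ^ 2) with hu | hu
  · rw [min_eq_left hu, ← h, lintegral_map (by fun_prop) (by fun_prop)]
    have hm : Measurable fun z : ℝ => ENNReal.ofReal
        ((Set.Ioi l).indicator (fun v => 0 + 3 / 2 * (v - l) ^ 2) |z|) := by
      have : Measurable (fun v => (Set.Ioi l).indicator (fun v => 0 + 3 / 2 * (v - l) ^ 2) v) :=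
        (by fun_prop : Measurable fun v => 0 + 3 / 2 * (v - l) ^ 2).indicator measurableSet_Ioi
      exact (this.comp measurable_abs).ennreal_ofReal
    calc _ ≤ ∫⁻ z, (ENNReal.ofReal ((Set.Ioi l).indicator (fun v => 0 + 3 / 2 * (v - l) ^ 2) |z|)
          + ENNReal.ofReal (12 * u ^ 2)) ∂(gaussianReal 0 1) := by
          refine lintegral_mono fun z => ?_
          have hi : 0 ≤ (Set.Ioi l).indicator (fun v => v - l) |z| := by
            refine Set.indicator_apply_nonneg fun h => ?_
            simp only [Set.mem_Ioi] at h; linarith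
          have hi2 : (Set.Ioi l).indicator (fun v => 0 + 3 / 2 * (v - l) ^ 2) |z|
              = 3 / 2 * ((Set.Ioi l).indicator (fun v => v - l) |z|) ^ 2 := by
            simp only [Set.indicator_apply]; split_ifs <;> ring
          rw [hi2, ← ENNReal.ofReal_add (by positivity) (by positivity)]
          refine ENNReal.ofReal_le_ofReal ?_
          rw [← sq_abs]
          refine (pow_le_pow_left₀ (abs_nonneg _) (abs_softThreshold_add_sub_le hl0.le u z) 2).trans ?_
          generalize (Set.Ioi l).indicator (fun v => v - l) |z| = m
          nlinarith [sq_nonneg (m - 4 * |u|), sq_abs u]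
      _ ≤ ENNReal.ofReal (2 * phi l * (0 / l + 2 * (3 / 2) / l ^ 3)) + ENNReal.ofReal (12 * u ^ 2) := by
          rw [lintegral_add_left hm]
          gcongr
          · exact lintegral_tail_le hl0 le_rfl (by norm_num)
          · simp
      _ = _ := by
          rw [← ENNReal.ofReal_add (by positivity) (by positivity)]; congr 1; ring
  · rw [min_eq_right hu.le, ← h, lintegral_map (by fun_prop) (by fun_prop)]
    calc _ ≤ ∫⁻ z, ENNReal.ofReal (2 * l ^ 2 + 2 * z ^ 2) ∂(gaussianReal 0 1) := by
          refine lintegral_mono fun z => ENNReal.ofReal_le_ofReal ?_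
          simpa using sq_softThreshold_sub_le hl0.le u (u + z)
      _ = ENNReal.ofReal (2 * l ^ 2 + 2) := lintegral_quadratic_gaussianReal (by positivity)
      _ ≤ _ := by
          refine ENNReal.ofReal_le_ofReal ?_
          have : 0 ≤ 6 * phi l / l ^ 3 := by positivity
          nlinarith

/-- The risk of soft thresholding. -/
lemma sepRisk_softThreshold_le {n : ℕ} (hn : 0 < n) (θ : Fin n → ℝ) {l : ℝ} (hl : 1 ≤ l) :
    sepRisk θ (softThreshold l) ≤ ENNReal.ofReal (12 * truncSq θ (l ^ 2) + 6 * phi l / l ^ 3) := by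
  have hp := phi_pos l
  rw [truncSq, ← avg_affine hn, ofReal_avg hn fun k => by positivity, sepRisk]
  gcongr with k
  exact lintegral_softThreshold_le hl (θ k)

/-! ### The pretest statistic -/

/-- The expectation of `kappaHat`. -/
def kappa {n : ℕ} (θ : Fin n → ℝ) : ℝ := 1 - (1 / n) * ∑ k, Real.exp (-(θ k) ^ 2 / 4)

lemma integral_exp_gaussianReal (u : ℝ) :
    ∫ x, √2 * Real.exp (-x ^ 2 / 2) ∂(gaussianReal u 1) = Real.exp (-u ^ 2 / 4) := by
  rw [integral_gaussianReal_one]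
  have h : ∀ x, phi (x - u) * (√2 * Real.exp (-x ^ 2 / 2))
      = √2 / √(2 * Real.pi) * Real.exp (-u ^ 2 / 4) * Real.exp (-1 * (x - u / 2) ^ 2) := fun x => by
    rw [phi, mul_assoc _ (Real.exp (-u ^ 2 / 4)), ← Real.exp_add,
      show -u ^ 2 / 4 + -1 * (x - u / 2) ^ 2 = -(x - u) ^ 2 / 2 + -x ^ 2 / 2 by ring, Real.exp_add]
    ring
  simp_rw [h, integral_const_mul]
  rw [integral_sub_right_eq_self (fun x => Real.exp (-1 * x ^ 2)), integral_gaussian, div_one,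
    Real.sqrt_mul (by norm_num)]
  have := Real.pi_pos
  field_simp

lemma kappa_le_truncSq {n : ℕ} (hn : 0 < n) (θ : Fin n → ℝ) : kappa θ ≤ truncSq θ 1 := by
  have h : kappa θ = (1 / (n:ℝ)) * ∑ k, (1 - Real.exp (-(θ k) ^ 2 / 4)) := by
    rw [Finset.sum_sub_distrib, mul_sub, avg_const hn, kappa]
  rw [h]
  refine avg_le_avg fun k => le_min ?_ ?_
  · nlinarith [Real.add_one_le_exp (-(θ k) ^ 2 / 4), sq_nonneg (θ k)]
  · linarith [Real.exp_pos (-(θ k) ^ 2 / 4)]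

/-- With `v = θ²/4`, the bound `exp(-v) ≤ 1/(1 + v)` reduces the claim to `min(4v, 1) ≤ 5v/(1 + v)`.
-/
lemma truncSq_le_kappa {n : ℕ} (hn : 0 < n) (θ : Fin n → ℝ) : truncSq θ 1 ≤ 5 * kappa θ := by
  have h : 5 * kappa θ = (1 / (n:ℝ)) * ∑ k, (5 * (1 - Real.exp (-(θ k) ^ 2 / 4))) := by
    rw [← Finset.mul_sum, Finset.sum_sub_distrib, mul_left_comm, mul_sub, avg_const hn, kappa]
  rw [h]
  refine avg_le_avg fun k => ?_
  set v := (θ k) ^ 2 / 4 with hv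
  have hv0 : 0 ≤ v := by positivity
  have h1 : Real.exp (-(θ k) ^ 2 / 4) ≤ (1 + v)⁻¹ := by
    rw [neg_div, ← hv, Real.exp_neg]
    gcongr; linarith [Real.add_one_le_exp v]
  have h2 : θ k ^ 2 = 4 * v := by rw [hv]; ring
  have h3 : 5 * (1 - (1 + v)⁻¹) = 5 * v / (1 + v) := by field_simp; ring
  have h4 : min (4 * v) 1 ≤ 5 * v / (1 + v) := by
    rw [le_div_iff₀ (by positivity)]
    rcases le_total (4 * v) 1 with h | h
    · rw [min_eq_left h]; nlinarith
    · rw [min_eq_right h]; linarith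
  rw [h2] at h1 ⊢
  linarith

lemma continuous_kappaHat {n : ℕ} : Continuous (kappaHat (n := n)) := by
  unfold kappaHat; fun_prop

/-- Hoeffding's inequality: the summands lie in `[0, √2]`, so the sub-Gaussian parameter of each is
`(√2/2)² = 1/2`. -/
lemma obsLaw_kappaHat_le {n : ℕ} (hn : 0 < n) (θ : Fin n → ℝ) {s : ℝ} (hs : 0 ≤ s) :
    obsLaw θ {x | kappa θ + s ≤ kappaHat x} ≤ ENNReal.ofReal (Real.exp (-(n * s ^ 2))) ∧
    obsLaw θ {x | kappaHat x ≤ kappa θ - s} ≤ ENNReal.ofReal (Real.exp (-(n * s ^ 2))) := by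
  have hn' : (0:ℝ) < n := by exact_mod_cast hn
  set F : ℝ → ℝ := fun y => √2 * Real.exp (-y ^ 2 / 2) with hF
  have hFm : Measurable F := by fun_prop
  have hsub : ∀ k, HasSubgaussianMGF (fun x : Fin n → ℝ => F (x k) - Real.exp (-(θ k) ^ 2 / 4))
      (1 / 2) (obsLaw θ) := fun k => by
    have h := hasSubgaussianMGF_of_mem_Icc (μ := obsLaw θ) (a := 0) (b := √2)
      (X := fun x => F (x k)) (hFm.comp (measurable_pi_apply k)).aemeasurable
      (ae_of_all _ fun x => ⟨by positivity, mul_le_of_le_one_right (by positivity)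
        (Real.exp_le_one_iff.2 (by nlinarith [sq_nonneg (x k)]))⟩)
    rw [integral_eval_obsLaw θ k hFm, hF, integral_exp_gaussianReal] at h
    convert h using 1
    ext
    push_cast
    rw [sub_zero, Real.norm_of_nonneg (by positivity), div_pow, Real.sq_sqrt (by norm_num)]
    norm_num
  have hexp : -(n * s) ^ 2 / (2 * ((∑ _k : Fin n, (1 / 2 : NNReal) : NNReal) : ℝ)) = -(n * s ^ 2) := by
    simp; field_simp
  have hk : ∀ x : Fin n → ℝ, ∑ k, (F (x k) - Real.exp (-(θ k) ^ 2 / 4))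
      = n * (kappa θ - kappaHat x) := fun x => by
    rw [kappa, kappaHat, Finset.sum_sub_distrib, mul_sub, mul_sub, mul_sub, ← mul_assoc, ← mul_assoc,
      mul_one_div_cancel hn'.ne', one_mul, one_mul]
    ring
  constructor
  · have hind := iIndepFun_obsLaw θ (F := fun k y => -(F y - Real.exp (-(θ k) ^ 2 / 4)))
      (fun k => (hFm.sub_const _).neg)
    have h := HasSubgaussianMGF.measure_sum_ge_le_of_iIndepFun hind (s := Finset.univ)
      (c := fun _ => 1 / 2) (fun k _ => (hsub k).neg) (ε := n * s) (by positivity)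
    rw [hexp] at h
    refine ENNReal.le_ofReal_iff_toReal_le (measure_ne_top _ _) (Real.exp_pos _).le |>.2
      (le_trans (measureReal_mono ?_) h)
    intro x hx
    simp only [Set.mem_ofPred_eq, Finset.sum_neg_distrib, hk] at hx ⊢
    nlinarith
  · have hind := iIndepFun_obsLaw θ (F := fun k y => F y - Real.exp (-(θ k) ^ 2 / 4))
      (fun k => hFm.sub_const _)
    have h := HasSubgaussianMGF.measure_sum_ge_le_of_iIndepFun hind (s := Finset.univ)
      (c := fun _ => 1 / 2) (fun k _ => hsub k) (ε := n * s) (by positivity)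
    rw [hexp] at h
    refine ENNReal.le_ofReal_iff_toReal_le (measure_ne_top _ _) (Real.exp_pos _).le |>.2
      (le_trans (measureReal_mono ?_) h)
    intro x hx
    simp only [Set.mem_ofPred_eq, hk] at hx ⊢
    nlinarith

/-! ### Losses on rare events -/

/-- The unbounded part of the loss is the squared noise, and `z² ≤ s + z⁴/s` trades it for a
constant times the probability and a fourth moment; `s` is free for balancing. -/
lemma setLIntegral_loss_le {n : ℕ} (θ : Fin n → ℝ) (k : Fin n) {A : Set (Fin n → ℝ)} {p D s : ℝ}
    (hs : 0 < s) (hp : 0 ≤ p) (hA : obsLaw θ A ≤ ENNReal.ofReal p)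
    {r : (Fin n → ℝ) → ℝ} (hr : ∀ x, |r x - x k| ≤ D) :
    ∫⁻ x in A, ENNReal.ofReal ((r x - θ k) ^ 2) ∂(obsLaw θ)
      ≤ ENNReal.ofReal (2 * (D ^ 2 + s) * p + 192 / s) := by
  have hm : Measurable fun y => ENNReal.ofReal (2 / s) * ENNReal.ofReal ((y - θ k) ^ 4) := by
    fun_prop
  have h4 : ∫⁻ x, ENNReal.ofReal (2 / s) * ENNReal.ofReal ((x k - θ k) ^ 4) ∂(obsLaw θ)
      ≤ ENNReal.ofReal (192 / s) := by
    rw [lintegral_eval_obsLaw θ k hm, lintegral_const_mul _ (by fun_prop)]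
    have h := gaussianReal_map_const_add (μ := 0) (v := 1) (θ k)
    rw [zero_add] at h
    rw [← h, lintegral_map (by fun_prop) (by fun_prop)]
    simp only [add_sub_cancel_left]
    refine (mul_le_mul_right lintegral_pow_four_gaussianReal _).trans ?_
    rw [show (96 : ℝ≥0∞) = ENNReal.ofReal 96 by simp, ← ENNReal.ofReal_mul (by positivity)]
    exact ENNReal.ofReal_le_ofReal (by ring_nf; rfl)
  calc _ ≤ ∫⁻ x in A, (ENNReal.ofReal (2 * (D ^ 2 + s))
        + ENNReal.ofReal (2 / s) * ENNReal.ofReal ((x k - θ k) ^ 4)) ∂(obsLaw θ) := by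
        refine lintegral_mono fun x => ?_
        rw [← ENNReal.ofReal_mul (by positivity), ← ENNReal.ofReal_add (by positivity) (by positivity)]
        refine ENNReal.ofReal_le_ofReal ?_
        have h1 : (r x - x k) ^ 2 ≤ D ^ 2 :=
          sq_le_sq' (neg_le_of_abs_le (hr x)) (le_of_abs_le (hr x))
        set z := x k - θ k
        have h2 : z ^ 2 ≤ s + 1 / s * z ^ 4 := by
          rw [← sub_nonneg]
          have : s + 1 / s * z ^ 4 - z ^ 2 = 1 / s * ((s - z ^ 2 / 2) ^ 2 + 3 / 4 * z ^ 4) := by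
            field_simp; ring
          rw [this]; positivity
        have h3 : (r x - θ k) ^ 2 ≤ 2 * (r x - x k) ^ 2 + 2 * z ^ 2 := by
          have : r x - θ k = (r x - x k) + z := by simp [z]
          rw [this]; nlinarith [sq_nonneg (r x - x k - z)]
        have h5 : 2 / s * z ^ 4 = 2 * (1 / s * z ^ 4) := by ring
        linarith
    _ ≤ ENNReal.ofReal (2 * (D ^ 2 + s)) * ENNReal.ofReal p + ENNReal.ofReal (192 / s) := by
        rw [lintegral_add_left measurable_const, setLIntegral_const]
        gcongr
        exact (setLIntegral_le_lintegral _ _).trans h4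
    _ = _ := by
        rw [← ENNReal.ofReal_mul (by positivity), ← ENNReal.ofReal_add (by positivity) (by positivity)]

/-! ### The risk of the hybrid rule for deterministic means -/

/-- The risk of the hybrid rule for the `k`-th mean. -/
def hybridRisk {n : ℕ} (ρ l b : ℝ) (θ : Fin n → ℝ) (k : Fin n) : ℝ≥0∞ :=
  ∫⁻ x, ENNReal.ofReal ((hybridRule ρ l b x (x k) - θ k) ^ 2) ∂(obsLaw θ)

lemma measurableSet_pretest {n : ℕ} (b : ℝ) : MeasurableSet {x : Fin n → ℝ | b < kappaHat x} :=
  measurableSet_lt measurable_const continuous_kappaHat.measurable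

lemma hybridRisk_eq {n : ℕ} (ρ l b : ℝ) (θ : Fin n → ℝ) (k : Fin n) :
    hybridRisk ρ l b θ k
      = (∫⁻ x in {x | b < kappaHat x}, ENNReal.ofReal
          ((x k + score √(2 * Real.log n) ρ x (x k) - θ k) ^ 2) ∂(obsLaw θ))
        + ∫⁻ x in {x | b < kappaHat x}ᶜ, ENNReal.ofReal
          ((softThreshold l (x k) - θ k) ^ 2) ∂(obsLaw θ) := by
  rw [hybridRisk, ← lintegral_add_compl _ (measurableSet_pretest b)]
  congr 1
  · refine setLIntegral_congr_fun (measurableSet_pretest b) fun x hx => ?_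
    simp only [Set.mem_ofPred_eq] at hx
    simp only [hybridRule, if_pos hx, gebRule_eq, score]
  · refine setLIntegral_congr_fun (measurableSet_pretest b).compl fun x hx => ?_
    simp only [Set.mem_compl_iff, Set.mem_ofPred_eq] at hx
    simp only [hybridRule, if_neg hx]

lemma inv_mul_sum_le {n : ℕ} (hn : 0 < n) {f : Fin n → ℝ≥0∞} {c : ℝ≥0∞} (h : ∀ k, f k ≤ c) :
    (n : ℝ≥0∞)⁻¹ * ∑ k, f k ≤ c := by
  calc _ ≤ (n : ℝ≥0∞)⁻¹ * ∑ _k : Fin n, c := by gcongr with k; exact h k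
    _ = c := by
      simp only [Finset.sum_const, Finset.card_univ, Fintype.card_fin, nsmul_eq_mul]
      rw [← mul_assoc, ENNReal.inv_mul_cancel (by exact_mod_cast hn.ne') (by simp), one_mul]

lemma inv_mul_sum_lintegral_softThreshold {n : ℕ} (θ : Fin n → ℝ) {l : ℝ} (hl : 0 ≤ l) :
    (n : ℝ≥0∞)⁻¹ * ∑ k, ∫⁻ x, ENNReal.ofReal ((softThreshold l (x k) - θ k) ^ 2) ∂(obsLaw θ)
      = sepRisk θ (softThreshold l) := by
  have := (continuous_softThreshold hl).measurable
  simp only [sepRisk]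
  congr 1
  exact Finset.sum_congr rfl fun k _ => lintegral_eval_obsLaw θ k
    (F := fun y => ENNReal.ofReal ((softThreshold l y - θ k) ^ 2)) (by fun_prop)

section Averages

variable {n : ℕ} {ρ b : ℝ} {θ : Fin n → ℝ}

/-- Taking `D = n`, `s = n²` and probability `n⁻⁴` makes both parts of the rare-event bound of order
`n⁻²`: `4 + 192 = 196`. -/
lemma avg_hybridRisk_le_of_pretest_rare (hn : 0 < n) (hρ : 0 < ρ)
    (hD : (2 * Real.log n) / ρ ≤ n)
    (hA : obsLaw θ {x | b < kappaHat x} ≤ ENNReal.ofReal (1 / n ^ 4)) :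
    (n : ℝ≥0∞)⁻¹ * ∑ k, hybridRisk ρ √(2 * Real.log n) b θ k
      ≤ ENNReal.ofReal (196 / n ^ 2) + sepRisk θ (softThreshold √(2 * Real.log n)) := by
  have hn' : (0:ℝ) < n := by exact_mod_cast hn
  have hL : 0 ≤ 2 * Real.log n := mul_nonneg zero_le_two (Real.log_natCast_nonneg n)
  simp only [hybridRisk_eq, Finset.sum_add_distrib, mul_add]
  gcongr
  · refine inv_mul_sum_le hn fun k => ?_
    refine (setLIntegral_loss_le θ k (s := n ^ 2) (D := n) (by positivity) (by positivity) hA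
      fun x => ?_).trans ?_
    · rw [add_sub_cancel_left]
      refine (abs_score_le hn (Real.sqrt_nonneg _) hρ _ _).trans ?_
      rwa [Real.sq_sqrt hL]
    · refine ENNReal.ofReal_le_ofReal (le_of_eq ?_)
      field_simp; norm_num
  · rw [← inv_mul_sum_lintegral_softThreshold θ (Real.sqrt_nonneg _)]
    gcongr with k
    exact Measure.restrict_le_self

/-- For undecided pretests: whichever rule is chosen, its loss is at most the sum of both losses. -/
lemma avg_hybridRisk_le_add_soft :
    (n : ℝ≥0∞)⁻¹ * ∑ k, hybridRisk ρ √(2 * Real.log n) b θ k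
      ≤ (n : ℝ≥0∞)⁻¹ * ∑ k, selfRisk (score √(2 * Real.log n) ρ) θ k
        + sepRisk θ (softThreshold √(2 * Real.log n)) := by
  simp only [hybridRisk_eq, Finset.sum_add_distrib, mul_add]
  gcongr
  · exact setLIntegral_le_lintegral _ _
  · rw [← inv_mul_sum_lintegral_softThreshold θ (Real.sqrt_nonneg _)]
    gcongr with k
    exact Measure.restrict_le_self

lemma avg_hybridRisk_le_add_rare (hn : 0 < n) (hL : 2 * Real.log n ≤ n ^ 2)
    (hA : obsLaw θ {x | kappaHat x ≤ b} ≤ ENNReal.ofReal (1 / n ^ 4)) :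
    (n : ℝ≥0∞)⁻¹ * ∑ k, hybridRisk ρ √(2 * Real.log n) b θ k
      ≤ (n : ℝ≥0∞)⁻¹ * ∑ k, selfRisk (score √(2 * Real.log n) ρ) θ k
        + ENNReal.ofReal (196 / n ^ 2) := by
  have hn' : (0:ℝ) < n := by exact_mod_cast hn
  have hA' : {x : Fin n → ℝ | b < kappaHat x}ᶜ = {x | kappaHat x ≤ b} := by
    ext x; simp
  simp only [hybridRisk_eq, Finset.sum_add_distrib, mul_add]
  gcongr
  · exact setLIntegral_le_lintegral _ _
  · refine inv_mul_sum_le hn fun k => ?_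
    rw [hA']
    refine (setLIntegral_loss_le θ k (s := n ^ 2) (D := n) (by positivity) (by positivity) hA
      (r := fun x => softThreshold √(2 * Real.log n) (x k))
      fun x => ?_).trans ?_
    · exact (abs_softThreshold_sub_le (Real.sqrt_nonneg _) _).trans (Real.sqrt_le_iff.2 ⟨by positivity, hL⟩)
    · refine ENNReal.ofReal_le_ofReal (le_of_eq ?_)
      field_simp; norm_num

end Averages

/-! ### Comparison of truncated and tail averages of the means -/

lemma truncSq_mono {n : ℕ} (θ : Fin n → ℝ) {c d : ℝ} (h : c ≤ d) : truncSq θ c ≤ truncSq θ d :=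
  avg_le_avg fun _ => min_le_min_left _ h

lemma truncSq_mul_le {n : ℕ} (θ : Fin n → ℝ) {c d : ℝ} (hd : 1 ≤ d) :
    truncSq θ (d * c) ≤ d * truncSq θ c := by
  rw [truncSq, truncSq, mul_left_comm, Finset.mul_sum (s := Finset.univ) (a := d)]
  refine avg_le_avg fun k => ?_
  rw [mul_min_of_nonneg _ _ (by linarith)]
  exact min_le_min_right _ (le_mul_of_one_le_left (sq_nonneg _) hd)

lemma truncSq_nonneg {n : ℕ} (θ : Fin n → ℝ) {c : ℝ} (hc : 0 ≤ c) : 0 ≤ truncSq θ c :=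
  mul_nonneg (by positivity) (Finset.sum_nonneg fun _ _ => le_min (sq_nonneg _) hc)

lemma tailAvg_nonneg {n : ℕ} (θ : Fin n → ℝ) (x : ℝ) : 0 ≤ tailAvg θ x :=
  mul_nonneg (by positivity) (Finset.sum_nonneg fun _ _ =>
    Set.indicator_nonneg (fun _ _ => zero_le_one) _)

lemma tailAvg_le_one {n : ℕ} (hn : 0 < n) (θ : Fin n → ℝ) (x : ℝ) : tailAvg θ x ≤ 1 := by
  rw [← avg_const hn 1]
  exact avg_le_avg fun k => Set.indicator_apply_le' (fun _ => le_rfl) fun _ => zero_le_one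

lemma tailAvg_sqrt_le {n : ℕ} (θ : Fin n → ℝ) {c : ℝ} (hc : 1 ≤ c) :
    tailAvg θ √c ≤ truncSq θ c := by
  refine avg_le_avg fun k => Set.indicator_apply_le' (fun h => ?_) fun _ =>
    le_min (sq_nonneg _) (by linarith)
  simp only [Set.mem_Ioi] at h
  have h1 := pow_le_pow_left₀ (Real.sqrt_nonneg c) h.le 2
  rw [Real.sq_sqrt (by linarith), sq_abs] at h1
  exact le_min (by linarith) hc

/-! ### Large samples -/

/-- The sample size is large enough for the asymptotic estimates, and the regularization `ρ` is of
the order `√(log n / n)`. -/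
structure LargeSample (ρ₀ b₀ : ℝ) (n : ℕ) (ρ : ℝ) : Prop where
  lower : ρ₀ / 2 * √(2 * Real.log n) / √n ≤ ρ
  upper : ρ ≤ 3 * ρ₀ / 2 * √(2 * Real.log n) / √n
  log_ge : 2 ≤ Real.log n
  card_ge : 196 ≤ (n:ℝ)
  exp_le : 2 * Real.log n * Real.exp √(2 * Real.log n) ≤ ρ₀ / 2 * √n
  log_le : 2 * Real.log n ≤ n
  rho_le : 25 * (3 * ρ₀ / 2 * √(2 * Real.log n) / √n) ≤ Real.exp (-8)
  cube_le : 2 * Real.log n * (Real.log n ^ 2 / √n) ≤ 1 / 2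
  pretest : 16 ≤ b₀ ^ 2 * Real.log n
  slack : 15 / 17 / (n * Real.log n ^ (3 / 2 : ℝ)) + 196 / n ^ 2
    ≤ 1 / (n * (Real.log n + 1) ^ (3 / 2 : ℝ))

namespace LargeSample

variable {ρ₀ b₀ ρ : ℝ} {n : ℕ}

lemma n_pos (h : LargeSample ρ₀ b₀ n ρ) : 0 < n := by
  have := h.card_ge
  exact_mod_cast (by linarith : (0:ℝ) < n)

lemma sqrt_pos (h : LargeSample ρ₀ b₀ n ρ) : 0 < √(n:ℝ) := Real.sqrt_pos.2 (by linarith [h.card_ge])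

lemma sq_sqrt (_h : LargeSample ρ₀ b₀ n ρ) : √(n:ℝ) ^ 2 = n := Real.sq_sqrt (Nat.cast_nonneg n)

lemma sq_a (h : LargeSample ρ₀ b₀ n ρ) : √(2 * Real.log n) ^ 2 = 2 * Real.log n := Real.sq_sqrt (by linarith [h.log_ge])

lemma two_le_a (h : LargeSample ρ₀ b₀ n ρ) : 2 ≤ √(2 * Real.log n) := Real.le_sqrt_of_sq_le (by linarith [h.log_ge])

lemma exp_a (h : LargeSample ρ₀ b₀ n ρ) : Real.exp (-√(2 * Real.log n) ^ 2 / 2) = 1 / n := by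
  rw [h.sq_a, show -(2 * Real.log n) / 2 = -Real.log n by ring, Real.exp_neg,
    Real.exp_log (by linarith [h.card_ge]), one_div]

lemma rho_lower (h : LargeSample ρ₀ b₀ n ρ) : ρ₀ / 2 * √(2 * Real.log n) * √n ≤ n * ρ := by
  have h1 := h.lower
  have h2 := h.sqrt_pos
  rw [div_le_iff₀ h2] at h1
  calc _ ≤ ρ * √n * √n := by gcongr
    _ = _ := by rw [mul_assoc, ← sq, h.sq_sqrt]; ring

lemma exp_bound (h : LargeSample ρ₀ b₀ n ρ) : √(2 * Real.log n) ^ 3 * Real.exp √(2 * Real.log n) ≤ n * ρ := by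
  refine le_trans ?_ h.rho_lower
  have h1 := h.exp_le
  have h2 := h.two_le_a
  calc _ = √(2 * Real.log n) * (2 * Real.log n * Real.exp √(2 * Real.log n)) := by
        rw [← mul_assoc, ← h.sq_a, Real.sqrt_sq (by linarith), ← pow_succ']
    _ ≤ √(2 * Real.log n) * (ρ₀ / 2 * √n) := by gcongr
    _ = _ := by ring

lemma cube_a_le (h : LargeSample ρ₀ b₀ n ρ) : √(2 * Real.log n) ^ 3 ≤ n * ρ := by
  refine le_trans ?_ h.exp_bound
  have h2 := h.two_le_a
  exact le_mul_of_one_le_right (by positivity) (Real.one_le_exp (by linarith))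

lemma one_le_mul_rho (h : LargeSample ρ₀ b₀ n ρ) : 1 ≤ n * ρ :=
  (one_le_pow₀ (by linarith [h.two_le_a])).trans h.cube_a_le

lemma rho_ge (h : LargeSample ρ₀ b₀ n ρ) : 1 / n ≤ ρ := by
  have := h.card_ge
  rw [div_le_iff₀ (by linarith), mul_comm]
  exact h.one_le_mul_rho

lemma rho_pos (h : LargeSample ρ₀ b₀ n ρ) : 0 < ρ := lt_of_lt_of_le (by have := h.card_ge; positivity) h.rho_ge

lemma Q_le (h : LargeSample ρ₀ b₀ n ρ) (hρ₀ : 0 < ρ₀) : √(2 * Real.log n) ^ 2 / (n * ρ ^ 2) ≤ 4 / ρ₀ ^ 2 := by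
  have h1 := h.rho_lower
  have h2 := h.sqrt_pos
  have h3 := h.two_le_a
  have h4 := h.rho_pos
  have hn : (0:ℝ) < n := by linarith [h.card_ge]
  rw [div_le_div_iff₀ (by positivity) (by positivity)]
  have h5 : (ρ₀ / 2 * √(2 * Real.log n)) ^ 2 ≤ n * ρ ^ 2 := by
    have h6 := pow_le_pow_left₀ (by positivity) h1 2
    have h7 : (ρ₀ / 2 * √(2 * Real.log n) * √n) ^ 2 = (ρ₀ / 2 * √(2 * Real.log n)) ^ 2 * n := by
      rw [mul_pow _ √(n:ℝ), h.sq_sqrt]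
    rw [h7] at h6
    refine le_of_mul_le_mul_right (h6.trans (le_of_eq ?_)) hn
    ring
  linarith [h5]

lemma div_rho_le (h : LargeSample ρ₀ b₀ n ρ) : 2 * Real.log n / ρ ≤ n := by
  rw [div_le_iff₀ h.rho_pos, ← h.sq_a]
  refine le_trans ?_ h.cube_a_le
  exact pow_le_pow_right₀ (by linarith [h.two_le_a]) (by norm_num)

lemma delta_le (h : LargeSample ρ₀ b₀ n ρ) (hρ₀ : 0 < ρ₀) :
    √(2 * Real.log n) ^ 2 / (n * ρ) ≤ 4 / ρ₀ * (Real.log n / √n) := by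
  have h1 := h.rho_lower
  have h2 := h.sqrt_pos
  have h3 := h.two_le_a
  have hl := h.log_ge
  calc _ ≤ √(2 * Real.log n) ^ 2 / (ρ₀ / 2 * √(2 * Real.log n) * √n) := by gcongr
    _ = 2 / ρ₀ * (√(2 * Real.log n) / √n) := by field_simp
    _ ≤ 2 / ρ₀ * ((2 * Real.log n) / √n) := by gcongr; nlinarith [h.sq_a]
    _ = _ := by ring

lemma cube_div_le (h : LargeSample ρ₀ b₀ n ρ) (hρ₀ : 0 < ρ₀) :
    √(2 * Real.log n) ^ 3 / (n * ρ) ≤ 4 / ρ₀ * (Real.log n / √n) := by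
  have h1 := h.rho_lower
  have h2 := h.sqrt_pos
  have h3 := h.two_le_a
  calc _ ≤ √(2 * Real.log n) ^ 3 / (ρ₀ / 2 * √(2 * Real.log n) * √n) := by gcongr
    _ = 2 / ρ₀ * (√(2 * Real.log n) ^ 2 / √n) := by field_simp
    _ = _ := by rw [h.sq_a]; ring

lemma sqrt_mul_rpow (h : LargeSample ρ₀ b₀ n ρ) : √(Real.log n) * Real.log n ^ (3 / 2 : ℝ) = Real.log n ^ 2 := by
  rw [Real.sqrt_eq_rpow, ← Real.rpow_add (by linarith [h.log_ge])]
  norm_num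

lemma a_cube (h : LargeSample ρ₀ b₀ n ρ) : √(2 * Real.log n) ^ 3 = 2 * √2 * Real.log n ^ (3 / 2 : ℝ) := by
  have hl := h.log_ge
  have h1 : Real.log n ^ (3 / 2 : ℝ) = √(Real.log n) ^ 3 := by
    rw [Real.sqrt_eq_rpow, ← Real.rpow_natCast, ← Real.rpow_mul (by linarith)]; norm_num
  rw [h1, Real.sqrt_mul (by norm_num), mul_pow]
  congr 1
  rw [pow_succ, Real.sq_sqrt (by norm_num)]

lemma a_cube_le (h : LargeSample ρ₀ b₀ n ρ) : √(2 * Real.log n) ^ 3 ≤ 3 * Real.log n ^ (3 / 2 : ℝ) := by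
  have hl := h.log_ge
  rw [h.a_cube]
  have : √2 ≤ 3 / 2 := Real.sqrt_le_iff.2 ⟨by norm_num, by norm_num⟩
  have h1 : 0 < Real.log n ^ (3 / 2 : ℝ) := by positivity
  nlinarith

/-- Since `φ(a) = 1/(n√(2π))` and `a³ = 2√2 (log n)^{3/2}`, the exact constant is `3/(2√π)`; `√π ≥
17/10` turns it into `15/17`, and the gap to `1` pays for replacing `log n` by `log n + 1`. -/
lemma soft_remainder_le (h : LargeSample ρ₀ b₀ n ρ) :
    6 * phi √(2 * Real.log n) / √(2 * Real.log n) ^ 3 ≤ 15 / 17 / (n * Real.log n ^ (3 / 2 : ℝ)) := by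
  have hl := h.log_ge
  have hn := h.card_ge
  have hL : 0 < Real.log n ^ (3 / 2 : ℝ) := by positivity
  have h1 : 17 / 10 ≤ √Real.pi := Real.le_sqrt_of_sq_le (by linarith [Real.pi_gt_three])
  rw [phi, h.exp_a, h.a_cube, Real.sqrt_mul (by norm_num)]
  have h2 : √(2:ℝ) * √2 = 2 := Real.mul_self_sqrt (by norm_num)
  have h3 : 6 * (1 / (n:ℝ) / (√2 * √Real.pi)) / (2 * √2 * Real.log n ^ (3 / 2 : ℝ))
      = 3 / 2 / √Real.pi / (n * Real.log n ^ (3 / 2 : ℝ)) := by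
    have : √(2:ℝ) ≠ 0 := by positivity
    field_simp
    rw [show √(2:ℝ) ^ 2 = 2 by rw [sq, h2]]
    norm_num
  rw [h3]
  refine div_le_div_of_nonneg_right ?_ (by positivity)
  rw [div_le_div_iff₀ (by linarith) (by norm_num)]
  linarith

lemma soft_remainder_le' (h : LargeSample ρ₀ b₀ n ρ) :
    6 * phi √(2 * Real.log n) / √(2 * Real.log n) ^ 3 ≤ 1 / n := by
  refine h.soft_remainder_le.trans ?_
  have hl := h.log_ge
  have hn := h.card_ge
  have h1 : 1 ≤ Real.log n ^ (3 / 2 : ℝ) := Real.one_le_rpow (by linarith) (by norm_num)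
  rw [div_div, div_le_div_iff₀ (by positivity) (by positivity)]
  nlinarith

lemma inv_le (h : LargeSample ρ₀ b₀ n ρ) : 1 / (n:ℝ) ≤ Real.log n / √n := by
  have hl := h.log_ge
  have h1 : 1 ≤ √(n:ℝ) := Real.le_sqrt_of_sq_le (by linarith [h.card_ge])
  rw [div_le_div_iff₀ (by linarith [h.card_ge]) h.sqrt_pos]
  calc 1 * √(n:ℝ) ≤ Real.log n * √(n:ℝ) ^ 2 := by nlinarith
    _ = _ := by rw [h.sq_sqrt]

lemma rare_le (h : LargeSample ρ₀ b₀ n ρ) : 196 / (n:ℝ) ^ 2 ≤ 1 / n := by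
  have hn := h.card_ge
  rw [div_le_div_iff₀ (by positivity) (by positivity)]
  nlinarith

/-- The deviation is `b/2`, so the exponent is `b₀² (log n)²/4`, at least `4 log n` once `b₀² log n
≥ 16`. -/
lemma pretest_prob (h : LargeSample ρ₀ b₀ n ρ) : Real.exp (-(n * (b₀ * Real.log n / √n / 2) ^ 2)) ≤ 1 / n ^ 4 := by
  have hn : (0:ℝ) < n := by linarith [h.card_ge]
  have h1 : n * (b₀ * Real.log n / √n / 2) ^ 2 = b₀ ^ 2 * Real.log n ^ 2 / 4 := by
    rw [div_pow, div_pow, h.sq_sqrt]; field_simp; ring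
  have h2 : 1 / (n:ℝ) ^ 4 = Real.exp (-(4 * Real.log n)) := by
    rw [Real.exp_neg, show (4 : ℝ) * Real.log n = (4 : ℕ) * Real.log n by norm_num, Real.exp_nat_mul,
      Real.exp_log hn, one_div]
  rw [h1, h2, Real.exp_le_exp]
  nlinarith [h.pretest, h.log_ge]

lemma log_div_le (h : LargeSample ρ₀ b₀ n ρ) : Real.log n / √n ≤ Real.log n ^ 2 / √n := by
  have := h.sqrt_pos
  have hl := h.log_ge
  gcongr
  nlinarith

lemma sq_div_le_one (h : LargeSample ρ₀ b₀ n ρ) : Real.log n ^ 2 / √n ≤ 1 := by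
  have := h.sqrt_pos
  have h1 := h.cube_le
  have hl := h.log_ge
  have h2 : 0 ≤ Real.log n ^ 2 / √n := by positivity
  nlinarith

end LargeSample

/-! ### Bounds for the integrated regret -/

/-- As `ρ` is of order `a/√n`, variance and regularization bias are both at most of order `a³/√n`
per unit length. The window of length `2(x + a)` gives `a⁴/√n` and `x a³/√n`, which are the two
powers of `log n`. -/
lemma regret_le_tailAvg {ρ₀ b₀ ρ K x : ℝ} {n : ℕ} (h : LargeSample ρ₀ b₀ n ρ) (hρ₀ : 0 < ρ₀)
    (hK : 0 ≤ K) (hx : 0 ≤ x) (θ : Fin n → ℝ) :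
    ∫⁻ y, ENNReal.ofReal (regretBound K √(2 * Real.log n) ρ θ y)
      ≤ ENNReal.ofReal ((8 * (4 * K / ρ₀ + 6 * ρ₀) + 4 * (K + 12)) * (Real.log n ^ 2 / √n
        + tailAvg θ x + x * (Real.log n ^ (3 / 2 : ℝ) / √n))) := by
  refine (lintegral_regretBound_le_tailAvg h.n_pos hK h.two_le_a h.exp_a h.rho_ge hx θ).trans
    (ENNReal.ofReal_le_ofReal ?_)
  have hs := h.sqrt_pos
  have hl := h.log_ge
  have ha := h.two_le_a
  have hn : (0:ℝ) < n := by linarith [h.card_ge]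
  have hta := tailAvg_nonneg θ x
  have hW := h.a_cube_le
  have h1 := h.cube_div_le hρ₀
  have h2 := h.upper
  have h3 := h.inv_le
  have ha2 := h.sq_a
  set L := Real.log n
  set a := √(2 * L)
  set W := L ^ (3 / 2 : ℝ)
  have hW0 : 0 < W := by positivity
  have h4 : K * (a ^ 3 / (n * ρ)) + 4 * a ^ 2 * ρ ≤ (4 * K / ρ₀ + 6 * ρ₀) * (a ^ 3 / √n) := by
    have h5 : L ≤ a ^ 3 := by nlinarith
    calc _ ≤ K * (4 / ρ₀ * (a ^ 3 / √n)) + 4 * a ^ 2 * (3 * ρ₀ / 2 * a / √n) := by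
          gcongr; exact h1.trans (by gcongr)
      _ = _ := by ring
  have h6 : a ^ 3 / √n * (2 * (x + a)) ≤ 8 * (L ^ 2 / √n) + 6 * (x * (W / √n)) := by
    have h7 : a ^ 3 * (2 * (x + a)) ≤ 8 * L ^ 2 + 6 * (x * W) := by
      have : a ^ 3 * a = 4 * L ^ 2 := by rw [show a ^ 3 * a = (a ^ 2) ^ 2 by ring, ha2]; ring
      nlinarith [mul_le_mul_of_nonneg_left hW hx]
    calc _ = a ^ 3 * (2 * (x + a)) / √n := by ring
      _ ≤ (8 * L ^ 2 + 6 * (x * W)) / √n := by gcongr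
      _ = _ := by ring
  have h8 : a / n ≤ 2 * (L ^ 2 / √n) := by
    calc a / n = a * (1 / n) := by ring
      _ ≤ (2 * L) * (L / √n) := by gcongr; nlinarith
      _ = _ := by ring
  have hxW : 0 ≤ x * (W / √n) := by positivity
  have hV : 0 ≤ L ^ 2 / √n := by positivity
  have hC : 0 ≤ 4 * K / ρ₀ + 6 * ρ₀ := by positivity
  calc _ ≤ (4 * K / ρ₀ + 6 * ρ₀) * (a ^ 3 / √n) * (2 * (x + a))
        + ((K + 2) * tailAvg θ x + (K + 12) * (a / n)) := by
        rw [mul_div_assoc (K + 12)]; gcongr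
    _ ≤ (4 * K / ρ₀ + 6 * ρ₀) * (8 * (L ^ 2 / √n) + 6 * (x * (W / √n)))
        + ((K + 2) * tailAvg θ x + (K + 12) * (2 * (L ^ 2 / √n))) := by
        rw [mul_assoc]; gcongr
    _ ≤ _ := by
        generalize 4 * K / ρ₀ + 6 * ρ₀ = C at *
        generalize x * (W / √n) = X at *
        generalize L ^ 2 / √n = V at *
        nlinarith [mul_nonneg hC hta, mul_nonneg hC hxW, mul_nonneg hK hta, mul_nonneg hK hV,
          mul_nonneg hK hxW]

lemma regret_le_truncSq {ρ₀ b₀ ρ K : ℝ} {n : ℕ} (h : LargeSample ρ₀ b₀ n ρ) (hρ₀ : 0 < ρ₀)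
    (hK : 0 ≤ K) (θ : Fin n → ℝ) (hθ : truncSq θ 1 ≤ Real.log n ^ 2 / √n) :
    ∫⁻ y, ENNReal.ofReal (regretBound K √(2 * Real.log n) ρ θ y)
      ≤ ENNReal.ofReal ((4 * K / ρ₀ + 225 * (K + 12) * ρ₀) * (Real.log n / √n)
        + (2 * K + 400) * truncSq θ 1) := by
  have hs := h.sqrt_pos
  have hl := h.log_ge
  have ha := h.two_le_a
  have hn : (0:ℝ) < n := by linarith [h.card_ge]
  have hρ := h.rho_pos
  have hε := truncSq_nonneg θ zero_le_one
  have h25 : 25 * ρ ≤ Real.exp (-8) := le_trans (by gcongr; exact h.upper) h.rho_le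
  -- The solution of `exp(-T²/2) = 25ρ`. It is at least `4` because `25ρ ≤ exp(-8)`, and at most
  -- `√(2 log n)` because `ρ ≥ 1/n`.
  set T := √(-2 * Real.log (25 * ρ)) with hT
  have hlog : Real.log (25 * ρ) ≤ -8 := by
    rw [← Real.log_exp (-8)]; exact Real.log_le_log (by positivity) h25
  have hT2 : T ^ 2 = -2 * Real.log (25 * ρ) := Real.sq_sqrt (by linarith)
  have hT4 : 4 ≤ T := Real.le_sqrt_of_sq_le (by linarith)
  have hTa : T ≤ √(2 * Real.log n) := by
    refine Real.sqrt_le_sqrt ?_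
    have : -Real.log n ≤ Real.log (25 * ρ) := by
      rw [← Real.log_inv, ← one_div]
      exact Real.log_le_log (by positivity) (h.rho_ge.trans (by linarith))
    linarith
  have hTρ : Real.exp (-T ^ 2 / 2) = 25 * ρ := by
    rw [hT2, show -(-2 * Real.log (25 * ρ)) / 2 = Real.log (25 * ρ) by ring,
      Real.exp_log (by positivity)]
  have hTθ : T ^ 2 * truncSq θ 1 ≤ 1 / 2 := by
    calc T ^ 2 * truncSq θ 1 ≤ √(2 * Real.log n) ^ 2 * (Real.log n ^ 2 / √n) := by gcongr
      _ = 2 * Real.log n * (Real.log n ^ 2 / √n) := by rw [h.sq_a]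
      _ ≤ 1 / 2 := h.cube_le
  refine (lintegral_regretBound_le_truncSq h.n_pos hK (by linarith) hT4 hTρ θ hTθ).trans
    (ENNReal.ofReal_le_ofReal ?_)
  have h1 := h.cube_div_le hρ₀
  have h2 : T * ρ ≤ 3 * ρ₀ * (Real.log n / √n) := by
    calc T * ρ ≤ √(2 * Real.log n) * (3 * ρ₀ / 2 * √(2 * Real.log n) / √n) := by
          gcongr; exact h.upper
      _ = 3 * ρ₀ / 2 * (√(2 * Real.log n) ^ 2 / √n) := by ring
      _ = _ := by rw [h.sq_a]; ring
  calc _ ≤ K * (4 / ρ₀ * (Real.log n / √n)) + ((2 * K + 400) * truncSq θ 1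
        + 75 * (K + 12) * (3 * ρ₀ * (Real.log n / √n))) := by
        rw [mul_assoc _ T]; gcongr
    _ = _ := by ring

/-! ### The oracle inequality for deterministic means -/

/-- The constant in the bound for the variance of the estimated score. -/
def scoreConst (ρ₀ : ℝ) : ℝ := 2 * ((80 + 3840 * (4 / ρ₀ ^ 2)) * (9 + 4 / ρ₀ ^ 2))

/-- The constant in the bound for the integrated regret. -/
def regretConst (ρ₀ b₀ : ℝ) : ℝ :=
  3 * (8 * (4 * scoreConst ρ₀ / ρ₀ + 6 * ρ₀) + 4 * (scoreConst ρ₀ + 12))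
    + (4 * scoreConst ρ₀ / ρ₀ + 225 * (scoreConst ρ₀ + 12) * ρ₀) * (2 / b₀)
    + (2 * scoreConst ρ₀ + 400)

/-- The constant in the oracle inequality for deterministic means. -/
def oracleConst (ρ₀ b₀ : ℝ) : ℝ :=
  10 * regretConst ρ₀ b₀ + 27 * (4 / ρ₀) * (2 / b₀ + 1) + 24 * (1 + 10 * b₀) + (2 / b₀ + 1)

lemma scoreConst_nonneg (ρ₀ : ℝ) : 0 ≤ scoreConst ρ₀ := by unfold scoreConst; positivity

lemma regretConst_nonneg {ρ₀ b₀ : ℝ} (hρ₀ : 0 < ρ₀) (hb₀ : 0 < b₀) : 0 ≤ regretConst ρ₀ b₀ := by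
  have := scoreConst_nonneg ρ₀
  unfold regretConst; positivity

lemma oracleConst_nonneg {ρ₀ b₀ : ℝ} (hρ₀ : 0 < ρ₀) (hb₀ : 0 < b₀) : 0 ≤ oracleConst ρ₀ b₀ := by
  have := regretConst_nonneg hρ₀ hb₀
  unfold oracleConst; positivity

lemma le_regretConst {ρ₀ b₀ : ℝ} (hρ₀ : 0 < ρ₀) (hb₀ : 0 < b₀) :
    3 * (8 * (4 * scoreConst ρ₀ / ρ₀ + 6 * ρ₀) + 4 * (scoreConst ρ₀ + 12)) ≤ regretConst ρ₀ b₀ := by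
  have := scoreConst_nonneg ρ₀
  have h1 : 0 ≤ (4 * scoreConst ρ₀ / ρ₀ + 225 * (scoreConst ρ₀ + 12) * ρ₀) * (2 / b₀) := by
    positivity
  unfold regretConst; linarith

section Regret

variable {ρ₀ b₀ ρ : ℝ} {n : ℕ}

lemma regret_le_const (h : LargeSample ρ₀ b₀ n ρ) (hρ₀ : 0 < ρ₀) (hb₀ : 0 < b₀)
    (θ : Fin n → ℝ) :
    ∫⁻ y, ENNReal.ofReal (regretBound (scoreConst ρ₀) √(2 * Real.log n) ρ θ y)
      ≤ ENNReal.ofReal (regretConst ρ₀ b₀ * 1) := by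
  have hK := scoreConst_nonneg ρ₀
  refine (regret_le_tailAvg h hρ₀ hK le_rfl θ).trans (ENNReal.ofReal_le_ofReal ?_)
  have h1 := h.sq_div_le_one
  have h2 := tailAvg_le_one h.n_pos θ 0
  have h3 := le_regretConst hρ₀ hb₀
  have h4 : 0 ≤ 8 * (4 * scoreConst ρ₀ / ρ₀ + 6 * ρ₀) + 4 * (scoreConst ρ₀ + 12) := by positivity
  calc _ ≤ (8 * (4 * scoreConst ρ₀ / ρ₀ + 6 * ρ₀) + 4 * (scoreConst ρ₀ + 12)) * 3 := by
        gcongr; linarith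
    _ ≤ _ := by linarith

lemma regret_le_tail (h : LargeSample ρ₀ b₀ n ρ) (hρ₀ : 0 < ρ₀) (hb₀ : 0 < b₀)
    (θ : Fin n → ℝ) {x : ℝ} (hx : 0 ≤ x) :
    ∫⁻ y, ENNReal.ofReal (regretBound (scoreConst ρ₀) √(2 * Real.log n) ρ θ y)
      ≤ ENNReal.ofReal (regretConst ρ₀ b₀ * (Real.log n ^ 2 / √n
        + tailAvg θ x + x * (Real.log n ^ (3 / 2 : ℝ) / √n))) := by
  have hK := scoreConst_nonneg ρ₀
  refine (regret_le_tailAvg h hρ₀ hK hx θ).trans (ENNReal.ofReal_le_ofReal ?_)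
  have h2 := tailAvg_nonneg θ x
  have h3 := le_regretConst hρ₀ hb₀
  have h4 : 0 ≤ 8 * (4 * scoreConst ρ₀ / ρ₀ + 6 * ρ₀) + 4 * (scoreConst ρ₀ + 12) := by positivity
  have hl := h.log_ge
  gcongr
  linarith

/-- The lower bound on `kappa` makes `log n/√n` at most a multiple of `truncSq θ 1`, so the
near-zero regime has no additive remainder. If `truncSq θ 1` exceeds `(log n)²/√n`, the tail bound
already suffices. -/
lemma regret_le_trunc (h : LargeSample ρ₀ b₀ n ρ) (hρ₀ : 0 < ρ₀) (hb₀ : 0 < b₀)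
    (θ : Fin n → ℝ) (hκ : b₀ * Real.log n / √n / 2 < kappa θ) :
    ∫⁻ y, ENNReal.ofReal (regretBound (scoreConst ρ₀) √(2 * Real.log n) ρ θ y)
      ≤ ENNReal.ofReal (regretConst ρ₀ b₀ * truncSq θ (Real.log n)) := by
  have hK := scoreConst_nonneg ρ₀
  have hl := h.log_ge
  have hs := h.sqrt_pos
  have hε : b₀ * Real.log n / √n / 2 ≤ truncSq θ 1 := hκ.le.trans (kappa_le_truncSq h.n_pos θ)
  have hmono : truncSq θ 1 ≤ truncSq θ (Real.log n) := truncSq_mono θ (by linarith)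
  have h0 := truncSq_nonneg θ zero_le_one
  have h4 : 0 ≤ 8 * (4 * scoreConst ρ₀ / ρ₀ + 6 * ρ₀) + 4 * (scoreConst ρ₀ + 12) := by positivity
  have h5 : 0 ≤ 4 * scoreConst ρ₀ / ρ₀ + 225 * (scoreConst ρ₀ + 12) * ρ₀ := by positivity
  have hLε : Real.log n / √n ≤ 2 / b₀ * truncSq θ 1 := by
    calc Real.log n / √n = 2 / b₀ * (b₀ * Real.log n / √n / 2) := by field_simp
      _ ≤ _ := by gcongr
  rcases le_or_gt (truncSq θ 1) (Real.log n ^ 2 / √n) with hV | hV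
  · refine (regret_le_truncSq h hρ₀ hK θ hV).trans (ENNReal.ofReal_le_ofReal ?_)
    calc _ ≤ (4 * scoreConst ρ₀ / ρ₀ + 225 * (scoreConst ρ₀ + 12) * ρ₀) * (2 / b₀ * truncSq θ 1)
          + (2 * scoreConst ρ₀ + 400) * truncSq θ 1 := by gcongr
      _ = ((4 * scoreConst ρ₀ / ρ₀ + 225 * (scoreConst ρ₀ + 12) * ρ₀) * (2 / b₀)
          + (2 * scoreConst ρ₀ + 400)) * truncSq θ 1 := by ring
      _ ≤ regretConst ρ₀ b₀ * truncSq θ 1 := by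
          gcongr
          unfold regretConst
          linarith
      _ ≤ _ := by have := regretConst_nonneg hρ₀ hb₀; gcongr
  -- With `x = √(log n)` the linear term equals `(log n)²/√n`, and the tail average is dominated by
  -- the truncated second moment.
  · refine (regret_le_tailAvg h hρ₀ hK (Real.sqrt_nonneg (Real.log n)) θ).trans
      (ENNReal.ofReal_le_ofReal ?_)
    have h6 := tailAvg_sqrt_le θ (show 1 ≤ Real.log n by linarith)
    have h7 : √(Real.log n) * (Real.log n ^ (3 / 2 : ℝ) / √n) = Real.log n ^ 2 / √n := by
      rw [← mul_div_assoc, h.sqrt_mul_rpow]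
    rw [h7]
    calc _ ≤ (8 * (4 * scoreConst ρ₀ / ρ₀ + 6 * ρ₀) + 4 * (scoreConst ρ₀ + 12))
          * (3 * truncSq θ (Real.log n)) := by gcongr; linarith
      _ = 3 * (8 * (4 * scoreConst ρ₀ / ρ₀ + 6 * ρ₀) + 4 * (scoreConst ρ₀ + 12))
          * truncSq θ (Real.log n) := by ring
      _ ≤ _ := by
          have := h0.trans hmono
          gcongr
          exact le_regretConst hρ₀ hb₀

/-- The oracle inequality for deterministic means, given a bound for the integrated regret. -/
lemma avg_hybridRisk_le (h : LargeSample ρ₀ b₀ n ρ) (hρ₀ : 0 < ρ₀) (hb₀ : 0 < b₀)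
    (θ : Fin n → ℝ) {T : ℝ} (hT : truncSq θ (Real.log n) ≤ T ∨ Real.log n ^ 2 / √n ≤ T)
    (hB : b₀ * Real.log n / √n / 2 < kappa θ →
      ∫⁻ y, ENNReal.ofReal (regretBound (scoreConst ρ₀) √(2 * Real.log n) ρ θ y)
      ≤ ENNReal.ofReal (regretConst ρ₀ b₀ * T)) {t : ℝ → ℝ} (ht : Measurable t) :
    (n : ℝ≥0∞)⁻¹ * ∑ k, hybridRisk ρ √(2 * Real.log n) (b₀ * Real.log n / √n) θ k
      ≤ sepRisk θ t + ENNReal.ofReal (oracleConst ρ₀ b₀ * T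
        + 1 / (n * (Real.log n + 1) ^ (3 / 2 : ℝ))) := by
  have hl := h.log_ge
  have hs := h.sqrt_pos
  have hn : (0:ℝ) < n := by linarith [h.card_ge]
  have hp := phi_pos √(2 * Real.log n)
  have ha := h.two_le_a
  have hR := regretConst_nonneg hρ₀ hb₀
  have hV0 : 0 ≤ Real.log n ^ 2 / √n := by positivity
  have hT0 : 0 ≤ T := hT.elim (fun h => (truncSq_nonneg θ (by linarith)).trans h) hV0.trans
  -- A small `kappa` makes soft thresholding good for either form of the target: raising the
  -- truncation level from `1` to `log n` costs a factor `log n`, so the bound is of order `(log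
  -- n)²/√n`.
  have htr : kappa θ ≤ 2 * (b₀ * Real.log n / √n) → truncSq θ (Real.log n) ≤ (1 + 10 * b₀) * T := by
    intro hκ
    rcases hT with hT | hT
    · nlinarith
    · calc truncSq θ (Real.log n) = truncSq θ (Real.log n * 1) := by rw [mul_one]
        _ ≤ Real.log n * truncSq θ 1 := truncSq_mul_le θ (by linarith)
        _ ≤ Real.log n * (5 * (2 * (b₀ * Real.log n / √n))) := by
            gcongr; linarith [truncSq_le_kappa h.n_pos θ]
        _ = 10 * b₀ * (Real.log n ^ 2 / √n) := by ring
        _ ≤ 10 * b₀ * T := by gcongr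
        _ ≤ _ := by linarith
  have hsoft := sepRisk_softThreshold_le h.n_pos θ (l := √(2 * Real.log n)) (by linarith)
  have htr2 : truncSq θ (√(2 * Real.log n) ^ 2) ≤ 2 * truncSq θ (Real.log n) := by
    rw [h.sq_a]; exact truncSq_mul_le θ (by norm_num)
  have hη0 : 0 ≤ 1 / (n * (Real.log n + 1) ^ (3 / 2 : ℝ)) := by positivity
  have hO : 24 * (1 + 10 * b₀) ≤ oracleConst ρ₀ b₀ := by
    have h1 : 0 ≤ 27 * (4 / ρ₀) * (2 / b₀ + 1) := by positivity
    have h2 : 0 ≤ 2 / b₀ + 1 := by positivity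
    unfold oracleConst; linarith
  have hdev := obsLaw_kappaHat_le h.n_pos θ (s := b₀ * Real.log n / √n / 2) (by positivity)
  have hprob := ENNReal.ofReal_le_ofReal h.pretest_prob
  rcases le_or_gt (kappa θ) (b₀ * Real.log n / √n / 2) with hκ | hκ
  -- Here `T` need not dominate the remainders, so they must fit into the explicit additive term
  -- through `slack`. In the other cases `hLT` absorbs them into `T`.
  · refine (avg_hybridRisk_le_of_pretest_rare h.n_pos h.rho_pos h.div_rho_le
      ((measure_mono fun x hx => ?_).trans (hdev.1.trans hprob))).trans ?_
    · simp only [Set.mem_ofPred_eq] at hx ⊢; linarith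
    refine (add_le_add_right hsoft _).trans ?_
    rw [← ENNReal.ofReal_add (by positivity) (by
      have := truncSq_nonneg θ (sq_nonneg √(2 * Real.log n)); positivity)]
    refine le_add_of_nonneg_of_le zero_le (ENNReal.ofReal_le_ofReal ?_)
    have h1 := htr (hκ.trans (by have : 0 ≤ b₀ * Real.log n / √n := by positivity
                                 linarith))
    have h2 := h.slack
    have h3 := h.soft_remainder_le
    nlinarith
  · have hLT : Real.log n / √n ≤ (2 / b₀ + 1) * T := by
      rcases hT with hT | hT
      · calc Real.log n / √n = 2 / b₀ * (b₀ * Real.log n / √n / 2) := by field_simp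
          _ ≤ 2 / b₀ * T := by
            gcongr
            exact hκ.le.trans ((kappa_le_truncSq h.n_pos θ).trans
              ((truncSq_mono θ (by linarith)).trans hT))
          _ ≤ _ := by linarith
      · have : 0 ≤ 2 / b₀ * T := by positivity
        linarith [h.log_div_le]
    have hδ := h.delta_le hρ₀
    have han : √(2 * Real.log n) ^ 2 ≤ n := by rw [h.sq_a]; exact h.log_le
    have hgeb := avg_selfRisk_score_le h.n_pos ha han h.exp_a h.rho_ge (h.Q_le hρ₀)
      (div_le_one_of_le₀ h.exp_bound (by have := h.rho_pos; positivity))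
      (div_le_one_of_le₀ ((pow_le_pow_right₀ (by linarith) (by norm_num)).trans h.cube_a_le)
        (by have := h.rho_pos; positivity)) (by positivity) θ (hB hκ) ht
    have hδ0 : 0 ≤ √(2 * Real.log n) ^ 2 / (n * ρ) := by have := h.rho_pos; positivity
    have hδT : 27 * (√(2 * Real.log n) ^ 2 / (n * ρ)) ≤ 27 * (4 / ρ₀) * (2 / b₀ + 1) * T := by
      calc _ ≤ 27 * (4 / ρ₀ * ((2 / b₀ + 1) * T)) := by
            gcongr; exact hδ.trans (by gcongr)
        _ = _ := by ring
    rcases le_or_gt (kappa θ) (2 * (b₀ * Real.log n / √n)) with hκ2 | hκ2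
    · refine avg_hybridRisk_le_add_soft.trans ((add_le_add hgeb hsoft).trans ?_)
      rw [add_assoc, ← ENNReal.ofReal_add (by positivity) (by
        have := truncSq_nonneg θ (sq_nonneg √(2 * Real.log n)); positivity)]
      refine add_le_add_right (ENNReal.ofReal_le_ofReal ?_) _
      have h1 := htr hκ2
      have h2 := h.soft_remainder_le'.trans (h.inv_le.trans hLT)
      unfold oracleConst
      linarith
    · refine (avg_hybridRisk_le_add_rare h.n_pos (h.log_le.trans (by nlinarith [h.card_ge]))
        ((measure_mono fun x hx => ?_).trans (hdev.2.trans hprob))).trans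
        ((add_le_add_left hgeb _).trans ?_)
      · have : 0 ≤ b₀ * Real.log n / √n := by positivity
        simp only [Set.mem_ofPred_eq] at hx ⊢; linarith
      rw [add_assoc, ← ENNReal.ofReal_add (by positivity) (by positivity)]
      refine add_le_add_right (ENNReal.ofReal_le_ofReal ?_) _
      have h2 := h.rare_le.trans (h.inv_le.trans hLT)
      have h3 : 0 ≤ 24 * (1 + 10 * b₀) * T := by positivity
      unfold oracleConst
      linarith

end Regret

/-! ### Large samples are eventual -/

lemma eventually_pow_le_exp (C : ℝ) : ∀ᶠ x : ℝ in atTop, C * x ^ 3 ≤ Real.exp (x / 4) := by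
  have h := Real.tendsto_pow_mul_exp_neg_atTop_nhds_zero 3
  have h1 : Tendsto (fun x : ℝ => C * 64 * ((x / 4) ^ 3 * Real.exp (-(x / 4)))) atTop (𝓝 (C * 64 * 0)) :=
    (h.comp (tendsto_id.atTop_div_const (by norm_num))).const_mul _
  rw [mul_zero] at h1
  filter_upwards [h1.eventually (gt_mem_nhds zero_lt_one)] with x hx
  rw [Real.exp_neg] at hx
  have h2 := Real.exp_pos (x / 4)
  have h3 : C * x ^ 3 = (C * 64 * ((x / 4) ^ 3 * (Real.exp (x / 4))⁻¹)) * Real.exp (x / 4) := by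
    field_simp; ring
  rw [h3]
  nlinarith

/-- For `x ≥ 33`, passing from `x` to `x + 1` costs at most `(34/33)^{3/2} ≤ 17/16`. This leaves
`16/17 = 15/17 + 1/17`, and the last part covers the rare-event term. -/
lemma slack_le {x : ℝ} (hx : 33 ≤ x) (h : 1000000 * x ^ 3 ≤ Real.exp (x / 4)) :
    15 / 17 / (Real.exp x * x ^ (3 / 2 : ℝ)) + 196 / Real.exp x ^ 2
      ≤ 1 / (Real.exp x * (x + 1) ^ (3 / 2 : ℝ)) := by
  have hx0 : 0 < x := by linarith
  have hE := Real.exp_pos x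
  have hA : 0 < x ^ (3 / 2 : ℝ) := by positivity
  have hB : 0 < (x + 1) ^ (3 / 2 : ℝ) := by positivity
  have h1 : (x + 1) ^ (3 / 2 : ℝ) ≤ 17 / 16 * x ^ (3 / 2 : ℝ) := by
    calc (x + 1) ^ (3 / 2 : ℝ) ≤ (34 / 33 * x) ^ (3 / 2 : ℝ) := by
          gcongr; linarith
      _ = (34 / 33) ^ (3 / 2 : ℝ) * x ^ (3 / 2 : ℝ) := Real.mul_rpow (by norm_num) hx0.le
      _ ≤ _ := by
          gcongr
          calc (34 / 33 : ℝ) ^ (3 / 2 : ℝ) ≤ (34 / 33 : ℝ) ^ (2 : ℝ) :=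
                Real.rpow_le_rpow_of_exponent_le (by norm_num) (by norm_num)
            _ ≤ _ := by rw [Real.rpow_ofNat]; norm_num
  have h2 : x ^ (3 / 2 : ℝ) ≤ x ^ 3 := by
    rw [← Real.rpow_ofNat]
    exact Real.rpow_le_rpow_of_exponent_le (by linarith) (by norm_num)
  have h3 : Real.exp (x / 4) ≤ Real.exp x := Real.exp_le_exp.2 (by linarith)
  have h4 : 196 / Real.exp x ^ 2 ≤ 1 / 17 / (Real.exp x * x ^ (3 / 2 : ℝ)) := by
    rw [div_div, div_le_div_iff₀ (by positivity) (by positivity)]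
    have : 196 * 17 * x ^ (3 / 2 : ℝ) ≤ Real.exp x := by linarith
    nlinarith
  calc _ ≤ 15 / 17 / (Real.exp x * x ^ (3 / 2 : ℝ)) + 1 / 17 / (Real.exp x * x ^ (3 / 2 : ℝ)) := by
        gcongr
    _ = 1 / (Real.exp x * (17 / 16 * x ^ (3 / 2 : ℝ))) := by field_simp; norm_num
    _ ≤ _ := by gcongr

lemma eventually_largeSample {ρ₀ b₀ : ℝ} (hρ₀ : 0 < ρ₀) (hb₀ : 0 < b₀) {ζ ρ : ℕ → ℝ}
    (hζ : Tendsto ζ atTop (𝓝 0))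
    (hρ : ∀ n, 2 ≤ n → ρ n = (1 + ζ n) * ρ₀ * √(2 * Real.log n / n)) :
    ∀ᶠ n : ℕ in atTop, LargeSample ρ₀ b₀ n (ρ n) := by
  have hlog : Tendsto (fun n : ℕ => Real.log n) atTop atTop :=
    Real.tendsto_log_atTop.comp tendsto_natCast_atTop_atTop
  have hz : ∀ᶠ n in atTop, |ζ n| < 1 / 2 := by
    have := hζ.abs
    rw [abs_zero] at this
    exact this.eventually (gt_mem_nhds (by norm_num))
  filter_upwards [hz, eventually_ge_atTop 196, hlog.eventually_ge_atTop 33,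
    hlog.eventually_ge_atTop (16 / b₀ ^ 2), hlog.eventually (eventually_pow_le_exp 1000000),
    hlog.eventually (eventually_pow_le_exp (4 / ρ₀)),
    hlog.eventually (eventually_pow_le_exp (75 * ρ₀ * Real.exp 8))] with n hz hn h33 hb h1 h2 h3
  have hn' : (196:ℝ) ≤ n := by exact_mod_cast hn
  have hn0 : (0:ℝ) < n := by linarith
  have hsq : √(n:ℝ) = Real.exp (Real.log n / 2) := by
    rw [Real.exp_half, Real.exp_log hn0]
  have hρn := hρ n (by omega)
  rw [Real.sqrt_div (by linarith)] at hρn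
  have hz' := abs_lt.1 hz
  have hexp := Real.exp_log hn0
  have hd : ρ n = (1 + ζ n) * (ρ₀ * √(2 * Real.log n) / √n) := by rw [hρn]; ring
  have hd0 : 0 ≤ ρ₀ * √(2 * Real.log n) / √n := by positivity
  set x := Real.log n with hx
  -- Valid for `x ≥ 32`. With `√n = exp(x/2)`, one factor `exp(x/4)` pays for `exp √(2x)` and the
  -- other for powers of `x`.
  have ha : √(2 * x) ≤ x / 4 := Real.sqrt_le_iff.2 ⟨by linarith, by nlinarith⟩
  have he4 : Real.exp (x / 4) * Real.exp (x / 4) = Real.exp (x / 2) := by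
    rw [← Real.exp_add]; ring_nf
  have he0 := Real.exp_pos (x / 4)
  have hle2 : Real.exp (x / 4) ≤ Real.exp (x / 2) := Real.exp_le_exp.2 (by linarith)
  have hx1 : x ≤ x ^ 3 := by nlinarith [sq_nonneg x, mul_nonneg (by linarith : 0 ≤ x) (sq_nonneg x)]
  refine ⟨?_, ?_, by linarith, hn', ?_, ?_, ?_, ?_, ?_, ?_⟩
  · rw [hd]; calc _ = 1 / 2 * (ρ₀ * √(2 * x) / √n) := by ring
      _ ≤ _ := by gcongr; linarith
  · rw [hd]; calc _ ≤ 3 / 2 * (ρ₀ * √(2 * x) / √n) := by gcongr; linarith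
      _ = _ := by ring
  · rw [hsq, ← he4]
    have h4 : 2 * x ≤ ρ₀ / 2 * Real.exp (x / 4) := by
      have h5 : 4 / ρ₀ * x ≤ Real.exp (x / 4) := le_trans (by gcongr) h2
      calc 2 * x = ρ₀ / 2 * (4 / ρ₀ * x) := by field_simp; norm_num
        _ ≤ _ := by gcongr
    calc _ ≤ ρ₀ / 2 * Real.exp (x / 4) * Real.exp (x / 4) := by gcongr
      _ = _ := by ring
  · have : Real.exp (x / 4) ≤ Real.exp x := Real.exp_le_exp.2 (by linarith)
    linarith
  · rw [hsq, ← mul_div_assoc, div_le_iff₀ (Real.exp_pos _)]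
    have h4 : 75 * ρ₀ * Real.exp 8 * x ≤ Real.exp (x / 2) :=
      le_trans (by gcongr) (h3.trans hle2)
    calc 25 * (3 * ρ₀ / 2 * √(2 * x)) ≤ 25 * (3 * ρ₀ / 2 * (2 * x)) := by gcongr; linarith
      _ = Real.exp (-8) * (75 * ρ₀ * Real.exp 8 * x) := by
          have : Real.exp (-8) * Real.exp 8 = 1 := by rw [← Real.exp_add]; simp
          linear_combination (-75 * ρ₀ * x) * this
      _ ≤ _ := by gcongr
  · rw [hsq, ← mul_div_assoc, div_le_iff₀ (Real.exp_pos _)]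
    nlinarith [pow_pos (by linarith : 0 < x) 3]
  · rw [div_le_iff₀ (by positivity)] at hb; linarith
  · have := slack_le h33 h1
    rwa [hexp] at this

/-! ### Random means -/

lemma lintegral_mixture {Ω : Type*} [MeasurableSpace Ω] {P : Measure Ω} {n : ℕ}
    {θ : Ω → Fin n → ℝ} (hθ : Measurable θ) {f : ℝ → ℝ≥0∞} (hf : Measurable f) :
    ∫⁻ u, f u ∂(mixture P θ) = ∫⁻ ω, (n : ℝ≥0∞)⁻¹ * ∑ k, f (θ ω k) ∂P := by
  have hm : ∀ k, Measurable fun ω => θ ω k := fun k => (measurable_pi_apply k).comp hθ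
  have hfm : ∀ k, Measurable fun ω => f (θ ω k) := fun k => hf.comp (hm k)
  rw [mixture, lintegral_smul_measure, lintegral_finsetSum_measure, lintegral_const_mul _
    (Finset.measurable_sum _ fun k _ => hfm k), lintegral_finsetSum _
    fun k _ => hfm k, smul_eq_mul]
  congr 1
  exact Finset.sum_congr rfl fun k _ => lintegral_map hf (hm k)

section NormalMeans

variable {Ω : Type*} [MeasurableSpace Ω] {P : Measure Ω} [IsProbabilityMeasure P] {n : ℕ}
  {θ X : Ω → Fin n → ℝ}

/-- Disintegration of the joint law along the means; from here on only the product normal law given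
the means is used. -/
lemma NormalMeans.lintegral_eq (h : NormalMeans P θ X) {F : (Fin n → ℝ) → (Fin n → ℝ) → ℝ≥0∞}
    (hF : Measurable (Function.uncurry F)) :
    ∫⁻ ω, F (θ ω) (X ω) ∂P = ∫⁻ ω, (∫⁻ x, F (θ ω) x ∂(obsLaw (θ ω))) ∂P := by
  have h1 : (P.map θ) ⊗ₘ condDistrib X θ P = P.map fun ω => (θ ω, X ω) :=
    compProd_map_condDistrib h.measurable_obs.aemeasurable
  calc ∫⁻ ω, F (θ ω) (X ω) ∂P
      = ∫⁻ z, Function.uncurry F z ∂(P.map fun ω => (θ ω, X ω)) := by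
        rw [lintegral_map hF (h.measurable_mean.prodMk h.measurable_obs)]; rfl
    _ = ∫⁻ t, (∫⁻ x, F t x ∂(condDistrib X θ P t)) ∂(P.map θ) := by
        rw [← h1, Measure.lintegral_compProd hF]; rfl
    _ = ∫⁻ ω, (∫⁻ x, F (θ ω) x ∂(condDistrib X θ P (θ ω))) ∂P := by
        rw [lintegral_map (hF.lintegral_kernel_prod_right) h.measurable_mean]
    _ = _ := by
        refine lintegral_congr_ae ?_
        filter_upwards [ae_of_ae_map h.measurable_mean.aemeasurable h.condLaw] with ω hω
        rw [hω]; rfl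

lemma isProbabilityMeasure_mixture (hn : 0 < n) (hθ : Measurable θ) :
    IsProbabilityMeasure (mixture P θ) := by
  refine ⟨?_⟩
  have h : ∀ k, (P.map fun ω => θ ω k) Set.univ = 1 := fun k => by
    have := Measure.isProbabilityMeasure_map (μ := P)
      ((measurable_pi_apply k).comp hθ).aemeasurable
    exact this.measure_univ
  simp only [mixture, Measure.smul_apply, Measure.finsetSum_apply, h, smul_eq_mul]
  simp only [Finset.sum_const, Finset.card_univ, Fintype.card_fin, nsmul_eq_mul, mul_one]
  exact ENNReal.inv_mul_cancel (by exact_mod_cast hn.ne') (by simp)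

lemma measurable_lintegral_loss {t : ℝ → ℝ} (ht : Measurable t) :
    Measurable fun u : ℝ => ∫⁻ y, ENNReal.ofReal ((t y - u) ^ 2) ∂(gaussianReal u 1) := by
  have h1 : ∀ u : ℝ, ∫⁻ y, ENNReal.ofReal ((t y - u) ^ 2) ∂(gaussianReal u 1)
      = ∫⁻ y, ENNReal.ofReal (phi (y - u)) * ENNReal.ofReal ((t y - u) ^ 2) := fun u =>
    lintegral_gaussianReal_one u (F := fun y => ENNReal.ofReal ((t y - u) ^ 2)) (by fun_prop)
  simp_rw [h1]
  have h2 : Measurable fun z : ℝ × ℝ => phi (z.2 - z.1) :=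
    continuous_phi.measurable.comp (measurable_snd.sub measurable_fst)
  have h3 : Measurable fun z : ℝ × ℝ => t z.2 := ht.comp measurable_snd
  exact (h2.ennreal_ofReal.mul
    ((h3.sub measurable_fst).pow_const 2).ennreal_ofReal).lintegral_prod_right'

lemma bayesRisk_mixture (hθ : Measurable θ) {t : ℝ → ℝ} (ht : Measurable t) :
    bayesRisk t (mixture P θ) = ∫⁻ ω, sepRisk (θ ω) t ∂P :=
  lintegral_mixture hθ (measurable_lintegral_loss ht)

lemma lintegral_tailAvg (hn : 0 < n) (hθ : Measurable θ) (x : ℝ) :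
    ∫⁻ ω, ENNReal.ofReal (tailAvg (θ ω) x) ∂P = ENNReal.ofReal (tail (mixture P θ) x) := by
  have := isProbabilityMeasure_mixture (P := P) hn hθ
  have hS : MeasurableSet {u : ℝ | x < |u|} := measurableSet_lt measurable_const measurable_abs
  rw [tail, ofReal_measureReal, ← lintegral_indicator_one hS, lintegral_mixture hθ
    (measurable_one.indicator hS)]
  refine lintegral_congr fun ω => ?_
  rw [tailAvg, ofReal_avg hn fun k => Set.indicator_nonneg (fun _ _ => zero_le_one) _]
  congr 1
  refine Finset.sum_congr rfl fun k _ => ?_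
  simp only [Set.indicator_apply, Set.mem_Ioi, Set.mem_ofPred_eq, Pi.one_apply]
  split_ifs <;> simp

lemma lintegral_truncSq (hn : 0 < n) (hθ : Measurable θ) {c : ℝ} (hc : 0 ≤ c) :
    ∫⁻ ω, ENNReal.ofReal (truncSq (θ ω) c) ∂P
      = ∫⁻ u, ENNReal.ofReal (min (u ^ 2) c) ∂(mixture P θ) := by
  rw [lintegral_mixture hθ (by fun_prop)]
  refine lintegral_congr fun ω => ?_
  rw [truncSq, ofReal_avg hn fun k => le_min (sq_nonneg _) hc]

end NormalMeans

lemma antitone_tail (G : Measure ℝ) [IsProbabilityMeasure G] : Antitone (tail G) := fun x y h =>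
  measureReal_mono fun u hu => by simp only [Set.mem_ofPred_eq] at hu ⊢; linarith

/-- Layer-cake formula: for `0 < v < c`, `min(u², c) > v` exactly when `|u| > √v`. -/
lemma lintegral_min_sq (G : Measure ℝ) [IsProbabilityMeasure G] {c : ℝ} (hc : 0 ≤ c) :
    ∫⁻ u, ENNReal.ofReal (min (u ^ 2) c) ∂G = ENNReal.ofReal (∫ v in (0 : ℝ)..c, tail G √v) := by
  have hanti : Antitone fun v => tail G √v := fun v w h => antitone_tail G (Real.sqrt_le_sqrt h)
  have hi : IntegrableOn (fun v => tail G √v) (Set.Ioc 0 c) :=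
    (intervalIntegrable_iff_integrableOn_Ioc_of_le hc).1 (hanti.intervalIntegrable)
  rw [lintegral_eq_lintegral_meas_lt G (ae_of_all _ fun u => le_min (sq_nonneg u) hc)
    (by fun_prop), intervalIntegral.integral_of_le hc, integral_Ioc_eq_integral_Ioo,
    ofReal_integral_eq_lintegral_ofReal (hi.mono_set Set.Ioo_subset_Ioc_self)
    (ae_of_all _ fun v => measureReal_nonneg)]
  rw [← lintegral_indicator measurableSet_Ioo, ← lintegral_indicator measurableSet_Ioi]
  refine lintegral_congr fun v => ?_
  simp only [Set.indicator_apply, Set.mem_Ioi, Set.mem_Ioo]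
  by_cases hv : 0 < v
  · by_cases hvc : v < c
    · simp only [hv, hvc, and_self, if_true]
      rw [tail, ofReal_measureReal]
      congr 1
      ext u
      simp only [Set.mem_ofPred_eq, lt_min_iff, hvc, and_true]
      rw [← Real.sqrt_sq_eq_abs, Real.sqrt_lt_sqrt_iff hv.le]
    · simp only [hv, hvc, and_false, if_true, if_false]
      simp [hvc]
  · simp [hv]

/-! ### The risk of the hybrid rule for random means -/

lemma measurable_apply_self {n : ℕ} {s : (Fin n → ℝ) → ℝ → ℝ}
    (hs : Measurable fun z : (Fin n → ℝ) × ℝ => s z.1 z.2) (k : Fin n) :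
    Measurable fun x => s x (x k) :=
  hs.comp (measurable_id.prodMk (measurable_pi_apply k))

lemma measurable_hybridRule {n : ℕ} {ρ l : ℝ} (hρ : 0 < ρ) (hl : 0 ≤ l) (b : ℝ) (k : Fin n) :
    Measurable fun x : Fin n → ℝ => hybridRule ρ l b x (x k) := by
  classical
  have hk : Measurable fun x : Fin n → ℝ => x k := measurable_pi_apply k
  have hs := measurable_apply_self (s := score √(2 * Real.log n) ρ)
    (continuous_score √(2 * Real.log n) hρ).measurable k
  have ht := (continuous_softThreshold hl).measurable.comp hk
  have h : (fun x : Fin n → ℝ => hybridRule ρ l b x (x k))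
      = {x | b < kappaHat x}.piecewise (fun x => x k + score √(2 * Real.log n) ρ x (x k))
        (softThreshold l ∘ fun x => x k) := by
    ext x
    simp only [hybridRule, Set.piecewise, gebRule_eq, score, Set.mem_ofPred_eq, Function.comp]
  rw [h]
  exact (hk.add hs).piecewise (measurableSet_pretest b) ht

lemma abs_hybridRule_sub_le {n : ℕ} (hn : 0 < n) {ρ : ℝ} (hρ : 0 < ρ) (b : ℝ) (x : Fin n → ℝ)
    (y : ℝ) : |hybridRule ρ √(2 * Real.log n) b x y - y|
      ≤ 2 * Real.log n / ρ + √(2 * Real.log n) := by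
  have hL : 0 ≤ 2 * Real.log n := mul_nonneg zero_le_two (Real.log_natCast_nonneg n)
  unfold hybridRule
  split_ifs with h
  · rw [gebRule_eq, add_sub_cancel_left]
    have := abs_score_le hn (Real.sqrt_nonneg (2 * Real.log n)) hρ x y
    rw [Real.sq_sqrt hL] at this
    exact this.trans (le_add_of_nonneg_right (Real.sqrt_nonneg _))
  · exact (abs_softThreshold_sub_le (Real.sqrt_nonneg _) y).trans
      (le_add_of_nonneg_left (by positivity))

section NormalMeans

variable {Ω : Type*} [MeasurableSpace Ω] {P : Measure Ω} [IsProbabilityMeasure P] {n : ℕ}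
  {θ X : Ω → Fin n → ℝ} {ρ b : ℝ}

/-- A bound for the risk of a coordinate. -/
def crudeBound (n : ℕ) (ρ : ℝ) : ℝ := 2 * (2 * Real.log n / ρ + √(2 * Real.log n)) ^ 2 + 2

lemma lintegral_loss_le (h : NormalMeans P θ X) (hn : 0 < n) (hρ : 0 < ρ) (b : ℝ) (k : Fin n) :
    ∫⁻ ω, ENNReal.ofReal
      ((hybridRule ρ √(2 * Real.log n) b (X ω) (X ω k) - θ ω k) ^ 2) ∂P
      ≤ ENNReal.ofReal (crudeBound n ρ) := by
  set D := 2 * Real.log n / ρ + √(2 * Real.log n) with hD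
  have hm : Measurable fun z : (Fin n → ℝ) × (Fin n → ℝ) =>
      ENNReal.ofReal (2 * D ^ 2 + 2 * (z.2 k - z.1 k) ^ 2) := by
    have h1 : Measurable fun z : (Fin n → ℝ) × (Fin n → ℝ) => z.2 k :=
      (measurable_pi_apply k).comp measurable_snd
    have h2 : Measurable fun z : (Fin n → ℝ) × (Fin n → ℝ) => z.1 k :=
      (measurable_pi_apply k).comp measurable_fst
    exact ((((h1.sub h2).pow_const 2).const_mul 2).const_add _).ennreal_ofReal
  calc _ ≤ ∫⁻ ω, ENNReal.ofReal (2 * D ^ 2 + 2 * (X ω k - θ ω k) ^ 2) ∂P := by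
        refine lintegral_mono fun ω => ENNReal.ofReal_le_ofReal ?_
        have h1 := abs_hybridRule_sub_le hn hρ b (X ω) (X ω k)
        have h2 := sq_le_sq' (neg_le_of_abs_le h1) (le_of_abs_le h1)
        set y := hybridRule ρ √(2 * Real.log n) b (X ω) (X ω k)
        nlinarith [sq_nonneg (y - X ω k - (X ω k - θ ω k))]
    _ = ∫⁻ ω, (∫⁻ x, ENNReal.ofReal (2 * D ^ 2 + 2 * (x k - θ ω k) ^ 2) ∂(obsLaw (θ ω))) ∂P :=
        h.lintegral_eq (F := fun t x => ENNReal.ofReal (2 * D ^ 2 + 2 * (x k - t k) ^ 2)) hm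
    _ = ∫⁻ _ω, ENNReal.ofReal (2 * D ^ 2 + 2) ∂P := by
        refine lintegral_congr fun ω => ?_
        rw [lintegral_eval_obsLaw (θ ω) k
          (F := fun y => ENNReal.ofReal (2 * D ^ 2 + 2 * (y - θ ω k) ^ 2)) (by fun_prop)]
        have h := gaussianReal_map_const_add (μ := 0) (v := 1) (θ ω k)
        rw [zero_add] at h
        rw [← h, lintegral_map (by fun_prop) (by fun_prop)]
        simp only [add_sub_cancel_left]
        exact lintegral_quadratic_gaussianReal (by positivity)
    _ = _ := by simp [crudeBound, hD]

lemma integrable_loss (h : NormalMeans P θ X) (hn : 0 < n) (hρ : 0 < ρ) (b : ℝ) (k : Fin n) :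
    Integrable (fun ω =>
      (hybridRule ρ √(2 * Real.log n) b (X ω) (X ω k) - θ ω k) ^ 2) P := by
  have hm : Measurable fun ω => (hybridRule ρ √(2 * Real.log n) b (X ω) (X ω k) - θ ω k) ^ 2 :=
    (((measurable_hybridRule hρ (Real.sqrt_nonneg _) b k).comp h.measurable_obs).sub
      ((measurable_pi_apply k).comp h.measurable_mean)).pow_const 2
  refine (lintegral_ofReal_ne_top_iff_integrable hm.aestronglyMeasurable
    (ae_of_all _ fun ω => sq_nonneg _)).1 ?_
  exact ((lintegral_loss_le h hn hρ b k).trans_lt ENNReal.ofReal_lt_top).ne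

lemma avg_integral_loss_eq (h : NormalMeans P θ X) (hn : 0 < n) (hρ : 0 < ρ) (b : ℝ) :
    (1 / (n:ℝ)) * ∑ k, ∫ ω,
      (hybridRule ρ √(2 * Real.log n) b (X ω) (X ω k) - θ ω k) ^ 2 ∂P
      = (∫⁻ ω, (n : ℝ≥0∞)⁻¹ * ∑ k, ENNReal.ofReal
        ((hybridRule ρ √(2 * Real.log n) b (X ω) (X ω k) - θ ω k) ^ 2) ∂P).toReal := by
  have hi := integrable_loss h hn hρ b
  rw [← integral_finsetSum _ fun k _ => hi k, ← integral_const_mul,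
    integral_eq_lintegral_of_nonneg_ae]
  · congr 1
    refine lintegral_congr fun ω => ofReal_avg hn fun k => sq_nonneg _
  · exact ae_of_all _ fun ω => mul_nonneg (by positivity) (Finset.sum_nonneg fun k _ => sq_nonneg _)
  · exact ((integrable_finsetSum _ fun k _ => hi k).const_mul _).aestronglyMeasurable

lemma lintegral_avg_loss_eq (h : NormalMeans P θ X) (hρ : 0 < ρ) (b : ℝ) :
    ∫⁻ ω, (n : ℝ≥0∞)⁻¹ * ∑ k, ENNReal.ofReal
        ((hybridRule ρ √(2 * Real.log n) b (X ω) (X ω k) - θ ω k) ^ 2) ∂P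
      = ∫⁻ ω, (n : ℝ≥0∞)⁻¹ * ∑ k, hybridRisk ρ √(2 * Real.log n) b (θ ω) k ∂P := by
  have hm : ∀ k, Measurable fun x : Fin n → ℝ => hybridRule ρ √(2 * Real.log n) b x (x k) :=
    measurable_hybridRule hρ (Real.sqrt_nonneg _) b
  have hF : Measurable (Function.uncurry fun t x : Fin n → ℝ => (n : ℝ≥0∞)⁻¹ * ∑ k, ENNReal.ofReal
      ((hybridRule ρ √(2 * Real.log n) b x (x k) - t k) ^ 2)) := by
    refine (Finset.measurable_sum _ fun k _ => ?_).const_mul _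
    exact ((((hm k).comp measurable_snd).sub
      ((measurable_pi_apply k).comp measurable_fst)).pow_const 2).ennreal_ofReal
  rw [h.lintegral_eq hF]
  refine lintegral_congr fun ω => ?_
  have hk : ∀ k, Measurable fun x : Fin n → ℝ => ENNReal.ofReal
      ((hybridRule ρ √(2 * Real.log n) b x (x k) - θ ω k) ^ 2) := fun k =>
    (((hm k).sub_const _).pow_const 2).ennreal_ofReal
  rw [lintegral_const_mul _ (Finset.measurable_sum _ fun k _ => hk k),
    lintegral_finsetSum _ fun k _ => hk k]
  rfl

lemma measurable_sepRisk (hθ : Measurable θ) {t : ℝ → ℝ} (ht : Measurable t) :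
    Measurable fun ω => sepRisk (θ ω) t :=
  (Finset.measurable_sum _ fun k _ => (measurable_lintegral_loss ht).comp
    ((measurable_pi_apply k).comp hθ)).const_mul _

/-- A bound for the risk relative to separable rules, conditionally on the means, is a bound
relative to the ideal Bayes risk. -/
lemma risk_sub_idealRisk_le (h : NormalMeans P θ X) (hn : 0 < n) (hρ : 0 < ρ) {O r Tb : ℝ}
    (hO : 0 ≤ O) (hr : 0 ≤ r) (hTb : 0 ≤ Tb) {T : (Fin n → ℝ) → ℝ} (hT0 : ∀ t, 0 ≤ T t)
    (hT : ∫⁻ ω, ENNReal.ofReal (T (θ ω)) ∂P ≤ ENNReal.ofReal Tb)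
    (hrisk : ∀ (v : Fin n → ℝ) (t : ℝ → ℝ), Measurable t →
      (n : ℝ≥0∞)⁻¹ * ∑ k, hybridRisk ρ √(2 * Real.log n) b v k
      ≤ sepRisk v t + ENNReal.ofReal (O * T v + r)) :
    (1 / (n:ℝ)) * ∑ k, ∫ ω,
      (hybridRule ρ √(2 * Real.log n) b (X ω) (X ω k) - θ ω k) ^ 2 ∂P
      - idealRisk (mixture P θ) ≤ O * Tb + r := by
  have hθ := h.measurable_mean
  rw [avg_integral_loss_eq h hn hρ, lintegral_avg_loss_eq h hρ]
  set R := ∫⁻ ω, (n : ℝ≥0∞)⁻¹ * ∑ k, hybridRisk ρ √(2 * Real.log n) b (θ ω) k ∂P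
  have h1 : ∀ t : ℝ → ℝ, Measurable t →
      R ≤ bayesRisk t (mixture P θ) + ENNReal.ofReal (O * Tb + r) := fun t ht => by
    calc R ≤ ∫⁻ ω, (sepRisk (θ ω) t + (ENNReal.ofReal O * ENNReal.ofReal (T (θ ω))
          + ENNReal.ofReal r)) ∂P := by
          refine lintegral_mono fun ω => (hrisk (θ ω) t ht).trans (le_of_eq ?_)
          rw [ENNReal.ofReal_add (mul_nonneg hO (hT0 _)) hr, ENNReal.ofReal_mul hO]
      _ = bayesRisk t (mixture P θ) + (ENNReal.ofReal O * ∫⁻ ω, ENNReal.ofReal (T (θ ω)) ∂P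
          + ENNReal.ofReal r) := by
          rw [lintegral_add_left (measurable_sepRisk hθ ht), ← bayesRisk_mixture hθ ht,
            lintegral_add_right _ measurable_const, lintegral_const_mul' _ _ ENNReal.ofReal_ne_top]
          simp
      _ ≤ _ := by
          rw [ENNReal.ofReal_add (mul_nonneg hO hTb) hr, ENNReal.ofReal_mul hO]
          gcongr
  have h2 : R ≤ (⨅ (t : ℝ → ℝ) (_ : Measurable t), bayesRisk t (mixture P θ))
      + ENNReal.ofReal (O * Tb + r) := by
    rw [iInf_subtype', ENNReal.iInf_add]
    exact le_iInf fun t => h1 t.1 t.2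
  have h3 : (⨅ (t : ℝ → ℝ) (_ : Measurable t), bayesRisk t (mixture P θ)) ≠ ∞ := by
    refine ((iInf₂_le (fun y => y) measurable_id).trans_lt ?_).ne
    rw [bayesRisk_mixture hθ (t := fun y => y) measurable_id]
    simp [sepRisk_id hn]
  have h4 : R.toReal ≤ idealRisk (mixture P θ) + (O * Tb + r) := by
    have h5 := ENNReal.toReal_mono (ENNReal.add_ne_top.2 ⟨h3, ENNReal.ofReal_ne_top⟩) h2
    rwa [ENNReal.toReal_add h3 ENNReal.ofReal_ne_top, ENNReal.toReal_ofReal (by positivity)] at h5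
  linarith

/-- The oracle inequality in terms of the tail of the mixture. -/
lemma risk_le_rTail (h : NormalMeans P θ X) {ρ₀ b₀ : ℝ} (hL : LargeSample ρ₀ b₀ n ρ)
    (hρ₀ : 0 < ρ₀) (hb₀ : 0 < b₀) :
    (1 / (n:ℝ)) * ∑ k, ∫ ω, (hybridRule ρ √(2 * Real.log n) (b₀ * Real.log n / √n) (X ω) (X ω k)
      - θ ω k) ^ 2 ∂P - idealRisk (mixture P θ)
      ≤ oracleConst ρ₀ b₀ * rTail n (mixture P θ)
        + 1 / (n * (Real.log n + 1) ^ (3 / 2 : ℝ)) := by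
  have hn := hL.n_pos
  have hθ := h.measurable_mean
  have hO := oracleConst_nonneg hρ₀ hb₀
  have hl := hL.log_ge
  have hs := hL.sqrt_pos
  have hprob := isProbabilityMeasure_mixture (P := P) hn hθ
  have hr : 0 ≤ 1 / (n * (Real.log n + 1) ^ (3 / 2 : ℝ)) := by positivity
  set S := (1 / (n:ℝ)) * ∑ k, ∫ ω, (hybridRule ρ √(2 * Real.log n) (b₀ * Real.log n / √n) (X ω)
    (X ω k) - θ ω k) ^ 2 ∂P - idealRisk (mixture P θ)
  set r := 1 / (n * (Real.log n + 1) ^ (3 / 2 : ℝ))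
  -- The three members of the minimum come from three choices of `T`: the constant `1`, the
  -- truncated second moment, and the tail bound for each fixed `x ≥ 1`.
  have h1 : S ≤ oracleConst ρ₀ b₀ * 1 + r :=
    risk_sub_idealRisk_le h hn hL.rho_pos hO hr zero_le_one (T := fun _ => 1)
      (fun _ => zero_le_one) (by simp) fun v t ht =>
      avg_hybridRisk_le hL hρ₀ hb₀ v (Or.inr hL.sq_div_le_one)
        (fun _ => regret_le_const hL hρ₀ hb₀ v) ht
  have h2 : S ≤ oracleConst ρ₀ b₀ * (∫ u in (0 : ℝ)..Real.log n, tail (mixture P θ) √u) + r :=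
    risk_sub_idealRisk_le h hn hL.rho_pos hO hr
      (intervalIntegral.integral_nonneg (by linarith) fun _ _ => measureReal_nonneg)
      (T := fun v => truncSq v (Real.log n)) (fun v => truncSq_nonneg v (by linarith))
      (by rw [lintegral_truncSq hn hθ (by linarith), lintegral_min_sq _ (by linarith)])
      fun v t ht => avg_hybridRisk_le hL hρ₀ hb₀ v (Or.inl le_rfl)
        (fun hκ => regret_le_trunc hL hρ₀ hb₀ v hκ) ht
  have h3 : ∀ x : ℝ, 1 ≤ x → S ≤ oracleConst ρ₀ b₀ * (Real.log n ^ 2 / √n + tail (mixture P θ) x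
      + x * (Real.log n ^ (3 / 2 : ℝ) / √n)) + r := fun x hx => by
    have hV : 0 ≤ Real.log n ^ 2 / √n := by positivity
    have hW : 0 ≤ x * (Real.log n ^ (3 / 2 : ℝ) / √n) := by positivity
    have ht0 : 0 ≤ tail (mixture P θ) x := measureReal_nonneg
    refine risk_sub_idealRisk_le h hn hL.rho_pos hO hr (by positivity)
      (T := fun v => Real.log n ^ 2 / √n + tailAvg v x + x * (Real.log n ^ (3 / 2 : ℝ) / √n))
      (fun v => by have := tailAvg_nonneg v x; positivity) ?_
      fun v t ht => avg_hybridRisk_le hL hρ₀ hb₀ v (Or.inr ?_)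
        (fun _ => regret_le_tail hL hρ₀ hb₀ v (by linarith)) ht
    · have h4 : ∀ c : ℝ, 0 ≤ c → ENNReal.ofReal (Real.log n ^ 2 / √n + c
          + x * (Real.log n ^ (3 / 2 : ℝ) / √n)) = ENNReal.ofReal (Real.log n ^ 2 / √n
          + x * (Real.log n ^ (3 / 2 : ℝ) / √n)) + ENNReal.ofReal c := fun c hc => by
        rw [← ENNReal.ofReal_add (by positivity) hc]; congr 1; ring
      rw [h4 _ ht0]
      simp_rw [fun ω => h4 _ (tailAvg_nonneg (θ ω) x)]
      rw [lintegral_add_left measurable_const, lintegral_tailAvg hn hθ]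
      simp
    · have := tailAvg_nonneg v x
      linarith
  have h4 : S ≤ oracleConst ρ₀ b₀ * (Real.log n ^ 2 / √n +
      ⨅ x : Set.Ici (1 : ℝ), (tail (mixture P θ) x + x * (Real.log n ^ (3 / 2 : ℝ) / √n))) + r := by
    have hne : Nonempty (Set.Ici (1:ℝ)) := ⟨⟨1, Set.mem_Ici.2 le_rfl⟩⟩
    -- The infimum over `x` is taken after dividing by the constant; if the constant were zero, `h1`
    -- would already suffice.
    rcases hO.eq_or_lt with hO0 | hO0
    · rw [← hO0] at h1 ⊢; linarith
    have : (S - r) / oracleConst ρ₀ b₀ - Real.log n ^ 2 / √n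
        ≤ ⨅ x : Set.Ici (1 : ℝ), (tail (mixture P θ) x + x * (Real.log n ^ (3 / 2 : ℝ) / √n)) := by
      refine le_ciInf fun x => ?_
      have := h3 x.1 x.2
      rw [sub_le_iff_le_add, div_le_iff₀ hO0]
      linarith
    rw [sub_le_iff_le_add, div_le_iff₀ hO0] at this
    linarith
  rw [rTail]
  rcases min_choice 1 (min (∫ u in (0 : ℝ)..Real.log n, tail (mixture P θ) √u)
    (Real.log n ^ 2 / √n + ⨅ x : Set.Ici (1 : ℝ),
      (tail (mixture P θ) x + x * (Real.log n ^ (3 / 2 : ℝ) / √n)))) with h5 | h5 <;> rw [h5]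
  · exact h1
  · rcases min_choice (∫ u in (0 : ℝ)..Real.log n, tail (mixture P θ) √u)
      (Real.log n ^ 2 / √n + ⨅ x : Set.Ici (1 : ℝ),
        (tail (mixture P θ) x + x * (Real.log n ^ (3 / 2 : ℝ) / √n))) with h6 | h6 <;> rw [h6]
    · exact h2
    · exact h4

end NormalMeans

/-! ### Comparison of the rates -/

lemma rMoment_top {q : ℝ} (hq : 0 < q) {n : ℕ} (hL : 1 ≤ Real.log n) : rMoment q n ∞ = 1 := by
  have hn : 0 < (n:ℝ) := by
    by_contra! h
    rw [le_antisymm h (Nat.cast_nonneg n), Real.log_zero] at hL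
    linarith
  have hW : ENNReal.ofReal (Real.log n ^ (3 / 2 : ℝ) / √n) ≠ 0 := by
    rw [ne_eq, ENNReal.ofReal_eq_zero, not_le]
    have := Real.sqrt_pos.2 hn
    positivity
  rw [rMoment, ENNReal.top_rpow_of_pos hq, ENNReal.top_div_of_ne_top ENNReal.ofReal_ne_top,
    ENNReal.top_mul hW, ENNReal.top_rpow_of_pos (by positivity)]
  simp

lemma rMoment_ofReal {q : ℝ} (hq : 0 < q) {n : ℕ} (hL : 1 ≤ Real.log n) {c : ℝ} (hc : 0 ≤ c) :
    rMoment q n (ENNReal.ofReal c) = min 1 (min (c ^ q / Real.log n ^ (q / 2 - 1))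
      (max (Real.log n ^ 2 / √n)
        ((c * (Real.log n ^ (3 / 2 : ℝ) / √n)) ^ (q / (q + 1))))) := by
  have hW : 0 ≤ Real.log n ^ (3 / 2 : ℝ) / √n := by positivity
  rw [rMoment, ENNReal.ofReal_rpow_of_nonneg hc hq.le, ← ENNReal.ofReal_div_of_pos (by positivity),
    ← ENNReal.ofReal_mul hc, ENNReal.ofReal_rpow_of_nonneg (by positivity) (by positivity),
    ← ENNReal.ofReal_one, ← ENNReal.ofReal_max, ← ENNReal.ofReal_min, ← ENNReal.ofReal_min,
    ENNReal.toReal_ofReal]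
  positivity

/-- Markov at exponent `p`; lowering the exponent only weakens the bound when `c/x ≤ 1`, and
otherwise the right side is at least `1`. -/
lemma tail_le_rpow {G : Measure ℝ} [IsProbabilityMeasure G] {p q c x : ℝ} (hq : 0 < q) (hqp : q ≤ p)
    (hc : 0 ≤ c) (hG : ∫⁻ u, ENNReal.ofReal (|u| ^ p) ∂G ≤ ENNReal.ofReal (c ^ p)) (hx : 0 < x) :
    tail G x ≤ (c / x) ^ q := by
  have hp : 0 < p := hq.trans_le hqp
  have h1 : tail G x ≤ (c / x) ^ p := by
    have hm : Measurable fun u : ℝ => ENNReal.ofReal (|u| ^ p) := by fun_prop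
    have h := (mul_meas_ge_le_lintegral hm (ENNReal.ofReal (x ^ p)) (μ := G)).trans hG
    have h2 : ENNReal.ofReal (tail G x) ≤ G {u | ENNReal.ofReal (x ^ p) ≤ ENNReal.ofReal (|u| ^ p)} := by
      rw [tail, ofReal_measureReal]
      refine measure_mono fun u hu => ?_
      simp only [Set.mem_ofPred_eq] at hu ⊢
      exact ENNReal.ofReal_le_ofReal (Real.rpow_le_rpow hx.le hu.le hp.le)
    have h3 := (mul_le_mul_right h2 (ENNReal.ofReal (x ^ p))).trans h
    rw [← ENNReal.ofReal_mul (by positivity), ENNReal.ofReal_le_ofReal_iff (by positivity)] at h3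
    rw [Real.div_rpow hc hx.le, le_div_iff₀ (by positivity)]
    linarith
  have h0 : 0 ≤ c / x := by positivity
  rcases le_total (c / x) 1 with h | h
  · exact h1.trans (Real.rpow_le_rpow_of_exponent_ge' h0 h hq.le hqp)
  · exact measureReal_le_one.trans (Real.one_le_rpow h hq.le)

lemma lintegral_rpow_le {G : Measure ℝ} [IsProbabilityMeasure G] {p q c : ℝ} (hq : 0 < q)
    (hqp : q ≤ p) (hc : 0 ≤ c) (hG : ∫⁻ u, ENNReal.ofReal (|u| ^ p) ∂G ≤ ENNReal.ofReal (c ^ p)) :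
    ∫⁻ u, ENNReal.ofReal (|u| ^ q) ∂G ≤ ENNReal.ofReal (c ^ q) := by
  have hp : 0 < p := hq.trans_le hqp
  have h := eLpNorm'_le_eLpNorm'_of_exponent_le hq hqp G (f := fun u : ℝ => u) (by fun_prop)
  have h1 : ∀ r : ℝ, 0 ≤ r → ∀ u : ℝ, ‖u‖ₑ ^ r = ENNReal.ofReal (|u| ^ r) := fun r hr u => by
    rw [Real.enorm_eq_ofReal_abs, ENNReal.ofReal_rpow_of_nonneg (abs_nonneg u) hr]
  simp only [eLpNorm'] at h
  simp_rw [h1 q hq.le, h1 p hp.le] at h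
  have h2 : (∫⁻ u, ENNReal.ofReal (|u| ^ p) ∂G) ^ (1 / p) ≤ ENNReal.ofReal c := by
    refine (ENNReal.rpow_le_rpow hG (by positivity)).trans (le_of_eq ?_)
    rw [ENNReal.ofReal_rpow_of_nonneg (by positivity) (by positivity), ← Real.rpow_mul hc,
      mul_one_div_cancel hp.ne', Real.rpow_one]
  rw [← ENNReal.ofReal_rpow_of_nonneg hc hq.le]
  exact (ENNReal.rpow_inv_le_iff hq).1 (by rw [← one_div]; exact h.trans h2)

/-- Interpolation `min(u², L) ≤ L^{1 - q/2} |u|^q`, obtained by splitting the minimum into two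
powers; `q ≤ 2` makes the first exponent nonnegative, which is why the rate uses `min p 2`. -/
lemma integral_tail_le_rpow {G : Measure ℝ} [IsProbabilityMeasure G] {q c L : ℝ} (hq : 0 < q)
    (hq2 : q ≤ 2) (hc : 0 ≤ c) (hL : 0 < L)
    (hG : ∫⁻ u, ENNReal.ofReal (|u| ^ q) ∂G ≤ ENNReal.ofReal (c ^ q)) :
    ∫ v in (0 : ℝ)..L, tail G √v ≤ c ^ q / L ^ (q / 2 - 1) := by
  rw [← ENNReal.ofReal_le_ofReal_iff (by positivity), ← lintegral_min_sq G hL.le]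
  calc _ ≤ ∫⁻ u, ENNReal.ofReal (L ^ (1 - q / 2)) * ENNReal.ofReal (|u| ^ q) ∂G := by
        refine lintegral_mono fun u => ?_
        rw [← ENNReal.ofReal_mul (by positivity)]
        refine ENNReal.ofReal_le_ofReal ?_
        rcases eq_or_ne u 0 with rfl | hu
        · simp only [ne_eq, OfNat.ofNat_ne_zero, not_false_eq_true, zero_pow]
          exact (min_le_left _ _).trans (by positivity)
        have hu0 : 0 < |u| := abs_pos.2 hu
        have hm : 0 < min (u ^ 2) L := lt_min (by positivity) hL
        have h1 : (u ^ 2) ^ (q / 2) = |u| ^ q := by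
          rw [← sq_abs, ← Real.rpow_natCast, ← Real.rpow_mul hu0.le]
          congr 1; push_cast; ring
        calc min (u ^ 2) L = min (u ^ 2) L ^ (1 - q / 2) * min (u ^ 2) L ^ (q / 2) := by
              rw [← Real.rpow_add hm, sub_add_cancel, Real.rpow_one]
          _ ≤ L ^ (1 - q / 2) * (u ^ 2) ^ (q / 2) := by
              gcongr
              · linarith
              · exact min_le_right _ _
              · exact min_le_left _ _
          _ = _ := by rw [h1]
    _ ≤ ENNReal.ofReal (L ^ (1 - q / 2)) * ENNReal.ofReal (c ^ q) := by
        rw [lintegral_const_mul' _ _ ENNReal.ofReal_ne_top]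
        gcongr
    _ = _ := by
        rw [← ENNReal.ofReal_mul (by positivity)]
        congr 1
        rw [show 1 - q / 2 = -(q / 2 - 1) by ring, Real.rpow_neg hL.le]
        field_simp

/-- The optimal `x` equates `(c/x)^q` with `xW`, that is, `x^{q+1} = c^q/W`. If this would be below
`1`, the endpoint `x = 1` gives at most `2W`. -/
lemma iInf_tail_le {G : Measure ℝ} [IsProbabilityMeasure G] {q c W : ℝ} (hq : 0 < q) (hc : 0 ≤ c)
    (hW : 0 < W) (hG : ∀ x, 0 < x → tail G x ≤ (c / x) ^ q) :
    ⨅ x : Set.Ici (1 : ℝ), (tail G x + x * W) ≤ 2 * max W ((c * W) ^ (q / (q + 1))) := by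
  have hbdd : BddBelow (Set.range fun x : Set.Ici (1 : ℝ) => tail G x + x * W) := by
    refine ⟨0, ?_⟩
    rintro _ ⟨x, rfl⟩
    have h1 : (1:ℝ) ≤ x.1 := x.2
    have h2 : 0 ≤ tail G x := measureReal_nonneg
    have : 0 ≤ (x:ℝ) * W := by positivity
    simp only; linarith
  rcases le_or_gt (c ^ q) W with h | h
  · refine (ciInf_le hbdd ⟨1, Set.mem_Ici.2 le_rfl⟩).trans ?_
    have h1 := hG 1 one_pos
    rw [div_one] at h1
    have h2 := le_max_left W ((c * W) ^ (q / (q + 1)))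
    simp only [one_mul]
    linarith
  · have hc0 : 0 < c := by
      rcases hc.eq_or_lt with h0 | h0
      · rw [← h0, Real.zero_rpow hq.ne'] at h; linarith
      · exact h0
    set x := (c ^ q / W) ^ (1 / (q + 1)) with hx
    have hx1 : 1 ≤ x := Real.one_le_rpow ((one_le_div hW).2 h.le) (by positivity)
    have hx0 : 0 < x := by linarith
    refine (ciInf_le hbdd ⟨x, Set.mem_Ici.2 hx1⟩).trans ?_
    have hxq : x ^ (q + 1) = c ^ q / W := by
      rw [hx, ← Real.rpow_mul (by positivity), one_div_mul_cancel (by positivity), Real.rpow_one]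
    have h1 : x * W = (c * W) ^ (q / (q + 1)) := by
      have h2 : (x * W) ^ (q + 1) = (c * W) ^ q := by
        rw [Real.mul_rpow hx0.le hW.le, hxq, Real.mul_rpow hc0.le hW.le, Real.rpow_add hW,
          Real.rpow_one]
        field_simp
      rw [div_eq_mul_inv, Real.rpow_mul (by positivity), ← h2, ← Real.rpow_mul (by positivity),
        mul_inv_cancel₀ (by positivity), Real.rpow_one]
    have h2 : (c / x) ^ q = x * W := by
      rw [Real.div_rpow hc0.le hx0.le, div_eq_iff (by positivity)]
      rw [Real.rpow_add hx0, Real.rpow_one, eq_div_iff hW.ne'] at hxq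
      linarith
    have h3 := hG x hx0
    have h4 := le_max_right W ((c * W) ^ (q / (q + 1)))
    simp only
    linarith

lemma rTail_nonneg (n : ℕ) (G : Measure ℝ) : 0 ≤ rTail n G := by
  have hL := Real.log_natCast_nonneg n
  refine le_min zero_le_one (le_min ?_ ?_)
  · exact intervalIntegral.integral_nonneg hL fun _ _ => measureReal_nonneg
  · refine add_nonneg (by positivity) (Real.iInf_nonneg fun x => ?_)
    have h1 : (1:ℝ) ≤ x.1 := x.2
    exact add_nonneg measureReal_nonneg (by positivity)

/-- The rate in terms of the tail is at most of the order of the rate in terms of the moments. -/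
lemma rTail_le_rMoment {G : Measure ℝ} [IsProbabilityMeasure G] {p : ℝ} (hp : 0 < p) {n : ℕ}
    (hL : 1 ≤ Real.log n) : rTail n G ≤ 3 * rMoment (min p 2) n (moment p G) := by
  have hn : 0 < (n:ℝ) := by
    by_contra! h
    rw [le_antisymm h (Nat.cast_nonneg n), Real.log_zero] at hL
    linarith
  have hs := Real.sqrt_pos.2 hn
  set q := min p 2 with hqd
  have hq : 0 < q := lt_min hp two_pos
  have h1 : rTail n G ≤ 1 := min_le_left _ _
  rcases eq_or_ne (moment p G) ∞ with hC | hC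
  · rw [hC, rMoment_top hq hL]; linarith
  set c := (moment p G).toReal with hcd
  have hc : 0 ≤ c := ENNReal.toReal_nonneg
  have hCc : moment p G = ENNReal.ofReal c := (ENNReal.ofReal_toReal hC).symm
  have hG : ∫⁻ u, ENNReal.ofReal (|u| ^ p) ∂G ≤ ENNReal.ofReal (c ^ p) := by
    rw [← ENNReal.ofReal_rpow_of_nonneg hc hp.le, ← hCc, moment, ← ENNReal.rpow_mul,
      one_div_mul_cancel hp.ne', ENNReal.rpow_one]
  have hqp : q ≤ p := min_le_left _ _
  rw [hCc, rMoment_ofReal hq hL hc, mul_min_of_nonneg _ _ (by norm_num),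
    mul_min_of_nonneg _ _ (by norm_num)]
  refine le_min (by linarith) (le_min ?_ ?_)
  · have h2 := integral_tail_le_rpow hq (min_le_right _ _) hc (by linarith : 0 < Real.log n)
      (lintegral_rpow_le hq hqp hc hG)
    have h3 : 0 ≤ c ^ q / Real.log n ^ (q / 2 - 1) := by positivity
    exact (min_le_right _ _).trans ((min_le_left _ _).trans (by linarith))
  · have hW : 0 < Real.log n ^ (3 / 2 : ℝ) / √n := by positivity
    have h2 := iInf_tail_le hq hc hW fun x hx => tail_le_rpow hq hqp hc hG hx
    have h3 : Real.log n ^ (3 / 2 : ℝ) / √n ≤ Real.log n ^ 2 / √n := by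
      gcongr
      rw [← Real.rpow_ofNat]
      exact Real.rpow_le_rpow_of_exponent_le hL (by norm_num)
    have h4 := le_max_left (Real.log n ^ 2 / √n)
      ((c * (Real.log n ^ (3 / 2 : ℝ) / √n)) ^ (q / (q + 1)))
    have h5 := max_le_max_right ((c * (Real.log n ^ (3 / 2 : ℝ) / √n)) ^ (q / (q + 1))) h3
    exact (min_le_right _ _).trans ((min_le_right _ _).trans (by linarith))

end HybridGEB

end

/-! ### The oracle inequality for all sample sizes -/

theorem theorem6p4 (ρ₀ b₀ : ℝ) (hρ₀ : 0 < ρ₀) (hb₀ : 0 < b₀) :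
    ∃ M : ℝ,
      ∀ (ζ ρ b : ℕ → ℝ), Tendsto ζ atTop (𝓝 0) →
        (∀ n, 2 ≤ n → ρ n = (1 + ζ n) * ρ₀ * √(2 * Real.log n / n)) →
        (∀ n, 2 ≤ n → 0 < ρ n) →
        (∀ n, 2 ≤ n → b n = b₀ * Real.log n / √n) →
        ∃ η : ℕ → ℝ, Tendsto η atTop (𝓝 0) ∧
          ∀ (n : ℕ), 2 ≤ n →
          ∀ (Ω : Type*) [MeasurableSpace Ω] (P : Measure Ω) [IsProbabilityMeasure P]
            (θ X : Ω → Fin n → ℝ), HybridGEB.NormalMeans P θ X →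
            (∀ k, Integrable (fun ω =>
              (HybridGEB.hybridRule (ρ n) √(2 * Real.log n) (b n) (X ω) (X ω k) - θ ω k) ^ 2) P) ∧
            ∀ p : ℝ, 0 < p →
              (1 / n) * ∑ k, ∫ ω,
                  (HybridGEB.hybridRule (ρ n) √(2 * Real.log n) (b n) (X ω) (X ω k)
                    - θ ω k) ^ 2 ∂P
                - HybridGEB.idealRisk (HybridGEB.mixture P θ)
              ≤ M * min (HybridGEB.rTail n (HybridGEB.mixture P θ))
                    (HybridGEB.rMoment (min p 2) n (HybridGEB.moment p (HybridGEB.mixture P θ)))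
                + (1 + η n) / (n * (Real.log n + 1) ^ (3 / 2 : ℝ)) := by
  classical
  -- The factor `3` is the loss in passing from the tail rate to the moment rate.
  refine ⟨3 * HybridGEB.oracleConst ρ₀ b₀, fun ζ ρ b hζ hρ hρ0 hb => ?_⟩
  -- For large `n` no correction is needed. For the finitely many others, `η` is the crude risk
  -- bound times the denominator, which depends on `n` and `ρ n` but not on the law of the means.
  refine ⟨fun n => if HybridGEB.LargeSample ρ₀ b₀ n (ρ n) then 0
    else HybridGEB.crudeBound n (ρ n) * (n * (Real.log n + 1) ^ (3 / 2 : ℝ)), ?_, ?_⟩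
  · refine tendsto_const_nhds.congr' ?_
    filter_upwards [HybridGEB.eventually_largeSample hρ₀ hb₀ hζ hρ] with n hn
    rw [if_pos hn]
  intro n hn Ω _ P _ θ X h
  have hn0 : 0 < n := by omega
  have hO := HybridGEB.oracleConst_nonneg hρ₀ hb₀
  have hr0 := HybridGEB.rTail_nonneg n (HybridGEB.mixture P θ)
  refine ⟨HybridGEB.integrable_loss h hn0 (hρ0 n hn) (b n), fun p hp => ?_⟩
  have hden : (0:ℝ) < n * (Real.log n + 1) ^ (3 / 2 : ℝ) := by
    have h1 := Real.log_natCast_nonneg n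
    have h2 : (0:ℝ) < n := by exact_mod_cast hn0
    positivity
  beta_reduce
  by_cases hL : HybridGEB.LargeSample ρ₀ b₀ n (ρ n)
  · have := HybridGEB.isProbabilityMeasure_mixture (P := P) hn0 h.measurable_mean
    rw [if_pos hL, add_zero, hb n hn]
    refine (HybridGEB.risk_le_rTail h hL hρ₀ hb₀).trans (add_le_add_left ?_ _)
    have h1 := HybridGEB.rTail_le_rMoment (G := HybridGEB.mixture P θ) hp
      (show 1 ≤ Real.log n by linarith [hL.log_ge])
    rw [mul_comm 3, mul_assoc]
    refine mul_le_mul_of_nonneg_left ?_ hO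
    rw [mul_min_of_nonneg _ _ (by norm_num)]
    exact le_min (by linarith) h1
  · rw [if_neg hL]
    have h1 : 0 ≤ HybridGEB.idealRisk (HybridGEB.mixture P θ) := ENNReal.toReal_nonneg
    have h2 : 0 ≤ min (HybridGEB.rTail n (HybridGEB.mixture P θ))
        (HybridGEB.rMoment (min p 2) n (HybridGEB.moment p (HybridGEB.mixture P θ))) :=
      le_min hr0 ENNReal.toReal_nonneg
    have hc : 0 ≤ HybridGEB.crudeBound n (ρ n) := by unfold HybridGEB.crudeBound; positivity
    have h3 : (1 / (n:ℝ)) * ∑ k, ∫ ω, (HybridGEB.hybridRule (ρ n) √(2 * Real.log n) (b n) (X ω)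
        (X ω k) - θ ω k) ^ 2 ∂P ≤ HybridGEB.crudeBound n (ρ n) := by
      rw [← HybridGEB.avg_const hn0 (HybridGEB.crudeBound n (ρ n))]
      refine HybridGEB.avg_le_avg fun k => ?_
      rw [integral_eq_lintegral_of_nonneg_ae (ae_of_all _ fun ω => sq_nonneg _)
        (HybridGEB.integrable_loss h hn0 (hρ0 n hn) (b n) k).aestronglyMeasurable]
      exact ENNReal.toReal_le_of_le_ofReal hc
        (HybridGEB.lintegral_loss_le h hn0 (hρ0 n hn) (b n) k)
    have h4 : HybridGEB.crudeBound n (ρ n)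
        ≤ (1 + HybridGEB.crudeBound n (ρ n) * (n * (Real.log n + 1) ^ (3 / 2 : ℝ)))
          / (n * (Real.log n + 1) ^ (3 / 2 : ℝ)) := by
      rw [le_div_iff₀ hden]; linarith
    have h5 : 0 ≤ 3 * HybridGEB.oracleConst ρ₀ b₀ * min (HybridGEB.rTail n (HybridGEB.mixture P θ))
        (HybridGEB.rMoment (min p 2) n (HybridGEB.moment p (HybridGEB.mixture P θ))) := by
      positivity
    linarith
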